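/- Let $d\ge 1$ be an integer and let $\alpha,\beta\in(0,1]$. All complex powers are principal values: $i^\beta=e^{i\pi\beta/2}$ and $(-i)^\beta=e^{-i\pi\beta/2}$. Let $\|\cdot\|$ be the norm of $L^2(\mathbb R^d)$, let $$\mathcal F u(\xi)=\hat u(\xi)=(2\pi)^{-d/2}\int_{\mathbb R^d}e^{-ix\cdot\xi}u(x)\,dx$$ be the unitary Fourier transform on $L^2(\mathbb R^d)$, and let $\mathcal F^*$ be its adjoint. Let $H_0=-\Delta$ with domain $D(H_0)=H^2(\mathbb R^d)$. For $\gamma\ge 1$ let $H_0^\gamma v=\mathcal F^*(|\xi|^{2\gamma}\hat v)$ with domain $D(H_0^\gamma)=\{v\in L^2(\mathbb R^d): |\xi|^{2\gamma}\hat v\in L^2(\mathbb R^d)\}$ and norm $\|v\|_{D(H_0^\gamma)}=(\|v\|^2+\|H_0^\gamma v\|^2)^{1/2}$. Put $$\mathcal U_{\alpha,\beta}=\begin{cases}D(H_0)&\text{if }\beta>\alpha,\\ D(H_0^{1/\alpha})&\text{if }\beta=\alpha,\\ \mathcal F^*\mathcal C_0(\mathbb R^d)&\text{if }\beta<\alpha,\end{cases}\qquad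 \|v\|_{\mathcal U_{\alpha,\beta}}=\begin{cases}\|v\|_{D(H_0)}&\text{if }\beta>\alpha,\\ \|v\|_{D(H_0^{1/\alpha})}&\text{if }\beta\le\alpha,\end{cases}$$ where $\mathcal C_0(\mathbb R^d)$ is the space of compactly supported continuous functions on $\mathbb R^d$. Let $E_{\alpha,1}(z)=\sum_{n\ge 0}z^n/\Gamma(\alpha n+1)$ be the Mittag-Leffler function. Let $\partial_t^\alpha$ be the Caputo derivative $$\partial_t^\alpha u(t)=\frac1{\Gamma(1-\alpha)}\int_0^t\frac{u'(s)}{(t-s)^\alpha}\,ds\quad(0<\alpha<1),\qquad \partial_t^1u=u',$$ where $u'$ is the weak derivative and the integral is required to converge absolutely in $L^2(\mathbb R^d)$ for a.e. $t$. For $T\in(0,\infty]$, a solution on $(0,T)$ of $$-i^\beta\partial_t^\alpha u+H_0u=0,\qquad u(\cdot,0)=u_0 \tag{$*$}$$ is a function $u\in L^1_{\rm loc}((0,T);D(H_0))\cap W^{1,1}_{\rm loc}((0,T);L^2(\mathbb R^d))$, identified with its representative that is continuous in time with values in $L^2(\mathbb R^d)$, which satisfies the equation a.e. on $\mathbb R^d\times(0,T)$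 and $\lim_{t\downarrow0}\|u(\cdot,t)-u_0\|=0$. **Proposition.** There is a constant $C>0$, depending only on $\alpha$, $\beta$ and $d$, such that the following holds for every $u_0\in\mathcal U_{\alpha,\beta}$. The system $(*)$ has a unique solution $u$ on $(0,\infty)$, and for every $T\in(0,\infty)$ its restriction to $(0,T)$ is the unique solution on $(0,T)$. With $u(\cdot,0)=u_0$, the solution is given by $$u(\cdot,t)=\mathcal F^*\big(E_{\alpha,1}((-i)^\beta|\cdot|^2t^\alpha)\,\hat u_0\big),\qquad t\ge 0.$$ Moreover, for every $T\in(0,\infty)$, $u\in\mathcal C([0,T];D(H_0))\cap W^{1,1}(0,T;L^2(\mathbb R^d))$, and if $\beta\ge\alpha$, then $$\|u\|_{\mathcal C([0,T];D(H_0))}+\|u\|_{W^{1,1}(0,T;L^2(\mathbb R^d))}\le C(1+T)\,\|u_0\|_{\mathcal U_{\alpha,\beta}},$$ whereas if $\beta<\alpha$, then $$\|u\|_{\mathcal C([0,T];D(H_0))}+\|u\|_{W^{1,1}(0,T;L^2(\mathbb R^d))}\le C(1+T)\,e^{\cos\left(\frac{\pi\beta}{2\alpha}\right)\Lambda^{2/\alpha}T}\,\|u_0\|_{\mathcal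 U_{\alpha,\beta}},$$ where $\Lambda=\max\{|\xi|:\xi\in\operatorname{supp}\hat u_0\}$ (and $\Lambda=0$ if $u_0=0$). -/

import Mathlib

open MeasureTheory Filter Topology Set
open scoped ENNReal NNReal FourierTransform SchwartzMap ContDiff Laplacian

noncomputable section

namespace TFSE

/-! ### The spaces -/

/-- The Euclidean space `ℝ^d`. -/
abbrev Sp (d : ℕ) : Type := EuclideanSpace ℝ (Fin d)

/-- The complex Hilbert space `L²(ℝ^d)`. -/
abbrev L2 (d : ℕ) : Type := Lp ℂ 2 (volume : Measure (Sp d))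

/-! ### The unitary Fourier transform

`û(ξ) = (2π)^(-d/2) ∫ exp(-i x·ξ) u(x) dx`.  Mathlib's transform has the kernel
`exp(-2πi x·ξ)`, so it is followed by the unitary dilation by the factor `(2π)⁻¹`. -/

theorem map_dilate {d : ℕ} {c : ℝ} (hc : 0 < c) :
    Measure.map (fun x : Sp d => c • x) volume = ENNReal.ofReal ((c ^ d)⁻¹) • volume := by
  have h := Measure.map_addHaar_smul (volume : Measure (Sp d)) hc.ne'
  rw [finrank_euclideanSpace_fin, abs_of_pos (by positivity)] at h
  exact h

theorem quasi_dilate {d : ℕ} {c : ℝ} (hc : 0 < c) :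
    Measure.QuasiMeasurePreserving (fun x : Sp d => c • x) volume volume := by
  refine ⟨measurable_const_smul c, ?_⟩
  rw [map_dilate hc]
  exact Measure.smul_absolutelyContinuous

theorem memLp_dilate {d : ℕ} {c : ℝ} (hc : 0 < c) (f : L2 d) :
    MemLp (fun x : Sp d => ((c ^ ((d : ℝ) / 2) : ℝ) : ℂ) * f (c • x)) 2 volume := by
  have h1 : MemLp (f : Sp d → ℂ) 2 (Measure.map (fun x : Sp d => c • x) volume) := by
    rw [map_dilate hc]
    exact (Lp.memLp f).smul_measure ENNReal.ofReal_ne_top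
  exact (h1.comp_of_map (measurable_const_smul c).aemeasurable).const_mul _

theorem eLpNorm_dilate {d : ℕ} {c : ℝ} (hc : 0 < c) (f : L2 d) :
    eLpNorm (fun x : Sp d => ((c ^ ((d : ℝ) / 2) : ℝ) : ℂ) * f (c • x)) 2 volume
      = eLpNorm f 2 volume := by
  have h0 : (fun x : Sp d => ((c ^ ((d : ℝ) / 2) : ℝ) : ℂ) * f (c • x))
      = ((c ^ ((d : ℝ) / 2) : ℝ) : ℂ) • ((f : Sp d → ℂ) ∘ fun x => c • x) := rfl
  have hm : AEStronglyMeasurable (f : Sp d → ℂ)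
      (Measure.map (fun x : Sp d => c • x) volume) := by
    rw [map_dilate hc]
    exact (Lp.aestronglyMeasurable f).smul_measure _
  rw [h0, eLpNorm_const_smul, ← eLpNorm_map_measure hm (measurable_const_smul c).aemeasurable,
    map_dilate hc, eLpNorm_smul_measure_of_ne_top (by norm_num), smul_eq_mul, ← mul_assoc]
  have h1 : ‖((c ^ ((d : ℝ) / 2) : ℝ) : ℂ)‖ₑ = ENNReal.ofReal (c ^ ((d : ℝ) / 2)) := by
    rw [← ofReal_norm, Complex.norm_real, Real.norm_of_nonneg (by positivity)]
  rw [h1, ENNReal.ofReal_rpow_of_nonneg (by positivity) (by positivity),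
    ← ENNReal.ofReal_mul (by positivity), Real.inv_rpow (by positivity),
    ← Real.rpow_natCast, ← Real.rpow_mul hc.le]
  have h2 : (d : ℝ) * (1 / (2 : ℝ≥0∞)).toReal = (d : ℝ) / 2 := by
    simp; ring
  rw [h2, mul_inv_cancel₀ (by positivity)]
  simp

/-- The dilation `f ↦ c^(d/2) f(c ·)`, an isometry of `L²(ℝ^d)` for `c > 0`. -/
def dilateₗᵢ (d : ℕ) {c : ℝ} (hc : 0 < c) : L2 d →ₗᵢ[ℂ] L2 d where
  toFun f := (memLp_dilate hc f).toLp
  map_add' f g := by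
    apply Lp.ext
    filter_upwards [(memLp_dilate hc (f + g)).coeFn_toLp, (memLp_dilate hc f).coeFn_toLp,
      (memLp_dilate hc g).coeFn_toLp,
      Lp.coeFn_add (memLp_dilate hc f).toLp (memLp_dilate hc g).toLp,
      (quasi_dilate hc).ae (Lp.coeFn_add f g)] with x h1 h2 h3 h4 h5
    rw [h1, h4, Pi.add_apply, h2, h3, h5, Pi.add_apply, mul_add]
  map_smul' a f := by
    apply Lp.ext
    filter_upwards [(memLp_dilate hc (a • f)).coeFn_toLp, (memLp_dilate hc f).coeFn_toLp,
      Lp.coeFn_smul a (memLp_dilate hc f).toLp,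
      (quasi_dilate hc).ae (Lp.coeFn_smul a f)] with x h1 h2 h4 h5
    rw [h1, RingHom.id_apply, h4, Pi.smul_apply, h2, h5, Pi.smul_apply, smul_eq_mul, smul_eq_mul]
    ring
  norm_map' f := by
    change ‖(memLp_dilate hc f).toLp‖ = ‖f‖
    rw [Lp.norm_toLp, eLpNorm_dilate hc, Lp.norm_def]

theorem dilateₗᵢ_surjective (d : ℕ) {c : ℝ} (hc : 0 < c) :
    Function.Surjective (dilateₗᵢ d hc) := by
  intro g
  have hc' : 0 < c⁻¹ := inv_pos.mpr hc
  refine ⟨dilateₗᵢ d hc' g, ?_⟩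
  apply Lp.ext
  filter_upwards [(memLp_dilate hc (dilateₗᵢ d hc' g)).coeFn_toLp,
    (quasi_dilate hc).ae (memLp_dilate hc' g).coeFn_toLp] with x h1 h2
  change ((memLp_dilate hc (dilateₗᵢ d hc' g)).toLp) x = g x
  rw [h1]
  change _ * ((memLp_dilate hc' g).toLp) (c • x) = g x
  rw [h2, smul_smul, inv_mul_cancel₀ hc.ne', one_smul, ← mul_assoc, ← Complex.ofReal_mul,
    Real.inv_rpow hc.le, mul_inv_cancel₀ (by positivity)]
  simp

/-- The unitary Fourier transform of `L²(ℝ^d)`; its adjoint and inverse is `(fourierL2 d).symm`. -/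
def fourierL2 (d : ℕ) : L2 d ≃ₗᵢ[ℂ] L2 d :=
  (Lp.fourierTransformₗᵢ (Sp d) ℂ).trans
    (LinearIsometryEquiv.ofSurjective
      (dilateₗᵢ d (c := (2 * Real.pi)⁻¹) (by positivity)) (dilateₗᵢ_surjective d _))

/-- On Schwartz functions `fourierL2` is given by the usual integral. -/
theorem fourierL2_toLp (d : ℕ) (f : 𝓢(Sp d, ℂ)) :
    (fourierL2 d (f.toLp 2) : Sp d → ℂ) =ᵐ[volume] fun ξ =>
      (((2 * Real.pi) ^ (-(d : ℝ) / 2) : ℝ) : ℂ) *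
        ∫ x : Sp d, Complex.exp (-Complex.I * ((inner ℝ x ξ : ℝ) : ℂ)) * f x := by
  have hc : 0 < (2 * Real.pi)⁻¹ := by positivity
  have e1 : fourierL2 d (f.toLp 2) = (memLp_dilate hc ((𝓕 f).toLp 2)).toLp := by
    rw [← SchwartzMap.toLp_fourier_eq]
    rfl
  rw [e1]
  filter_upwards [(memLp_dilate hc ((𝓕 f).toLp 2)).coeFn_toLp,
    (quasi_dilate hc).ae ((𝓕 f).coeFn_toLp 2 volume)] with ξ h1 h2
  rw [h1, h2, SchwartzMap.fourier_coe, Real.fourier_eq', Real.inv_rpow (by positivity),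
    ← Real.rpow_neg (by positivity), neg_div]
  congr 1
  refine integral_congr_ae (Eventually.of_forall fun x => ?_)
  simp only [smul_eq_mul, inner_smul_right]
  congr 2
  push_cast
  have : (Real.pi : ℂ) ≠ 0 := by exact_mod_cast Real.pi_ne_zero
  field_simp

/-! ### The operator `H₀ = -Δ` and its powers -/

/-- `D(H₀) = H²(ℝ^d)`. -/
def domH0 (d : ℕ) : Set (L2 d) :=
  {v | TemperedDistribution.MemSobolev 2 2 (v : 𝓢'(Sp d, ℂ))}

theorem exists_neg_laplacian {d : ℕ} {v : L2 d} (hv : v ∈ domH0 d) :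
    ∃ w : L2 d, (w : 𝓢'(Sp d, ℂ)) = -Δ (v : 𝓢'(Sp d, ℂ)) := by
  have h := TemperedDistribution.MemSobolev.laplacian hv
  rw [sub_self, TemperedDistribution.memSobolev_zero_iff] at h
  obtain ⟨w, hw⟩ := h
  refine ⟨-w, ?_⟩
  rw [hw]
  exact map_neg (Lp.toTemperedDistributionCLM ℂ (volume : Measure (Sp d)) 2) w

open Classical in
/-- `H₀ v = -Δ v` in the sense of distributions, for `v ∈ D(H₀)` (and `0` off `D(H₀)`). -/
def H0 {d : ℕ} (v : L2 d) : L2 d :=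
  if hv : v ∈ domH0 d then (exists_neg_laplacian hv).choose else 0

theorem H0_spec {d : ℕ} {v : L2 d} (hv : v ∈ domH0 d) :
    (H0 v : 𝓢'(Sp d, ℂ)) = -Δ (v : 𝓢'(Sp d, ℂ)) := by
  rw [H0, dif_pos hv]
  exact (exists_neg_laplacian hv).choose_spec

open Classical in
/-- The product `m f` if it lies in `L²(ℝ^d)` (and `0` otherwise). -/
def mulL2 {d : ℕ} (m : Sp d → ℂ) (f : L2 d) : L2 d :=
  if h : MemLp (fun ξ => m ξ * f ξ) 2 volume then h.toLp else 0

/-- `D(H₀^γ) = {v ∈ L² : |ξ|^(2γ) v̂ ∈ L²}`. -/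
def domH0pow (d : ℕ) (γ : ℝ) : Set (L2 d) :=
  {v | MemLp (fun ξ : Sp d => ((‖ξ‖ ^ (2 * γ) : ℝ) : ℂ) * fourierL2 d v ξ) 2 volume}

/-- `H₀^γ v = F* (|ξ|^(2γ) v̂)`. -/
def H0pow {d : ℕ} (γ : ℝ) (v : L2 d) : L2 d :=
  (fourierL2 d).symm (mulL2 (fun ξ : Sp d => ((‖ξ‖ ^ (2 * γ) : ℝ) : ℂ)) (fourierL2 d v))

/-- The graph norm of `D(H₀)`. -/
def normH0 {d : ℕ} (v : L2 d) : ℝ := Real.sqrt (‖v‖ ^ 2 + ‖H0 v‖ ^ 2)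

/-- The graph norm of `D(H₀^γ)`. -/
def normH0pow {d : ℕ} (γ : ℝ) (v : L2 d) : ℝ := Real.sqrt (‖v‖ ^ 2 + ‖H0pow γ v‖ ^ 2)

/-! ### Initial data -/

/-- `F* C₀(ℝ^d)`, where `C₀` stands for compactly supported continuous functions. -/
def fourierC0 (d : ℕ) : Set (L2 d) :=
  {v | ∃ f : Sp d → ℂ, Continuous f ∧ HasCompactSupport f ∧ fourierL2 d v =ᵐ[volume] f}

/-- The space `U_{α,β}` of initial data. -/
def initialSpace (d : ℕ) (α β : ℝ) : Set (L2 d) :=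
  if α < β then domH0 d else if α = β then domH0pow d (1 / α) else fourierC0 d

/-- The norm of `U_{α,β}`. -/
def initialNorm {d : ℕ} (α β : ℝ) (v : L2 d) : ℝ :=
  if α < β then normH0 v else normH0pow (1 / α) v

/-- The support of (the class of) a function: the points near which it does not vanish a.e. -/
def suppL2 {d : ℕ} (f : L2 d) : Set (Sp d) :=
  {ξ | ∀ r > 0, ¬ ((f : Sp d → ℂ) =ᵐ[volume.restrict (Metric.ball ξ r)] 0)}

/-- `Λ = max {|ξ| : ξ ∈ supp û₀}` (equal to `0` when `u₀ = 0`). -/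
def freqRadius {d : ℕ} (u₀ : L2 d) : ℝ :=
  sSup ((fun ξ : Sp d => ‖ξ‖) '' suppL2 (fourierL2 d u₀))

/-! ### The Mittag-Leffler function -/

/-- `E_{a,c}(z) = ∑ zⁿ / Γ(a n + c)`. -/
def mittagLeffler (a c : ℝ) (z : ℂ) : ℂ :=
  ∑' n : ℕ, z ^ n / ((Real.Gamma (a * n + c) : ℝ) : ℂ)

/-! ### Functions of time with values in `L²(ℝ^d)` -/

/-- The time interval `(0,T)`, where `T = ⊤` gives `(0,∞)`. -/
def timeInterval (T : EReal) : Set ℝ := {t | 0 < t ∧ (t : EReal) < T}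

/-- `g` is the weak derivative of `u` on `J`, both being locally integrable there. -/
def HasWeakDeriv {d : ℕ} (J : Set ℝ) (u g : ℝ → L2 d) : Prop :=
  LocallyIntegrableOn u J volume ∧ LocallyIntegrableOn g J volume ∧
    ∀ φ : ℝ → ℝ, ContDiff ℝ ∞ φ → HasCompactSupport φ → tsupport φ ⊆ J →
      ∫ t in J, deriv φ t • u t = -∫ t in J, φ t • g t

/-- The Caputo derivative at time `t`, in terms of the derivative `g` of the function:
`Γ(1-α)⁻¹ ∫₀ᵗ (t-s)^(-α) g(s) ds` if `α < 1`, and `g(t)` if `α = 1`. -/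
def caputo {d : ℕ} (α : ℝ) (g : ℝ → L2 d) (t : ℝ) : L2 d :=
  if α = 1 then g t
  else (Real.Gamma (1 - α))⁻¹ • ∫ s in (0 : ℝ)..t, (t - s) ^ (-α) • g s

/-- `w` is the Caputo derivative of order `α ∈ (0,1]` of `u` on `(0,T)`: `u` is weakly
differentiable, and for a.e. `t` the integral that defines the derivative converges
absolutely in `L²(ℝ^d)` and equals `w t`. -/
def HasCaputoDeriv {d : ℕ} (α : ℝ) (T : EReal) (u w : ℝ → L2 d) : Prop :=
  ∃ g : ℝ → L2 d, HasWeakDeriv (timeInterval T) u g ∧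
    ∀ᵐ t ∂(volume.restrict (timeInterval T)),
      (α < 1 → IntervalIntegrable (fun s => (t - s) ^ (-α) • g s) volume 0 t) ∧
        w t = caputo α g t

/-- Solutions of `-i^β ∂_t^α u + H₀ u = 0` on `ℝ^d × (0,T)` with initial state `u₀`:
functions in `L¹_loc(0,T; D(H₀)) ∩ W^{1,1}_loc(0,T; L²)`, identified with their continuous
representatives, for which the equation holds a.e. and `u(t) → u₀` in `L²` as `t ↓ 0`. -/
structure IsSolution {d : ℕ} (α β : ℝ) (u₀ : L2 d) (T : EReal) (u : ℝ → L2 d) : Prop where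
  continuousOn : ContinuousOn u (timeInterval T)
  mem_dom : ∀ᵐ t ∂(volume.restrict (timeInterval T)), u t ∈ domH0 d
  locallyIntegrable_H0 : LocallyIntegrableOn (fun t => H0 (u t)) (timeInterval T) volume
  equation : ∃ w : ℝ → L2 d, HasCaputoDeriv α T u w ∧
    ∀ᵐ t ∂(volume.restrict (timeInterval T)),
      -(Complex.I ^ (β : ℂ)) • w t + H0 (u t) = 0
  initial : Tendsto u (𝓝[>] 0) (𝓝 u₀)

/-- `u ∈ C([0,T]; D(H₀))`, with the graph norm on `D(H₀)`. -/
def MemCDom {d : ℕ} (T : ℝ) (u : ℝ → L2 d) : Prop :=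
  (∀ t ∈ Icc 0 T, u t ∈ domH0 d) ∧ ContinuousOn u (Icc 0 T) ∧
    ContinuousOn (fun t => H0 (u t)) (Icc 0 T)

/-- `u ∈ W^{1,1}(0,T; L²)`. -/
def MemW11 {d : ℕ} (T : ℝ) (u : ℝ → L2 d) : Prop :=
  IntegrableOn u (Ioo 0 T) volume ∧
    ∃ g : ℝ → L2 d, HasWeakDeriv (Ioo 0 T) u g ∧ IntegrableOn g (Ioo 0 T) volume

/-- The norm of `C([0,T]; D(H₀))`, with values in `[0,∞]`. -/
def eNormCDom {d : ℕ} (T : ℝ) (u : ℝ → L2 d) : ℝ≥0∞ :=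
  ⨆ t ∈ Icc 0 T, ENNReal.ofReal (normH0 (u t))

/-- The norm of `W^{1,1}(0,T; L²)`, with values in `[0,∞]`; the infimum runs over the weak
derivatives of `u`, which agree a.e. -/
def eNormW11 {d : ℕ} (T : ℝ) (u : ℝ → L2 d) : ℝ≥0∞ :=
  (∫⁻ t in Ioo 0 T, ‖u t‖ₑ) +
    ⨅ (g : ℝ → L2 d) (_ : HasWeakDeriv (Ioo 0 T) u g), ∫⁻ t in Ioo 0 T, ‖g t‖ₑ

end TFSE

end

noncomputable section

namespace TFSE

/-! On the Fourier side the equation decouples into the scalar equations ∂_t^α y = (-i)^β |ξ|² y,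
solved by E_{α,1}((-i)^β |ξ|² t^α) y(0). Everything rests on the size of E_{α,b} on the ray arg z =
-πβ/2, for b = 1 (the solution) and b = α (its time derivative).

This size is read off a contour integral. In the coordinate w = log p, summing a geometric series
under Hankel's formula for 1/Γ (`hankel_gammaKernel`) represents E_{α,b}(z) as the integral of
exp(e^w + (1-b)w) / (1 - z e^{-αw}) (`mittagLeffler_eq_hankel`). With z = exp(α w₀), the pole that
matters is w₀, of imaginary part -θ, where θ = πβ/(2α). If β > α, then θ > π/2, the contour can
avoid the pole, and E_{α,b} is bounded on the ray (`mittagLeffler_bounded`). If β ≤ α, the pole is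
cancelled by subtracting a multiple of the same integral for the exponential function; what remains
is bounded, and the subtracted term has modulus r^{(1-b)/α} exp(cos θ r^{1/α}) / α, with r = |z|
(`mittagLeffler_growth`).

This explains the three spaces of initial data. For β > α only the factor |ξ|² of the time
derivative has to be absorbed. For β = α there is no exponential growth, since cos θ = 0, but the
algebraic factor makes the time derivative grow like |ξ|^{2/α}. For β < α the growth is exponential
in |ξ|^{2/α} t, which compactly supported frequencies keep finite.

The bounds are collected in `SymbolBound`, from which regularity and norm estimates follow by
domination. The time derivative and the Caputo derivative are identified through the fractional
integrals of orders 1 and 1-α of s^{α-1} E_{α,α}(k s^α), computed term by term from Beta integrals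
(`integral_rpow_mul_mittagLeffler`).

For uniqueness, restricting to |ξ| ≤ R turns H₀ into a bounded operator (`exists_truncation`).
Integration against the conjugate Abel kernel (`integral_abel`) then yields a Volterra equation for
the truncated solution (`IsSolution.volterra`), and a Gronwall argument (`eq_zero_of_le_integral`)
shows that the truncated difference of two solutions vanishes, for every R. -/

/-! ### Hankel contours in logarithmic coordinates -/

/-- The three pieces of the Hankel contour: the segment `Re w = R`, `|Im w| ≤ φ`, and the half
lines `Im w = ±φ`, `Re w > R`. -/
def hankelPath (φ R : ℝ) : Fin 3 → ℝ → ℂ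
  | 0, y => R + y * Complex.I
  | 1, x => x + φ * Complex.I
  | 2, x => x - φ * Complex.I

/-- The parameter measures on the three pieces of the Hankel contour. -/
def hankelMeasure (φ R : ℝ) : Fin 3 → Measure ℝ
  | 0 => volume.restrict (Ioc (-φ) φ)
  | 1 => volume.restrict (Ioi R)
  | 2 => volume.restrict (Ioi R)

/-- The derivative of the parametrization of the pieces of the Hankel contour, with orientation. -/
def hankelCoeff : Fin 3 → ℂ
  | 0 => Complex.I
  | 1 => 1
  | 2 => -1

/-- The integral of `F` over the Hankel contour, divided by `2πi`. -/
def hankel (φ R : ℝ) (F : ℂ → ℂ) : ℂ :=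
  (2 * Real.pi * Complex.I)⁻¹ *
    ∑ j, hankelCoeff j * ∫ x, F (hankelPath φ R j x) ∂(hankelMeasure φ R j)

/-- The Hankel contour as a set. -/
def hankelSet (φ R : ℝ) : Set ℂ :=
  {w | (w.re = R ∧ |w.im| ≤ φ) ∨ (R ≤ w.re ∧ |w.im| = φ)}

theorem continuous_hankelPath (φ R : ℝ) (j : Fin 3) : Continuous (hankelPath φ R j) := by
  fin_cases j
  · change Continuous fun y : ℝ => (R : ℂ) + y * Complex.I
    fun_prop
  · change Continuous fun x : ℝ => (x : ℂ) + φ * Complex.I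
    fun_prop
  · change Continuous fun x : ℝ => (x : ℂ) - φ * Complex.I
    fun_prop

theorem hankelPath_mem {φ R : ℝ} (hφ : 0 ≤ φ) (j : Fin 3) :
    ∀ᵐ x ∂(hankelMeasure φ R j), hankelPath φ R j x ∈ hankelSet φ R := by
  fin_cases j
  · refine (ae_restrict_iff' measurableSet_Ioc).2 (Eventually.of_forall fun y hy => Or.inl ?_)
    simpa [hankelPath, abs_le] using And.intro hy.1.le hy.2
  · refine (ae_restrict_iff' measurableSet_Ioi).2 (Eventually.of_forall fun x hx => Or.inr ?_)
    simpa [hankelPath, abs_of_nonneg hφ] using le_of_lt hx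
  · refine (ae_restrict_iff' measurableSet_Ioi).2 (Eventually.of_forall fun x hx => Or.inr ?_)
    simpa [hankelPath, abs_of_nonneg hφ] using le_of_lt hx

theorem norm_exp_exp_add (k : ℝ) (w : ℂ) :
    ‖Complex.exp (Complex.exp w + k * w)‖
      = Real.exp (Real.cos w.im * Real.exp w.re + k * w.re) := by
  rw [Complex.norm_exp, Complex.add_re, Complex.exp_re, Complex.re_ofReal_mul, mul_comm (Real.exp _)]

/-- Since c < 0 < k + 1, the function c e^x + (k+1)x is bounded above; the convexity inequality for
exp gives the bound. -/
theorem exists_exp_le {k : ℝ} (hk : -1 < k) {c : ℝ} (hc : c < 0) :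
    ∃ M, 0 < M ∧ ∀ x, Real.exp (c * Real.exp x + k * x) ≤ M * Real.exp (-x) := by
  have hk : 0 < k + 1 := by linarith
  have hc' : 0 < -c := by linarith
  -- The point where c e^x + (k+1)x attains its maximum.
  set y0 := Real.log ((k + 1) / -c) with hy0
  refine ⟨Real.exp ((k + 1) * (y0 - 1)), Real.exp_pos _, fun x => ?_⟩
  rw [← Real.exp_add, Real.exp_le_exp]
  have h1 := Real.add_one_le_exp (x - y0)
  have h2 : Real.exp (x - y0) = Real.exp x / ((k + 1) / -c) := by
    rw [Real.exp_sub, hy0, Real.exp_log (div_pos hk hc')]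
  have h3 : c * Real.exp x = -(k + 1) * Real.exp (x - y0) := by
    rw [h2]; field_simp
  rw [h3]
  nlinarith

/-- On x > R a negative k costs only the factor exp((k - |k|)R), which reduces the claim to |k|. -/
theorem integrableOn_exp_exp_Ioi (k R : ℝ) {c : ℝ} (hc : c < 0) :
    IntegrableOn (fun x => Real.exp (c * Real.exp x + k * x)) (Ioi R) := by
  obtain ⟨M, hM, hb⟩ := exists_exp_le (k := |k|) (by linarith [abs_nonneg k]) hc
  have h1 : IntegrableOn (fun x => Real.exp ((k - |k|) * R) * (M * Real.exp (-1 * x))) (Ioi R) :=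
    ((integrableOn_exp_mul_Ioi (by norm_num) R).const_mul M).const_mul _
  refine h1.mono' (by fun_prop) ?_
  refine (ae_restrict_iff' measurableSet_Ioi).2 (Eventually.of_forall fun x hx => ?_)
  rw [Real.norm_of_nonneg (Real.exp_pos _).le, neg_one_mul]
  refine le_trans ?_ (mul_le_mul_of_nonneg_left (hb x) (Real.exp_pos _).le)
  rw [← Real.exp_add, Real.exp_le_exp]
  have : (k - |k|) * x ≤ (k - |k|) * R :=
    mul_le_mul_of_nonpos_left (le_of_lt hx) (by linarith [le_abs_self k])
  linarith

/-- Positivity of k gives the decay at -∞, negativity of c the decay at +∞. -/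
theorem integrable_exp_exp {k : ℝ} (hk : 0 < k) {c : ℝ} (hc : c < 0) :
    Integrable (fun x => Real.exp (c * Real.exp x + k * x)) := by
  rw [← integrableOn_univ, ← Iic_union_Ioi (a := (0 : ℝ))]
  refine IntegrableOn.union ?_ (integrableOn_exp_exp_Ioi k 0 hc)
  refine (integrableOn_exp_mul_Iic hk 0).mono' (by fun_prop) (Eventually.of_forall fun x => ?_)
  rw [Real.norm_of_nonneg (Real.exp_pos _).le, Real.exp_le_exp]
  nlinarith [Real.exp_pos x]

/-- On the half lines of the contour `exp (exp w + k w)` decays. -/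
theorem integrable_hankel_base (k : ℝ) {φ : ℝ} (hφ : Real.cos φ < 0) (R : ℝ) (j : Fin 3) :
    Integrable (fun x => Complex.exp (Complex.exp (hankelPath φ R j x) + k * hankelPath φ R j x))
      (hankelMeasure φ R j) := by
  have hc : Continuous fun x =>
      Complex.exp (Complex.exp (hankelPath φ R j x) + k * hankelPath φ R j x) := by
    have := continuous_hankelPath φ R j
    fun_prop
  fin_cases j
  · exact hc.integrableOn_Ioc
  · refine (integrableOn_exp_exp_Ioi k R hφ).mono' hc.aestronglyMeasurable
      (Eventually.of_forall fun x => ?_)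
    rw [norm_exp_exp_add]
    simp [hankelPath]
  · refine (integrableOn_exp_exp_Ioi k R hφ).mono' hc.aestronglyMeasurable
      (Eventually.of_forall fun x => ?_)
    rw [norm_exp_exp_add]
    simp [hankelPath]

/-- F is controlled only on the contour as a subset of ℂ, so the measure is first restricted to the
preimage of that set, which has full measure. -/
theorem hankel_aestronglyMeasurable {φ : ℝ} (hφ0 : 0 ≤ φ) {R : ℝ} {F : ℂ → ℂ}
    (hF : ContinuousOn F (hankelSet φ R)) (j : Fin 3) :
    AEStronglyMeasurable (fun x => F (hankelPath φ R j x)) (hankelMeasure φ R j) := by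
  have hm : MeasurableSet (hankelPath φ R j ⁻¹' hankelSet φ R) := by
    refine (continuous_hankelPath φ R j).measurable ?_
    have h1 : Measurable fun w : ℂ => |w.im| := by fun_prop
    exact ((measurableSet_eq_fun Complex.measurable_re measurable_const).inter
      (measurableSet_le h1 measurable_const)).union
      ((measurableSet_le measurable_const Complex.measurable_re).inter
      (measurableSet_eq_fun h1 measurable_const))
  have h2 : (hankelMeasure φ R j).restrict (hankelPath φ R j ⁻¹' hankelSet φ R)
      = hankelMeasure φ R j := Measure.restrict_eq_self_of_ae_mem (hankelPath_mem hφ0 j)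
  rw [← h2]
  exact ContinuousOn.aestronglyMeasurable
    (hF.comp (continuous_hankelPath φ R j).continuousOn (fun x hx => hx)) hm

theorem hankel_integrable {φ : ℝ} (hφ0 : 0 ≤ φ) (hφ : Real.cos φ < 0) {R K : ℝ} (k : ℝ)
    {F : ℂ → ℂ} (hF : ContinuousOn F (hankelSet φ R))
    (hb : ∀ w ∈ hankelSet φ R, ‖F w‖ ≤ K * ‖Complex.exp (Complex.exp w + k * w)‖) (j : Fin 3) :
    Integrable (fun x => F (hankelPath φ R j x)) (hankelMeasure φ R j) := by
  refine (((integrable_hankel_base k hφ R j).norm).const_mul K).mono'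
    (hankel_aestronglyMeasurable hφ0 hF j) ?_
  filter_upwards [hankelPath_mem hφ0 j] with x hx using hb _ hx

/-- The constant in the estimate of Hankel integrals against `exp (exp w + k w)`. -/
def hankelBound (φ R k : ℝ) : ℝ :=
  ‖(2 * Real.pi * Complex.I)⁻¹‖ * ∑ j, ‖hankelCoeff j‖ *
    ∫ x, ‖Complex.exp (Complex.exp (hankelPath φ R j x) + k * hankelPath φ R j x)‖
      ∂(hankelMeasure φ R j)

theorem norm_hankel_le {φ : ℝ} (hφ0 : 0 ≤ φ) (hφ : Real.cos φ < 0) {R K : ℝ} (k : ℝ)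
    {F : ℂ → ℂ}
    (hb : ∀ w ∈ hankelSet φ R, ‖F w‖ ≤ K * ‖Complex.exp (Complex.exp w + k * w)‖) :
    ‖hankel φ R F‖ ≤ K * hankelBound φ R k := by
  rw [hankel, hankelBound, norm_mul, ← mul_left_comm, Finset.mul_sum]
  refine mul_le_mul_of_nonneg_left ?_ (norm_nonneg _)
  refine (norm_sum_le _ _).trans (Finset.sum_le_sum fun j _ => ?_)
  rw [norm_mul, ← mul_left_comm]
  refine mul_le_mul_of_nonneg_left ?_ (norm_nonneg _)
  rw [← integral_const_mul]
  refine norm_integral_le_of_norm_le (((integrable_hankel_base k hφ R j).norm).const_mul K) ?_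
  filter_upwards [hankelPath_mem hφ0 j] with x hx using hb _ hx

theorem hankel_sub {φ R : ℝ} {F G : ℂ → ℂ}
    (hF : ∀ j, Integrable (fun x => F (hankelPath φ R j x)) (hankelMeasure φ R j))
    (hG : ∀ j, Integrable (fun x => G (hankelPath φ R j x)) (hankelMeasure φ R j)) :
    hankel φ R (fun w => F w - G w) = hankel φ R F - hankel φ R G := by
  simp only [hankel, ← mul_sub, ← Finset.sum_sub_distrib]
  congr 1
  refine Finset.sum_congr rfl fun j _ => ?_
  rw [integral_sub (hF j) (hG j)]

theorem hankel_const_mul {φ R : ℝ} (c : ℂ) (F : ℂ → ℂ) :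
    hankel φ R (fun w => c * F w) = c * hankel φ R F := by
  simp only [hankel, integral_const_mul, Finset.mul_sum]
  refine Finset.sum_congr rfl fun j _ => ?_
  ring

/-- Geometric series under a Hankel integral. -/
theorem hasSum_hankel_geometric {φ : ℝ} (hφ0 : 0 ≤ φ) (hφ : Real.cos φ < 0) {R : ℝ} (k : ℝ)
    {q : ℂ → ℂ} (hq : ContinuousOn q (hankelSet φ R)) {ρ : ℝ} (hρ : ρ < 1)
    (hqρ : ∀ w ∈ hankelSet φ R, ‖q w‖ ≤ ρ) :
    HasSum (fun n : ℕ => hankel φ R (fun w => Complex.exp (Complex.exp w + k * w) * q w ^ n))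
      (hankel φ R (fun w => Complex.exp (Complex.exp w + k * w) / (1 - q w))) := by
  have hρ0 : 0 ≤ ρ := (norm_nonneg _).trans (hqρ (R : ℂ) (Or.inl (by simpa using hφ0)))
  refine HasSum.mul_left _ (hasSum_sum fun j _ => HasSum.mul_left _ ?_)
  have hcont : ContinuousOn (fun w : ℂ => Complex.exp (Complex.exp w + k * w)) (hankelSet φ R) := by
    fun_prop
  refine hasSum_integral_of_dominated_convergence
    (fun n x => ‖Complex.exp (Complex.exp (hankelPath φ R j x) + k * hankelPath φ R j x)‖ * ρ ^ n)
    (fun n => ?_) (fun n => ?_) ?_ ?_ ?_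
  · exact hankel_aestronglyMeasurable hφ0 (hcont.mul (hq.pow n)) j
  · filter_upwards [hankelPath_mem hφ0 j] with x hx
    rw [norm_mul, norm_pow]
    gcongr
    exact hqρ _ hx
  · exact Eventually.of_forall fun x => (summable_geometric_of_lt_one hρ0 hρ).mul_left _
  · simp_rw [tsum_mul_left]
    exact ((integrable_hankel_base k hφ R j).norm).mul_const _
  · filter_upwards [hankelPath_mem hφ0 j] with x hx
    rw [div_eq_mul_inv]
    exact (hasSum_geometric_of_norm_lt_one ((hqρ _ hx).trans_lt hρ)).mul_left _

/-- Cauchy's theorem: the left end of the contour can be moved. -/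
theorem hankel_eq_of_differentiableOn {φ : ℝ} (hφ0 : 0 ≤ φ) {R R' : ℝ} (hR : R ≤ R')
    {F : ℂ → ℂ} (hF : DifferentiableOn ℂ F {w | R ≤ w.re ∧ w.re ≤ R' ∧ |w.im| ≤ φ})
    (hi : ∀ j, Integrable (fun x => F (hankelPath φ R j x)) (hankelMeasure φ R j)) :
    hankel φ R F = hankel φ R' F := by
  have h1 : IntegrableOn (fun x : ℝ => F (x + φ * Complex.I)) (Ioi R) := hi 1
  have h2 : IntegrableOn (fun x : ℝ => F (x - φ * Complex.I)) (Ioi R) := hi 2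
  -- The horizontal sides of this rectangle are exactly the parts of the half lines by which the two
  -- contours differ.
  have hrect := Complex.integral_boundary_rect_eq_zero_of_differentiableOn F
    (R - φ * Complex.I) (R' + φ * Complex.I) (hF.mono ?_)
  swap
  · intro w hw
    rw [Complex.mem_reProdIm] at hw
    simp only [Complex.sub_re, Complex.ofReal_re, Complex.mul_re, Complex.I_re, mul_zero,
      Complex.ofReal_im, Complex.I_im, mul_one, sub_self, sub_zero, Complex.add_re, add_zero,
      Complex.sub_im, Complex.mul_im, zero_add, zero_sub, Complex.add_im,
      uIcc_of_le hR, uIcc_of_le (neg_le_self hφ0)] at hw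
    exact ⟨hw.1.1, hw.1.2, abs_le.2 hw.2⟩
  simp only [Complex.sub_re, Complex.ofReal_re, Complex.mul_re, Complex.I_re, mul_zero,
      Complex.ofReal_im, Complex.I_im, mul_one, sub_self, sub_zero, Complex.add_re, add_zero,
      Complex.sub_im, Complex.mul_im, zero_add, zero_sub, Complex.add_im, smul_eq_mul]
    at hrect
  have e1 := intervalIntegral.integral_interval_add_Ioi h1 (h1.mono_set (Ioi_subset_Ioi hR))
  have e2 := intervalIntegral.integral_interval_add_Ioi h2 (h2.mono_set (Ioi_subset_Ioi hR))
  simp only [hankel, Fin.sum_univ_three, hankelPath, hankelMeasure, hankelCoeff]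
  rw [← intervalIntegral.integral_of_le (neg_le_self hφ0),
    ← intervalIntegral.integral_of_le (neg_le_self hφ0), ← e1, ← e2]
  simp only [Complex.ofReal_neg, neg_mul, ← sub_eq_add_neg] at hrect
  congr 1
  linear_combination -hrect


/-! ### Hankel's formula for the reciprocal of the Gamma function -/

/-- The integrand of Hankel's formula for `1 / Γ(1 - k)` in the coordinate `w = log p`. -/
def gammaKernel (k : ℝ) (w : ℂ) : ℂ := Complex.exp (Complex.exp w + k * w)

theorem differentiable_gammaKernel (k : ℝ) : Differentiable ℂ (gammaKernel k) := by
  unfold gammaKernel; fun_prop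

theorem norm_gammaKernel (k : ℝ) (w : ℂ) :
    ‖gammaKernel k w‖ = Real.exp (Real.cos w.im * Real.exp w.re + k * w.re) :=
  norm_exp_exp_add k w

theorem integrable_gammaKernel_path (k : ℝ) {φ : ℝ} (hφ : Real.cos φ < 0) (R : ℝ) (j : Fin 3) :
    Integrable (fun x => gammaKernel k (hankelPath φ R j x)) (hankelMeasure φ R j) :=
  integrable_hankel_base k hφ R j

theorem integrable_gammaKernel {k : ℝ} (hk : 0 < k) {φ : ℝ} (hφ : Real.cos φ < 0) :
    Integrable (fun x : ℝ => gammaKernel k (x + φ * Complex.I)) := by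
  refine (integrable_exp_exp hk hφ).mono' ?_ (Eventually.of_forall fun x => ?_)
  · have := (differentiable_gammaKernel k).continuous
    exact (this.comp (by fun_prop : Continuous fun x : ℝ => (x : ℂ) + φ * Complex.I)).aestronglyMeasurable
  · rw [norm_gammaKernel]; simp

/-- Because of this symmetry the lines Im w = ±φ carry conjugate values, and only an imaginary part
survives in their difference. -/
theorem gammaKernel_conj (k : ℝ) (w : ℂ) :
    gammaKernel k ((starRingEnd ℂ) w) = (starRingEnd ℂ) (gammaKernel k w) := by
  simp [gammaKernel, ← Complex.exp_conj]

/-- The kernel is entire, so the segment may stand anywhere. -/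
theorem hankel_gammaKernel_left {φ : ℝ} (hφ0 : 0 ≤ φ) (hφ : Real.cos φ < 0) (k R R' : ℝ) :
    hankel φ R (gammaKernel k) = hankel φ R' (gammaKernel k) := by
  rcases le_total R R' with h | h
  · exact hankel_eq_of_differentiableOn hφ0 h (differentiable_gammaKernel k).differentiableOn
      (integrable_gammaKernel_path k hφ R)
  · exact (hankel_eq_of_differentiableOn hφ0 h (differentiable_gammaKernel k).differentiableOn
      (integrable_gammaKernel_path k hφ R')).symm

/-- Letting the left end of the contour go to `-∞`. -/
theorem hankel_gammaKernel_eq_lines {φ : ℝ} (hφ0 : 0 ≤ φ) (hφ : Real.cos φ < 0) {k : ℝ}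
    (hk : 0 < k) (R : ℝ) :
    hankel φ R (gammaKernel k) = (2 * Real.pi * Complex.I)⁻¹ *
      ((∫ x : ℝ, gammaKernel k (x + φ * Complex.I)) -
        ∫ x : ℝ, gammaKernel k (x - φ * Complex.I)) := by
  have hconst : Tendsto (fun R' => hankel φ R' (gammaKernel k)) atBot
      (𝓝 (hankel φ R (gammaKernel k))) := by
    simp_rw [hankel_gammaKernel_left hφ0 hφ k _ R]
    exact tendsto_const_nhds
  refine tendsto_nhds_unique hconst ?_
  simp only [hankel, Fin.sum_univ_three, hankelPath, hankelMeasure, hankelCoeff]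
  refine Tendsto.const_mul _ ?_
  have hi1 := integrable_gammaKernel hk hφ
  have hi2 : Integrable (fun x : ℝ => gammaKernel k (x - φ * Complex.I)) := by
    have := integrable_gammaKernel (φ := -φ) hk (by simpa using hφ)
    simpa [← sub_eq_add_neg] using this
  have h1 := (aecover_Ioi (μ := (volume : Measure ℝ)) (tendsto_id (α := ℝ) (x := atBot))
    ).integral_tendsto_of_countably_generated hi1
  have h2 := (aecover_Ioi (μ := (volume : Measure ℝ)) (tendsto_id (α := ℝ) (x := atBot))
    ).integral_tendsto_of_countably_generated hi2
  -- On the segment the modulus is at most exp(e^{R'} + kR'), which tends to 0 as R' → -∞ because k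
  -- > 0.
  have h0 : Tendsto (fun R' : ℝ => ∫ y in Ioc (-φ) φ, gammaKernel k (R' + y * Complex.I)) atBot
      (𝓝 0) := by
    have hz : Tendsto (fun R' : ℝ => Real.exp (Real.exp R' + k * R') * (φ - -φ)) atBot (𝓝 0) := by
      have e1 : Tendsto (fun R' : ℝ => Real.exp R' + k * R') atBot atBot :=
        Real.tendsto_exp_atBot.add_atBot (tendsto_id.const_mul_atBot hk)
      simpa using (Real.tendsto_exp_atBot.comp e1).mul_const (φ - -φ)
    refine squeeze_zero_norm (fun R' => ?_) hz
    rw [← intervalIntegral.integral_of_le (neg_le_self hφ0)]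
    refine (intervalIntegral.norm_integral_le_of_norm_le_const (C := Real.exp (Real.exp R' + k * R'))
      fun y _ => ?_).trans_eq ?_
    · rw [norm_gammaKernel, Real.exp_le_exp]
      simp only [Complex.add_im, Complex.ofReal_im, Complex.mul_im, Complex.ofReal_re, Complex.I_im,
        mul_one, Complex.I_re, mul_zero, add_zero, zero_add, Complex.add_re, Complex.mul_re, sub_self]
      nlinarith [Real.cos_le_one y, Real.exp_pos R']
    · rw [abs_of_nonneg (by linarith)]
  have := ((h0.const_mul Complex.I).add (h1.const_mul 1)).add (h2.const_mul (-1))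
  convert! this using 2
  ring

/-- The horizontal lines can be moved to `Im w = π`. -/
theorem integral_gammaKernel_line {φ : ℝ} (hφ1 : Real.pi / 2 < φ) (hφ2 : φ ≤ Real.pi) {k : ℝ}
    (hk : 0 < k) :
    ∫ x : ℝ, gammaKernel k (x + φ * Complex.I) = ∫ x : ℝ, gammaKernel k (x + Real.pi * Complex.I) := by
  have hcos : ∀ y ∈ Icc φ Real.pi, Real.cos y ≤ Real.cos φ := fun y hy =>
    Real.cos_le_cos_of_nonneg_of_le_pi (by linarith [Real.pi_pos]) hy.2 hy.1
  have hφ : Real.cos φ < 0 := Real.cos_neg_of_pi_div_two_lt_of_lt hφ1 (by linarith [Real.pi_pos])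
  have hi1 := integrable_gammaKernel hk hφ
  have hi2 := integrable_gammaKernel (φ := Real.pi) hk (by simp)
  have t1 := intervalIntegral_tendsto_integral hi1 tendsto_neg_atTop_atBot tendsto_id
  have t2 := intervalIntegral_tendsto_integral hi2 tendsto_neg_atTop_atBot tendsto_id
  have hv : ∀ X : ℝ, ‖∫ y in φ..Real.pi, gammaKernel k (X + y * Complex.I)‖
      ≤ Real.exp (Real.cos φ * Real.exp X + k * X) * (Real.pi - φ) := fun X => by
    refine (intervalIntegral.norm_integral_le_of_norm_le_const
      (C := Real.exp (Real.cos φ * Real.exp X + k * X)) fun y hy => ?_).trans_eq ?_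
    · rw [norm_gammaKernel, Real.exp_le_exp]
      simp only [Complex.add_im, Complex.ofReal_im, Complex.mul_im, Complex.ofReal_re, Complex.I_im,
        mul_one, Complex.I_re, mul_zero, add_zero, zero_add, Complex.add_re, Complex.mul_re, sub_self]
      rw [uIoc_of_le hφ2] at hy
      have := hcos y ⟨hy.1.le, hy.2⟩
      gcongr
    · rw [abs_of_nonneg (by linarith)]
  obtain ⟨M, hM, hMb⟩ := exists_exp_le (k := k) (by linarith) hφ
  have tv1 : Tendsto (fun X : ℝ => ∫ y in φ..Real.pi, gammaKernel k ((X : ℝ) + y * Complex.I)) atTop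
      (𝓝 0) := by
    refine squeeze_zero_norm (a := fun X : ℝ => M * Real.exp (-X) * (Real.pi - φ)) (fun X =>
      (hv X).trans ?_) ?_
    · exact mul_le_mul_of_nonneg_right (hMb X) (by linarith)
    · have := (Real.tendsto_exp_neg_atTop_nhds_zero.const_mul M).mul_const (Real.pi - φ)
      simpa using this
  have tv2 : Tendsto (fun X : ℝ => ∫ y in φ..Real.pi, gammaKernel k ((-X : ℝ) + y * Complex.I))
      atTop (𝓝 0) := by
    refine squeeze_zero_norm (a := fun X : ℝ => Real.exp (k * -X) * (Real.pi - φ)) (fun X =>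
      (hv (-X)).trans ?_) ?_
    · refine mul_le_mul_of_nonneg_right ?_ (by linarith)
      rw [Real.exp_le_exp]
      nlinarith [Real.exp_pos (-X)]
    · have e1 : Tendsto (fun X : ℝ => k * -X) atTop atBot :=
        tendsto_neg_atTop_atBot.const_mul_atBot hk
      simpa using (Real.tendsto_exp_atBot.comp e1).mul_const (Real.pi - φ)
  -- Cauchy's theorem on [-X, X] × [φ, π]. The vertical sides vanish as X → ∞: the right one because
  -- cos φ < 0, the left one because k > 0.
  have key : ∀ X : ℝ, (∫ x in (-X)..X, gammaKernel k (x + φ * Complex.I))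
      - (∫ x in (-X)..X, gammaKernel k (x + Real.pi * Complex.I))
      + Complex.I * (∫ y in φ..Real.pi, gammaKernel k ((X : ℝ) + y * Complex.I))
      - Complex.I * (∫ y in φ..Real.pi, gammaKernel k ((-X : ℝ) + y * Complex.I)) = 0 := fun X => by
    have := Complex.integral_boundary_rect_eq_zero_of_differentiableOn (gammaKernel k)
      ((-X : ℝ) + φ * Complex.I) ((X : ℝ) + Real.pi * Complex.I)
      (differentiable_gammaKernel k).differentiableOn
    simpa using this
  have lim := ((t1.sub t2).add (tv1.const_mul Complex.I)).sub (tv2.const_mul Complex.I)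
  have := tendsto_nhds_unique lim (tendsto_const_nhds.congr fun X => (key X).symm)
  simpa [sub_eq_zero] using this

/-- Euler's integral after the substitution of e^x for the variable. -/
theorem integral_exp_exp_eq_Gamma {k : ℝ} (hk : 0 < k) :
    ∫ x : ℝ, Real.exp (-Real.exp x + k * x) = Real.Gamma k := by
  have h := integral_image_eq_integral_abs_deriv_smul (s := univ) (f := Real.exp) (f' := Real.exp)
    MeasurableSet.univ (fun x _ => (Real.hasDerivAt_exp x).hasDerivWithinAt)
    Real.exp_injective.injOn (fun x => Real.exp (-x) * x ^ (k - 1))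
  rw [image_univ, Real.range_exp, ← Real.Gamma_eq_integral hk, setIntegral_univ] at h
  rw [h]
  refine integral_congr_ae (Eventually.of_forall fun x => ?_)
  simp only [smul_eq_mul, abs_of_pos (Real.exp_pos x)]
  rw [Real.rpow_def_of_pos (Real.exp_pos x), Real.log_exp, ← Real.exp_add, ← Real.exp_add]
  congr 1
  ring

/-- On the line Im w = π one has e^w = -e^{Re w}, which leads back to Euler's integral. -/
theorem integral_gammaKernel_pi {k : ℝ} (hk : 0 < k) :
    ∫ x : ℝ, gammaKernel k (x + Real.pi * Complex.I)
      = Complex.exp (k * Real.pi * Complex.I) * Real.Gamma k := by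
  have : ∀ x : ℝ, gammaKernel k (x + Real.pi * Complex.I)
      = Complex.exp (k * Real.pi * Complex.I) * ((Real.exp (-Real.exp x + k * x) : ℝ) : ℂ) := fun x => by
    rw [gammaKernel, Complex.exp_add x, Complex.exp_pi_mul_I, Complex.ofReal_exp, ← Complex.exp_add]
    congr 1
    push_cast
    ring
  simp_rw [this]
  rw [integral_const_mul, integral_complex_ofReal, integral_exp_exp_eq_Gamma hk]

/-- The difference of the two conjugate line integrals is 2i sin(πk) Γ(k), and the reflection
formula finishes the computation. -/
theorem hankel_gammaKernel_of_pos {φ : ℝ} (hφ1 : Real.pi / 2 < φ) (hφ2 : φ ≤ Real.pi) {k : ℝ}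
    (hk : 0 < k) (R : ℝ) :
    hankel φ R (gammaKernel k) = (((Real.Gamma (1 - k))⁻¹ : ℝ) : ℂ) := by
  have hφ : Real.cos φ < 0 := Real.cos_neg_of_pi_div_two_lt_of_lt hφ1 (by linarith [Real.pi_pos])
  have hφ0 : 0 ≤ φ := by linarith [Real.pi_pos]
  rw [hankel_gammaKernel_eq_lines hφ0 hφ hk]
  have hconj : ∀ x : ℝ, gammaKernel k (x - φ * Complex.I)
      = (starRingEnd ℂ) (gammaKernel k (x + φ * Complex.I)) := fun x => by
    rw [← gammaKernel_conj]
    simp [sub_eq_add_neg]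
  simp_rw [hconj]
  rw [integral_conj, integral_gammaKernel_line hφ1 hφ2 hk, integral_gammaKernel_pi hk,
    Complex.sub_conj]
  have him : (Complex.exp (k * Real.pi * Complex.I) * Real.Gamma k).im
      = Real.sin (Real.pi * k) * Real.Gamma k := by
    rw [mul_comm, Complex.im_ofReal_mul, ← Complex.ofReal_mul, Complex.exp_ofReal_mul_I_im, mul_comm,
      mul_comm k]
  rw [him]
  have h := Real.Gamma_mul_Gamma_one_sub k
  have hG := (Real.Gamma_pos_of_pos hk).ne'
  -- This includes the positive integers k: both sides are then 0, as `Real.Gamma` is 0 at its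
  -- poles.
  have h1 : (Real.Gamma (1 - k))⁻¹ = Real.sin (Real.pi * k) * Real.Gamma k / Real.pi := by
    have : Real.Gamma (1 - k) = Real.pi / Real.sin (Real.pi * k) / Real.Gamma k := by
      rw [← h]; field_simp
    rw [this, inv_div, div_div_eq_mul_div, mul_comm]
  rw [h1]
  have : (Real.pi : ℂ) ≠ 0 := by exact_mod_cast Real.pi_ne_zero
  push_cast
  field_simp

/-- The recursion in k carries the factor -k and says nothing about k = 0, so this value is taken as
the limit k ↓ 0 of the positive case. With the segment on Re w = 0 the kernel for k = 1 dominates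
all those with 0 < k < 1. -/
theorem hankel_gammaKernel_zero {φ : ℝ} (hφ1 : Real.pi / 2 < φ) (hφ2 : φ ≤ Real.pi) :
    hankel φ 0 (gammaKernel 0) = 1 := by
  have hφ : Real.cos φ < 0 := Real.cos_neg_of_pi_div_two_lt_of_lt hφ1 (by linarith [Real.pi_pos])
  have hφ0 : 0 ≤ φ := by linarith [Real.pi_pos]
  have h1 : Tendsto (fun k => hankel φ 0 (gammaKernel k)) (𝓝[>] 0)
      (𝓝 (hankel φ 0 (gammaKernel 0))) := by
    refine Tendsto.const_mul _ (tendsto_finsetSum _ fun j _ => Tendsto.const_mul _ ?_)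
    refine tendsto_integral_filter_of_dominated_convergence
      (fun x => ‖gammaKernel 1 (hankelPath φ 0 j x)‖) ?_ ?_
      (integrable_gammaKernel_path 1 hφ 0 j).norm ?_
    · exact Eventually.of_forall fun k => (integrable_gammaKernel_path k hφ 0 j).1
    · filter_upwards [Ioo_mem_nhdsGT (show (0 : ℝ) < 1 by norm_num)] with k hk
      filter_upwards [hankelPath_mem hφ0 j] with x hx
      rw [norm_gammaKernel, norm_gammaKernel, Real.exp_le_exp]
      have h0 : 0 ≤ (hankelPath φ 0 j x).re := by
        rcases hx with hx | hx
        · exact hx.1.ge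
        · exact hx.1
      nlinarith [hk.2]
    · refine Eventually.of_forall fun x => ?_
      have : Continuous fun k : ℝ => gammaKernel k (hankelPath φ 0 j x) := by
        unfold gammaKernel; fun_prop
      exact (this.tendsto 0).mono_left nhdsWithin_le_nhds
  have h2 : Tendsto (fun k : ℝ => (((Real.Gamma (1 - k))⁻¹ : ℝ) : ℂ)) (𝓝[>] 0) (𝓝 1) := by
    have e1 : ContinuousAt Real.Gamma 1 :=
      (Real.differentiableAt_Gamma fun m => by
        have : (0 : ℝ) ≤ m := Nat.cast_nonneg m
        linarith).continuousAt
    have e2 : Tendsto (fun k : ℝ => 1 - k) (𝓝[>] 0) (𝓝 1) := by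
      have : Tendsto (fun k : ℝ => 1 - k) (𝓝 0) (𝓝 (1 - 0)) := by
        exact (continuous_const.sub continuous_id).tendsto 0
      simpa using this.mono_left nhdsWithin_le_nhds
    have e3 := (e1.tendsto.comp e2).inv₀ (by simp)
    have := (Complex.continuous_ofReal.tendsto _).comp e3
    simpa [Function.comp_def] using this
  refine tendsto_nhds_unique h1 (h2.congr' ?_)
  filter_upwards [self_mem_nhdsWithin] with k hk
  rw [hankel_gammaKernel_of_pos hφ1 hφ2 hk]

/-- The derivative is a combination of the kernels for k + 1 and k, which makes integration along
the contour a recursion in k. -/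
theorem hasDerivAt_gammaKernel (k : ℝ) (w : ℂ) :
    HasDerivAt (gammaKernel k) (gammaKernel (k + 1) w + k * gammaKernel k w) w := by
  have h : HasDerivAt (fun w => Complex.exp w + k * w) (Complex.exp w + k * 1) w :=
    (Complex.hasDerivAt_exp w).add ((hasDerivAt_id w).const_mul _)
  convert! h.cexp using 1
  simp only [gammaKernel, mul_add, ← Complex.exp_add]
  push_cast
  ring_nf

theorem tendsto_gammaKernel (k : ℝ) {φ : ℝ} (hφ : Real.cos φ < 0) :
    Tendsto (fun x : ℝ => gammaKernel k (x + φ * Complex.I)) atTop (𝓝 0) := by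
  obtain ⟨M, hM, hb⟩ := exists_exp_le (k := |k|) (by linarith [abs_nonneg k]) hφ
  have h0 : Tendsto (fun X : ℝ => M * Real.exp (-X)) atTop (𝓝 0) := by
    simpa using Real.tendsto_exp_neg_atTop_nhds_zero.const_mul M
  refine squeeze_zero_norm' ?_ h0
  filter_upwards [eventually_ge_atTop 0] with x hx
  refine le_trans ?_ (hb x)
  rw [norm_gammaKernel, Real.exp_le_exp]
  simp only [Complex.add_im, Complex.ofReal_im, Complex.mul_im, Complex.ofReal_re, Complex.I_im,
    mul_one, Complex.I_re, mul_zero, add_zero, zero_add, Complex.add_re, Complex.mul_re, sub_self]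
  have := mul_le_mul_of_nonneg_right (le_abs_self k) hx
  linarith

/-- Integration by parts in Hankel's formula. -/
theorem hankel_gammaKernel_succ {φ : ℝ} (hφ0 : 0 ≤ φ) (hφ : Real.cos φ < 0) (k R : ℝ) :
    hankel φ R (gammaKernel (k + 1)) = -k * hankel φ R (gammaKernel k) := by
  have hi : ∀ j, Integrable (fun x => gammaKernel (k + 1) (hankelPath φ R j x)
      + k * gammaKernel k (hankelPath φ R j x)) (hankelMeasure φ R j) := fun j =>
    (integrable_gammaKernel_path (k + 1) hφ R j).add
      ((integrable_gammaKernel_path k hφ R j).const_mul _)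
  have hz : hankel φ R (fun w => gammaKernel (k + 1) w + k * gammaKernel k w) = 0 := by
    -- Each piece of the contour integrates a derivative. The boundary values at the two corners
    -- cancel, and those at infinity vanish.
    have l1 : ∀ s : ℝ, Real.cos s < 0 →
        IntegrableOn (fun x : ℝ => gammaKernel (k + 1) (x + s * Complex.I)
          + k * gammaKernel k (x + s * Complex.I)) (Ioi R) →
        ∫ x in Ioi R, (gammaKernel (k + 1) (x + s * Complex.I)
          + k * gammaKernel k (x + s * Complex.I)) = 0 - gammaKernel k (R + s * Complex.I) := by
      intro s hs hi
      refine integral_Ioi_of_hasDerivAt_of_tendsto' (f := fun x : ℝ => gammaKernel k (x + s * Complex.I))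
        (fun x _ => ?_) hi (tendsto_gammaKernel k hs)
      exact ((hasDerivAt_gammaKernel k (x + s * Complex.I)).comp_add_const (x : ℂ)
        (s * Complex.I)).comp_ofReal
    have l0 : Complex.I * ∫ y in (-φ)..φ, (gammaKernel (k + 1) (R + y * Complex.I)
          + k * gammaKernel k (R + y * Complex.I))
        = gammaKernel k (R + φ * Complex.I) - gammaKernel k (R - φ * Complex.I) := by
      rw [← intervalIntegral.integral_const_mul]
      have hd : ∀ y ∈ uIcc (-φ) φ, HasDerivAt (fun y : ℝ => gammaKernel k (R + y * Complex.I))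
          (Complex.I * (gammaKernel (k + 1) (R + y * Complex.I)
          + k * gammaKernel k (R + y * Complex.I))) y := fun y _ => by
        have e1 : HasDerivAt (fun y : ℂ => (R : ℂ) + y * Complex.I) Complex.I y := by
          simpa using ((hasDerivAt_id (y : ℂ)).mul_const Complex.I).const_add (R : ℂ)
        have e2 := ((hasDerivAt_gammaKernel k (R + y * Complex.I)).comp (y : ℂ) e1).comp_ofReal
        rw [mul_comm]
        exact e2
      have hc : Continuous fun y : ℝ => Complex.I * (gammaKernel (k + 1) (R + y * Complex.I)
          + k * gammaKernel k (R + y * Complex.I)) := by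
        unfold gammaKernel; fun_prop
      rw [intervalIntegral.integral_eq_sub_of_hasDerivAt hd (hc.intervalIntegrable _ _)]
      simp [sub_eq_add_neg]
    have h1 := l1 φ hφ (hi 1)
    have h2 := l1 (-φ) (by simpa using hφ) (by
      have := hi 2
      simpa [hankelPath, hankelMeasure, sub_eq_add_neg, IntegrableOn] using this)
    simp only [Complex.ofReal_neg, neg_mul, ← sub_eq_add_neg] at h2
    simp only [hankel, Fin.sum_univ_three, hankelPath, hankelMeasure, hankelCoeff]
    rw [← intervalIntegral.integral_of_le (neg_le_self hφ0), l0, h1, h2]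
    ring
  have hs := hankel_sub (F := fun w => gammaKernel (k + 1) w + k * gammaKernel k w)
    (G := fun w => k * gammaKernel k w) hi (fun j => (integrable_gammaKernel_path k hφ R j).const_mul (k : ℂ))
  rw [hz, hankel_const_mul] at hs
  simp only [add_sub_cancel_right] at hs
  rw [hs]
  ring

/-- **Hankel's formula** for the reciprocal of the Gamma function. -/
theorem hankel_gammaKernel {φ : ℝ} (hφ1 : Real.pi / 2 < φ) (hφ2 : φ ≤ Real.pi) (k R : ℝ) :
    hankel φ R (gammaKernel k) = (((Real.Gamma (1 - k))⁻¹ : ℝ) : ℂ) := by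
  have hφ : Real.cos φ < 0 := Real.cos_neg_of_pi_div_two_lt_of_lt hφ1 (by linarith [Real.pi_pos])
  have hφ0 : 0 ≤ φ := by linarith [Real.pi_pos]
  -- Induction on a bound for -k: for k < 0 the formula at k + 1 is divided by -k.
  obtain ⟨n, hn⟩ := exists_nat_gt (-k)
  induction n generalizing k with
  | zero =>
    exact hankel_gammaKernel_of_pos hφ1 hφ2 (by simpa using hn) R
  | succ n ih =>
    rcases lt_trichotomy k 0 with hk | hk | hk
    · have h := ih (k + 1) (by push_cast at hn; linarith)
      rw [hankel_gammaKernel_succ hφ0 hφ] at h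
      have hG : Real.Gamma (1 - k) = -k * Real.Gamma (1 - (k + 1)) := by
        have := Real.Gamma_add_one (s := -k) (by linarith)
        rw [show 1 - k = -k + 1 by ring, this]
        ring_nf
      have hk' : (k : ℂ) ≠ 0 := by exact_mod_cast hk.ne
      rw [hG, mul_inv, Complex.ofReal_mul, ← h]
      push_cast
      field_simp
    · subst hk
      rw [hankel_gammaKernel_left hφ0 hφ 0 R 0, hankel_gammaKernel_zero hφ1 hφ2]
      simp
    · exact hankel_gammaKernel_of_pos hφ1 hφ2 hk R


/-! ### Contour integrals for Mittag-Leffler functions -/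

theorem le_re_of_mem_hankelSet {φ R : ℝ} {w : ℂ} (hw : w ∈ hankelSet φ R) : R ≤ w.re := by
  rcases hw with h | h
  · exact h.1.ge
  · exact h.1

theorem abs_im_le_of_mem_hankelSet {φ R : ℝ} {w : ℂ} (hw : w ∈ hankelSet φ R) : |w.im| ≤ φ := by
  rcases hw with h | h
  · exact h.2
  · exact h.2.le

theorem norm_exp_neg_mul (a : ℝ) (w : ℂ) : ‖Complex.exp (-(a * w))‖ = Real.exp (-(a * w.re)) := by
  rw [Complex.norm_exp, Complex.neg_re, Complex.re_ofReal_mul]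

/-- Hankel's formula applied to each 1/Γ(an + b) leaves a geometric series in z e^{-aw}. The
condition on R places the contour to the right of all poles, where this ratio stays below 1 in
modulus. -/
theorem hasSum_mittagLeffler_hankel {φ : ℝ} (hφ1 : Real.pi / 2 < φ) (hφ2 : φ ≤ Real.pi)
    {a : ℝ} (ha : 0 < a) (b : ℝ) {R : ℝ} {z : ℂ} (hz : ‖z‖ < Real.exp (a * R)) :
    HasSum (fun n : ℕ => z ^ n / ((Real.Gamma (a * n + b) : ℝ) : ℂ))
      (hankel φ R fun w => gammaKernel (1 - b) w / (1 - z * Complex.exp (-(a * w)))) := by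
  have hφ : Real.cos φ < 0 := Real.cos_neg_of_pi_div_two_lt_of_lt hφ1 (by linarith [Real.pi_pos])
  have hφ0 : 0 ≤ φ := by linarith [Real.pi_pos]
  have h := hasSum_hankel_geometric hφ0 hφ (R := R) (1 - b)
    (q := fun w => z * Complex.exp (-(a * w))) (by fun_prop) (ρ := ‖z‖ * Real.exp (-(a * R))) ?_ ?_
  · convert! h using 1
    funext n
    have e1 : ∀ w : ℂ, Complex.exp (Complex.exp w + (1 - b : ℝ) * w) *
        (z * Complex.exp (-(a * w))) ^ n = z ^ n * gammaKernel (1 - (a * n + b)) w := fun w => by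
      rw [mul_pow, ← Complex.exp_nat_mul, mul_left_comm, ← Complex.exp_add, gammaKernel]
      congr 2
      push_cast
      ring
    simp_rw [e1]
    rw [hankel_const_mul, hankel_gammaKernel hφ1 hφ2, sub_sub_cancel, div_eq_mul_inv,
      Complex.ofReal_inv]
  · rw [Real.exp_neg, ← div_eq_mul_inv, div_lt_one (Real.exp_pos _)]
    exact hz
  · intro w hw
    rw [norm_mul, norm_exp_neg_mul]
    have := le_re_of_mem_hankelSet hw
    gcongr

theorem exists_lt_exp_mul {a : ℝ} (ha : 0 < a) (x R₀ : ℝ) : ∃ R, R₀ ≤ R ∧ x < Real.exp (a * R) := by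
  have h : Tendsto (fun R : ℝ => Real.exp (a * R)) atTop atTop :=
    Real.tendsto_exp_atTop.comp (tendsto_id.const_mul_atTop ha)
  obtain ⟨R, h1, h2⟩ := ((eventually_ge_atTop R₀).and (h.eventually_gt_atTop x)).exists
  exact ⟨R, h1, h2⟩

/-- Convergence is a by-product of the contour representation with large R, so no lower bound on the
growth of Γ is needed. -/
theorem summable_mittagLeffler {a : ℝ} (ha : 0 < a) (b : ℝ) (z : ℂ) :
    Summable fun n : ℕ => z ^ n / ((Real.Gamma (a * n + b) : ℝ) : ℂ) := by
  obtain ⟨R, -, hR⟩ := exists_lt_exp_mul ha ‖z‖ 0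
  exact (hasSum_mittagLeffler_hankel (φ := Real.pi) (by linarith [Real.pi_pos]) le_rfl ha b
    hR).summable

theorem hasSum_mittagLeffler {a : ℝ} (ha : 0 < a) (b : ℝ) (z : ℂ) :
    HasSum (fun n : ℕ => z ^ n / ((Real.Gamma (a * n + b) : ℝ) : ℂ)) (mittagLeffler a b z) :=
  (summable_mittagLeffler ha b z).hasSum

theorem summable_norm_mittagLeffler {a : ℝ} (ha : 0 < a) (b r : ℝ) :
    Summable fun n : ℕ => ‖(r : ℂ) ^ n / ((Real.Gamma (a * n + b) : ℝ) : ℂ)‖ :=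
  (summable_mittagLeffler ha b r).norm

theorem continuous_mittagLeffler {a : ℝ} (ha : 0 < a) (b : ℝ) : Continuous (mittagLeffler a b) := by
  have h : ∀ r : ℝ, ContinuousOn (mittagLeffler a b) (Metric.ball 0 r) := fun r => by
    refine continuousOn_tsum (u := fun n : ℕ => ‖(r : ℂ) ^ n / ((Real.Gamma (a * n + b) : ℝ) : ℂ)‖)
      (fun n => by fun_prop) (summable_norm_mittagLeffler ha b r) fun n z hz => ?_
    rw [mem_ball_zero_iff] at hz
    rw [norm_div, norm_div, norm_pow, norm_pow]
    have := hz.le.trans (le_abs_self r)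
    gcongr
    rwa [Complex.norm_real, Real.norm_eq_abs]
  refine continuous_iff_continuousAt.2 fun z => ?_
  exact (h (‖z‖ + 1)).continuousAt (Metric.isOpen_ball.mem_nhds (by simp))

theorem mittagLeffler_eq_hankel {φ : ℝ} (hφ1 : Real.pi / 2 < φ) (hφ2 : φ ≤ Real.pi)
    {a : ℝ} (ha : 0 < a) (b : ℝ) {R : ℝ} {z : ℂ} (hz : ‖z‖ < Real.exp (a * R)) :
    mittagLeffler a b z
      = hankel φ R fun w => gammaKernel (1 - b) w / (1 - z * Complex.exp (-(a * w))) :=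
  (hasSum_mittagLeffler_hankel hφ1 hφ2 ha b hz).tsum_eq

theorem mittagLeffler_one_one (z : ℂ) : mittagLeffler 1 1 z = Complex.exp z := by
  rw [Complex.exp_eq_exp_ℂ, NormedSpace.exp_eq_tsum_div, mittagLeffler]
  congr 1
  funext n
  rw [one_mul, Real.Gamma_nat_eq_factorial]
  simp

theorem mittagLeffler_zero (a b : ℝ) : mittagLeffler a b 0 = (((Real.Gamma b)⁻¹ : ℝ) : ℂ) := by
  rw [mittagLeffler, tsum_eq_single 0 (fun n hn => by simp [hn])]
  simp

/-! ### Growth of Mittag-Leffler functions along rays -/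

/-- Estimate of a Hankel integral whose integrand is bounded and analytic in a strip. -/
theorem norm_hankel_strip_le {φ : ℝ} (hφ1 : Real.pi / 2 < φ) (hφ2 : φ ≤ Real.pi) (k : ℝ)
    {θ K R x₀ : ℝ} (hR : 0 ≤ R) {B : ℂ → ℂ}
    (hB : DifferentiableOn ℂ B {ζ | θ - φ ≤ ζ.im ∧ ζ.im ≤ θ + φ})
    (hK : ∀ ζ : ℂ, θ - φ ≤ ζ.im → ζ.im ≤ θ + φ → ‖B ζ‖ ≤ K) :
    ‖hankel φ R fun w => gammaKernel k w * B (w - (x₀ - θ * Complex.I))‖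
      ≤ K * hankelBound φ 0 k := by
  have hφ : Real.cos φ < 0 := Real.cos_neg_of_pi_div_two_lt_of_lt hφ1 (by linarith [Real.pi_pos])
  have hφ0 : 0 ≤ φ := by linarith [Real.pi_pos]
  have hstrip : ∀ w : ℂ, |w.im| ≤ φ → θ - φ ≤ (w - (x₀ - θ * Complex.I)).im ∧
      (w - (x₀ - θ * Complex.I)).im ≤ θ + φ := fun w hw => by
    have := abs_le.1 hw
    simp only [Complex.sub_im, Complex.ofReal_im, Complex.mul_im, Complex.ofReal_re, Complex.I_im,
      mul_one, Complex.I_re, mul_zero, add_zero, zero_sub, sub_neg_eq_add]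
    constructor <;> linarith
  have hd : DifferentiableOn ℂ (fun w => gammaKernel k w * B (w - (x₀ - θ * Complex.I)))
      {w | |w.im| ≤ φ} :=
    (differentiable_gammaKernel k).differentiableOn.mul
      (hB.comp (by fun_prop) (fun w hw => hstrip w hw))
  have hb : ∀ w ∈ hankelSet φ 0, ‖gammaKernel k w * B (w - (x₀ - θ * Complex.I))‖
      ≤ K * ‖Complex.exp (Complex.exp w + k * w)‖ := fun w hw => by
    obtain ⟨h1, h2⟩ := hstrip w (abs_im_le_of_mem_hankelSet hw)
    rw [norm_mul, mul_comm, gammaKernel]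
    exact mul_le_mul_of_nonneg_right (hK _ h1 h2) (norm_nonneg _)
  -- By analyticity the segment moves back to Re w = 0, after which the bound depends neither on R
  -- nor on x₀.
  rw [← hankel_eq_of_differentiableOn hφ0 hR (hd.mono fun w hw => hw.2.2)
    (hankel_integrable hφ0 hφ k
      (hd.continuousOn.mono fun w hw => abs_im_le_of_mem_hankelSet hw) hb)]
  exact norm_hankel_le hφ0 hφ k hb

/-- A continuous function on a closed strip is bounded if it is bounded off a compact part. -/
theorem bounded_on_strip {c d K : ℝ} {B : ℂ → ℂ}
    (hB : ContinuousOn B {ζ | c ≤ ζ.im ∧ ζ.im ≤ d})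
    (hK : ∀ ζ : ℂ, 1 ≤ |ζ.re| → ‖B ζ‖ ≤ K) :
    ∃ K', ∀ ζ : ℂ, c ≤ ζ.im → ζ.im ≤ d → ‖B ζ‖ ≤ K' := by
  have hc : IsCompact (Icc (-1) 1 ×ℂ Icc c d) := isCompact_Icc.reProdIm isCompact_Icc
  obtain ⟨K₁, hK₁⟩ := hc.exists_bound_of_continuousOn
    (hB.mono fun ζ hζ => (Complex.mem_reProdIm.1 hζ).2)
  refine ⟨max K K₁, fun ζ h1 h2 => ?_⟩
  rcases le_or_gt 1 |ζ.re| with h | h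
  · exact (hK ζ h).trans (le_max_left _ _)
  · exact (hK₁ ζ (Complex.mem_reProdIm.2 ⟨abs_le.1 h.le, h1, h2⟩)).trans (le_max_right _ _)

/-- Estimate of `exp(-cζ) / (1 - exp(-aζ))` away from the imaginary axis. -/
theorem norm_exp_div_le {a c : ℝ} (ha : 0 < a) (hc : 0 ≤ c) (hca : c ≤ a) {ζ : ℂ}
    (hζ : 1 ≤ |ζ.re|) :
    ‖Complex.exp (-(c * ζ)) / (1 - Complex.exp (-(a * ζ)))‖ ≤ (1 - Real.exp (-a))⁻¹ := by
  have hea : 0 < 1 - Real.exp (-a) := by simpa using ha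
  rw [norm_div, norm_exp_neg_mul]
  have h1 : |1 - Real.exp (-(a * ζ.re))| ≤ ‖1 - Complex.exp (-(a * ζ))‖ := by
    have := abs_norm_sub_norm_le (1 : ℂ) (Complex.exp (-(a * ζ)))
    rwa [norm_exp_neg_mul, norm_one] at this
  -- On the right the numerator is at most 1 because c ≥ 0; on the left it is at most e^{-a Re ζ}
  -- because c ≤ a.
  have h2 : Real.exp (-(c * ζ.re)) * (1 - Real.exp (-a)) ≤ |1 - Real.exp (-(a * ζ.re))| := by
    rcases le_abs'.1 hζ with h | h
    · rw [abs_sub_comm]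
      refine le_trans ?_ (le_abs_self _)
      have e1 : Real.exp (-(c * ζ.re)) ≤ Real.exp (-(a * ζ.re)) := Real.exp_le_exp.2 (by nlinarith)
      have e2 : Real.exp (-(a * ζ.re)) * Real.exp (-a) ≥ 1 := by
        rw [← Real.exp_add]; exact Real.one_le_exp (by nlinarith)
      nlinarith
    · refine le_trans ?_ (le_abs_self _)
      have e1 : Real.exp (-(c * ζ.re)) ≤ 1 := Real.exp_le_one_iff.2 (by nlinarith)
      have e2 : Real.exp (-(a * ζ.re)) ≤ Real.exp (-a) := Real.exp_le_exp.2 (by nlinarith)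
      nlinarith
  have h3 : 0 < ‖1 - Complex.exp (-(a * ζ))‖ :=
    lt_of_lt_of_le (mul_pos (Real.exp_pos _) hea) (h2.trans h1)
  rw [div_le_iff₀ h3, inv_mul_eq_div, le_div_iff₀ hea]
  exact h2.trans h1

/-- A zero forces aζ to be a multiple of 2πi, and in this strip the only such multiple is 0. -/
theorem one_sub_exp_ne_zero {a : ℝ} {ζ : ℂ} (h1 : -(2 * Real.pi) < a * ζ.im)
    (h2 : a * ζ.im < 2 * Real.pi) (h3 : a * ζ.im ≠ 0 ∨ a * ζ.re ≠ 0) :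
    1 - Complex.exp (-(a * ζ)) ≠ 0 := by
  intro h
  have h' : Complex.exp (-(a * ζ)) = 1 := (sub_eq_zero.1 h).symm
  obtain ⟨n, hn⟩ := Complex.exp_eq_one_iff.1 h'
  have him := congrArg Complex.im hn
  have hre := congrArg Complex.re hn
  simp only [Complex.neg_im, Complex.mul_im, Complex.intCast_re,
    Complex.intCast_im, Complex.re_ofNat, Complex.im_ofNat, Complex.ofReal_re, Complex.ofReal_im,
    Complex.I_re, Complex.I_im, Complex.mul_re, Complex.neg_re] at him hre
  ring_nf at him hre
  have hn0 : n = 0 := by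
    have hp := Real.pi_pos
    have b1 : (n : ℝ) < 1 := by nlinarith
    have b2 : (-1 : ℝ) < n := by nlinarith
    have c1 : n < 1 := by exact_mod_cast b1
    have c2 : -1 < n := by exact_mod_cast b2
    omega
  subst hn0
  simp only [Int.cast_zero] at him hre
  rcases h3 with h3 | h3
  · exact h3 (by linarith)
  · exact h3 (by linarith)

/-- This locates the pole w₀ = (log r)/α - iθ of the contour integrand. Whether θ = πβ/(2α) exceeds
π/2 separates boundedness from growth. -/
theorem neg_I_cpow_mul {α β r : ℝ} (hα : 0 < α) (hr : 0 < r) :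
    (-Complex.I) ^ (β : ℂ) * (r : ℂ)
      = Complex.exp (α * ((Real.log r / α : ℝ) - (Real.pi * β / (2 * α) : ℝ) * Complex.I)) := by
  rw [Complex.cpow_def_of_ne_zero (neg_ne_zero.2 Complex.I_ne_zero), Complex.log_neg_I]
  have h : (r : ℂ) = Complex.exp (Real.log r) := by
    rw [← Complex.ofReal_exp, Real.exp_log hr]
  conv_lhs => rw [h]
  rw [← Complex.exp_add]
  congr 1
  have : (α : ℂ) ≠ 0 := by exact_mod_cast hα.ne'
  push_cast
  field_simp
  ring

theorem norm_neg_I_cpow (β : ℝ) : ‖(-Complex.I) ^ (β : ℂ)‖ = 1 := by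
  rw [Complex.norm_cpow_of_ne_zero (neg_ne_zero.2 Complex.I_ne_zero)]
  simp

/-- Boundedness of Mittag-Leffler functions on rays outside the sector of exponential growth. -/
theorem mittagLeffler_bounded {α β : ℝ} (hα : 0 < α) (hβ1 : β ≤ 1) (hαβ : α < β) (b : ℝ) :
    ∃ C, ∀ r : ℝ, 0 ≤ r → ‖mittagLeffler α b ((-Complex.I) ^ (β : ℂ) * (r : ℂ))‖ ≤ C := by
  have hπ := Real.pi_pos
  set θ := Real.pi * β / (2 * α) with hθ
  have hαθ : α * θ = Real.pi * β / 2 := by rw [hθ]; field_simp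
  have hθ1 : Real.pi / 2 < θ := by
    rw [hθ, lt_div_iff₀ (by positivity)]; nlinarith
  -- φ > π/2 makes the kernel decay along the half lines, and φ < θ leaves the pole outside the
  -- strip |Im w| ≤ φ.
  obtain ⟨φ, hφ1, hφ⟩ := exists_between (lt_min hθ1 (show Real.pi / 2 < Real.pi by linarith))
  have hφ2 : φ ≤ Real.pi := hφ.le.trans (min_le_right _ _)
  have hφθ : φ < θ := hφ.trans_le (min_le_left _ _)
  set B : ℂ → ℂ := fun ζ => 1 / (1 - Complex.exp (-(α * ζ))) with hB
  have hne : ∀ ζ : ℂ, θ - φ ≤ ζ.im → ζ.im ≤ θ + φ → 1 - Complex.exp (-(α * ζ)) ≠ 0 := by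
    intro ζ h1 h2
    have h3 : 0 < ζ.im := by linarith
    have h4 : 0 < α * ζ.im := by positivity
    have h5 : α * ζ.im ≤ α * θ + α * φ := by nlinarith
    refine one_sub_exp_ne_zero (by linarith) (lt_of_le_of_lt h5 ?_) (Or.inl h4.ne')
    rw [hαθ]
    nlinarith
  have hBd : DifferentiableOn ℂ B {ζ | θ - φ ≤ ζ.im ∧ ζ.im ≤ θ + φ} :=
    DifferentiableOn.div (by fun_prop) (by fun_prop) fun ζ hζ => hne ζ hζ.1 hζ.2
  obtain ⟨K, hK⟩ := bounded_on_strip (K := (1 - Real.exp (-α))⁻¹) hBd.continuousOn fun ζ hζ => by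
    simpa [hB] using norm_exp_div_le hα le_rfl hα.le hζ
  -- The point r = 0 has no logarithm, so its value enters the bound separately.
  refine ⟨max (K * hankelBound φ 0 (1 - b)) ‖mittagLeffler α b 0‖, fun r hr => ?_⟩
  rcases hr.eq_or_lt with rfl | hr
  · simp
  refine le_trans ?_ (le_max_left _ _)
  obtain ⟨R, hR0, hR⟩ := exists_lt_exp_mul hα r 0
  rw [mittagLeffler_eq_hankel hφ1 hφ2 hα b (R := R) (by
    rw [norm_mul, norm_neg_I_cpow, one_mul, Complex.norm_real, Real.norm_of_nonneg hr.le]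
    exact hR)]
  refine le_trans (le_of_eq ?_) (norm_hankel_strip_le hφ1 hφ2 (1 - b) (x₀ := Real.log r / α)
    hR0 hBd hK)
  congr 2
  funext w
  rw [hB, neg_I_cpow_mul hα hr, ← hθ, ← Complex.exp_add, mul_one_div]
  ring_nf

/-- The function `ζ ↦ (1 - exp(-aζ)) / ζ`, extended to `0`. -/
def expQuot (a : ℝ) : ℂ → ℂ := dslope (fun ζ => 1 - Complex.exp (-(a * ζ))) 0

theorem differentiable_expQuot (a : ℝ) : Differentiable ℂ (expQuot a) := by
  rw [← differentiableOn_univ, expQuot, Complex.differentiableOn_dslope univ_mem]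
  fun_prop

theorem expQuot_zero (a : ℝ) : expQuot a 0 = a := by
  rw [expQuot, dslope_same]
  have h : HasDerivAt (fun ζ : ℂ => -(a * ζ)) (-(a * 1)) 0 := ((hasDerivAt_id (0 : ℂ)).const_mul _).neg
  have := (h.cexp.const_sub 1).deriv
  rw [this]
  simp

theorem expQuot_of_ne (a : ℝ) {ζ : ℂ} (hζ : ζ ≠ 0) :
    expQuot a ζ = (1 - Complex.exp (-(a * ζ))) / ζ := by
  rw [expQuot, dslope_of_ne _ hζ, slope_def_field]
  simp

/-- Mittag-Leffler functions on rays inside the sector of exponential growth. -/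
theorem mittagLeffler_growth {α β : ℝ} (hα : 0 < α) (hα1 : α ≤ 1) (hβ : 0 < β) (hβα : β ≤ α)
    {b : ℝ} (hb0 : 0 ≤ b) (hb1 : b ≤ 1) :
    ∃ C, 0 ≤ C ∧ ∀ r : ℝ, 0 < r → ‖mittagLeffler α b ((-Complex.I) ^ (β : ℂ) * (r : ℂ))‖ ≤
      C + 1 / α * r ^ ((1 - b) / α) *
        Real.exp (Real.cos (Real.pi * β / (2 * α)) * r ^ (1 / α)) := by
  have hπ := Real.pi_pos
  set θ := Real.pi * β / (2 * α) with hθ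
  have hθ0 : 0 < θ := by positivity
  have hθ1 : θ ≤ Real.pi / 2 := by
    rw [hθ, div_le_iff₀ (by positivity)]; nlinarith
  have hφ1 : Real.pi / 2 < Real.pi := by linarith
  have hφ2 : Real.pi ≤ Real.pi := le_rfl
  set U : Set ℂ := {ζ | -(2 * Real.pi) < ζ.im ∧ ζ.im < 2 * Real.pi} with hU
  have hUo : IsOpen U :=
    (isOpen_lt continuous_const Complex.continuous_im).inter
      (isOpen_lt Complex.continuous_im continuous_const)
  have hU0 : U ∈ 𝓝 (0 : ℂ) := hUo.mem_nhds (by simp [hU, hπ])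
  have hQ : ∀ a : ℝ, 0 < a → a ≤ 1 → ∀ ζ ∈ U, expQuot a ζ ≠ 0 := by
    intro a ha ha1 ζ hζ
    by_cases h0 : ζ = 0
    · rw [h0, expQuot_zero]; exact_mod_cast ha.ne'
    · rw [expQuot_of_ne a h0]
      refine div_ne_zero (one_sub_exp_ne_zero ?_ ?_ ?_) h0
      · nlinarith [hζ.1, hζ.2]
      · nlinarith [hζ.1, hζ.2]
      · by_contra! h
        exact h0 (Complex.ext (by simpa [ha.ne'] using h.2) (by simpa [ha.ne'] using h.1))
  -- 1/(1 - e^{-αζ}) and e^{-(1-b)ζ}/(α(1 - e^{-ζ})) both have residue 1/α at 0. G is ζ times their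
  -- difference, so G(0) = 0 and the difference extends analytically to B.
  set G : ℂ → ℂ := fun ζ => 1 / expQuot α ζ -
    1 / α * (Complex.exp (-((1 - b : ℝ) * ζ)) / expQuot 1 ζ) with hG
  have hGd : DifferentiableOn ℂ G U := by
    refine DifferentiableOn.sub (DifferentiableOn.div (by fun_prop)
      (differentiable_expQuot α).differentiableOn (hQ α hα hα1)) (DifferentiableOn.const_mul
      (DifferentiableOn.div (by fun_prop) (differentiable_expQuot 1).differentiableOn
      (hQ 1 one_pos le_rfl)) _)
  have hG0 : G 0 = 0 := by simp [hG, expQuot_zero]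
  set B : ℂ → ℂ := dslope G 0 with hB
  have hBU : DifferentiableOn ℂ B U := (Complex.differentiableOn_dslope hU0).2 hGd
  have hBne : ∀ ζ : ℂ, ζ ≠ 0 → B ζ = 1 / (1 - Complex.exp (-(α * ζ))) -
      1 / α * (Complex.exp (-((1 - b : ℝ) * ζ)) / (1 - Complex.exp (-ζ))) := by
    intro ζ hζ
    rw [hB, dslope_of_ne _ hζ, slope_def_field, hG0, sub_zero, sub_zero, hG]
    simp only [expQuot_of_ne _ hζ, Complex.ofReal_one, one_mul]
    field_simp
  have hsub : {ζ : ℂ | θ - Real.pi ≤ ζ.im ∧ ζ.im ≤ θ + Real.pi} ⊆ U := fun ζ hζ =>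
    ⟨by linarith [hζ.1], by linarith [hζ.2]⟩
  have hBd := hBU.mono hsub
  obtain ⟨K, hK⟩ := bounded_on_strip
    (K := (1 - Real.exp (-α))⁻¹ + ‖(1 / α : ℂ)‖ * (1 - Real.exp (-1))⁻¹)
    hBd.continuousOn fun ζ hζ => by
      have h0 : ζ ≠ 0 := by rintro rfl; norm_num at hζ
      rw [hBne ζ h0]
      refine (norm_sub_le _ _).trans (add_le_add ?_ ?_)
      · simpa using norm_exp_div_le hα le_rfl hα.le hζ
      · rw [norm_mul]
        refine mul_le_mul_of_nonneg_left ?_ (norm_nonneg _)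
        simpa using norm_exp_div_le one_pos (c := 1 - b) (by linarith) (by linarith) hζ
  refine ⟨|K * hankelBound Real.pi 0 (1 - b)|, abs_nonneg _, fun r hr => ?_⟩
  set x₀ := Real.log r / α with hx₀
  set w₀ : ℂ := x₀ - θ * Complex.I with hw₀
  have hz : (-Complex.I) ^ (β : ℂ) * (r : ℂ) = Complex.exp (α * w₀) := neg_I_cpow_mul hα hr
  have hre : w₀.re = x₀ := by simp [hw₀]
  have him : w₀.im = -θ := by simp [hw₀]
  -- R ≥ 0 allows the segment to return to Re w = 0, and R > x₀ puts the contour to the right of the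
  -- pole.
  set R := max 0 (x₀ + 1) with hR
  have hR0 : 0 ≤ R := le_max_left _ _
  have hRx : x₀ < R := by linarith [le_max_right 0 (x₀ + 1)]
  have h1 : mittagLeffler α b (Complex.exp (α * w₀)) = hankel Real.pi R fun w =>
      gammaKernel (1 - b) w / (1 - Complex.exp (α * w₀) * Complex.exp (-(α * w))) :=
    mittagLeffler_eq_hankel hφ1 hφ2 hα b (by
      rw [Complex.norm_exp, Complex.re_ofReal_mul, hre, Real.exp_lt_exp]
      nlinarith)
  -- The exponential is the case a = b = 1, with the same pole w₀. Subtracting its representation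
  -- takes the place of the residue theorem.
  have h2 : Complex.exp (Complex.exp w₀) = hankel Real.pi R fun w =>
      gammaKernel (1 - 1) w / (1 - Complex.exp w₀ * Complex.exp (-((1 : ℝ) * w))) := by
    rw [← mittagLeffler_one_one]
    exact mittagLeffler_eq_hankel hφ1 hφ2 one_pos 1 (by
      rw [Complex.norm_exp, hre, Real.exp_lt_exp]; linarith)
  have hφ0 : 0 ≤ Real.pi := hπ.le
  have hcosπ : Real.cos Real.pi < 0 := by simp
  have hre_ne : ∀ w ∈ hankelSet Real.pi R, w - w₀ ≠ 0 := fun w hw h => by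
    have := le_re_of_mem_hankelSet hw
    have h' := congrArg Complex.re h
    simp only [Complex.sub_re, hre, Complex.zero_re] at h'
    linarith
  have hint : ∀ k a : ℝ, 0 < a → ∀ j, Integrable (fun x =>
      (fun w => gammaKernel k w / (1 - Complex.exp (a * w₀) * Complex.exp (-(a * w))))
        (hankelPath Real.pi R j x)) (hankelMeasure Real.pi R j) := by
    intro k a ha j
    have hρ : Real.exp (a * (x₀ - R)) < 1 := by
      rw [← Real.exp_zero]; exact Real.exp_lt_exp.2 (by nlinarith)
    have hlow : ∀ w ∈ hankelSet Real.pi R, 1 - Real.exp (a * (x₀ - R)) ≤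
        ‖1 - Complex.exp (a * w₀) * Complex.exp (-(a * w))‖ := fun w hw => by
      have h3 := norm_sub_norm_le (1 : ℂ) (Complex.exp (a * w₀) * Complex.exp (-(a * w)))
      rw [norm_one, norm_mul, norm_exp_neg_mul, Complex.norm_exp, Complex.re_ofReal_mul, hre,
        ← Real.exp_add] at h3
      have h4 := le_re_of_mem_hankelSet hw
      have h5 : Real.exp (a * x₀ + -(a * w.re)) ≤ Real.exp (a * (x₀ - R)) :=
        Real.exp_le_exp.2 (by nlinarith)
      linarith
    refine hankel_integrable (F := fun w => gammaKernel k w /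
      (1 - Complex.exp (a * w₀) * Complex.exp (-(a * w)))) hφ0 hcosπ
      (K := (1 - Real.exp (a * (x₀ - R)))⁻¹) k ?_ ?_ j
    · refine ContinuousOn.div (differentiable_gammaKernel k).continuous.continuousOn (by fun_prop)
        fun w hw h => ?_
      have := hlow w hw
      rw [h, norm_zero] at this
      linarith
    · intro w hw
      have h6 := hlow w hw
      rw [norm_div, div_eq_inv_mul, gammaKernel]
      gcongr
  have h3 : mittagLeffler α b (Complex.exp (α * w₀)) -
      1 / α * Complex.exp ((1 - b : ℝ) * w₀) * Complex.exp (Complex.exp w₀)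
      = hankel Real.pi R fun w => gammaKernel (1 - b) w * B (w - w₀) := by
    rw [h1, h2, ← hankel_const_mul, ← hankel_sub (hint (1 - b) α hα) (fun j => by
      have := (hint (1 - 1) 1 one_pos j).const_mul (1 / α * Complex.exp ((1 - b : ℝ) * w₀))
      simpa only [Complex.ofReal_one, one_mul] using this)]
    unfold hankel
    congr 1
    refine Finset.sum_congr rfl fun j _ => ?_
    congr 1
    refine integral_congr_ae ?_
    filter_upwards [hankelPath_mem hφ0 j] with x hx
    generalize hankelPath Real.pi R j x = w at hx
    have hk : gammaKernel (1 - b) w = Complex.exp ((1 - b : ℝ) * w) * gammaKernel (1 - 1) w := by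
      simp only [gammaKernel, ← Complex.exp_add]
      congr 1
      push_cast
      ring
    have hk2 : Complex.exp ((1 - b : ℝ) * w₀)
        = Complex.exp ((1 - b : ℝ) * w) * Complex.exp (-((1 - b : ℝ) * (w - w₀))) := by
      rw [← Complex.exp_add]; ring_nf
    have hk3 : Complex.exp (α * w₀) * Complex.exp (-(α * w)) = Complex.exp (-(α * (w - w₀))) := by
      rw [← Complex.exp_add]; ring_nf
    have hk4 : Complex.exp w₀ * Complex.exp (-((1 : ℝ) * w)) = Complex.exp (-(w - w₀)) := by
      rw [← Complex.exp_add]; push_cast; ring_nf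
    rw [hBne _ (hre_ne w hx), hk3, hk4, hk2, hk]
    ring
  have h4 := norm_hankel_strip_le hφ1 hφ2 (1 - b) (x₀ := x₀) hR0 hBd hK
  rw [← hw₀, ← h3] at h4
  have h5 : ‖(1 / α : ℂ) * Complex.exp ((1 - b : ℝ) * w₀) * Complex.exp (Complex.exp w₀)‖ =
      1 / α * r ^ ((1 - b) / α) * Real.exp (Real.cos θ * r ^ (1 / α)) := by
    rw [norm_mul, norm_mul, Complex.norm_exp, Complex.norm_exp, Complex.re_ofReal_mul, hre,
      Complex.exp_re, hre, him, Real.cos_neg, Real.rpow_def_of_pos hr, Real.rpow_def_of_pos hr,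
      norm_div, norm_one, Complex.norm_real, Real.norm_of_nonneg hα.le, hx₀, mul_comm (Real.cos θ)]
    congr 3
    · ring
    · ring_nf
  rw [hz]
  calc ‖mittagLeffler α b (Complex.exp (α * w₀))‖ ≤ _ := norm_le_norm_sub_add _
        ((1 / α : ℂ) * Complex.exp ((1 - b : ℝ) * w₀) * Complex.exp (Complex.exp w₀))
    _ ≤ _ := by
      rw [h5]
      gcongr
      exact h4.trans (le_abs_self _)


/-! ### Fractional integrals of powers and of Mittag-Leffler functions -/

theorem integral_rpow_mul_rpow {p c t : ℝ} (hp : 0 < p) (hc : 0 < c) (ht : 0 < t) :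
    ∫ s in (0 : ℝ)..t, (t - s) ^ (c - 1) * s ^ (p - 1)
      = t ^ (p + c - 1) * (Real.Gamma p * Real.Gamma c / Real.Gamma (p + c)) := by
  have h1 := Complex.betaIntegral_scaled (p : ℂ) (c : ℂ) ht
  have h2 := Complex.Gamma_mul_Gamma_eq_betaIntegral (s := (p : ℂ)) (t := (c : ℂ))
    (by simpa using hp) (by simpa using hc)
  have hG : Real.Gamma (p + c) ≠ 0 := (Real.Gamma_pos_of_pos (by linarith)).ne'
  rw [← Complex.ofReal_add, Complex.Gamma_ofReal, Complex.Gamma_ofReal, Complex.Gamma_ofReal] at h2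
  have h3 : Complex.betaIntegral p c
      = ((Real.Gamma p * Real.Gamma c / Real.Gamma (p + c) : ℝ) : ℂ) := by
    have : (Real.Gamma (p + c) : ℂ) ≠ 0 := by exact_mod_cast hG
    push_cast
    rw [h2]
    field_simp
  have h4 : ∫ s in (0 : ℝ)..t, (s : ℂ) ^ ((p : ℂ) - 1) * ((t : ℂ) - s) ^ ((c : ℂ) - 1)
      = ∫ s in (0 : ℝ)..t, (((t - s) ^ (c - 1) * s ^ (p - 1) : ℝ) : ℂ) := by
    refine intervalIntegral.integral_congr_ae (Eventually.of_forall fun s hs => ?_)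
    rw [uIoc_of_le ht.le] at hs
    rw [Complex.ofReal_mul, Complex.ofReal_cpow (by linarith [hs.2]), Complex.ofReal_cpow hs.1.le]
    push_cast
    ring
  rw [h4, intervalIntegral.integral_ofReal, h3] at h1
  have h5 : ((t : ℂ)) ^ ((p : ℂ) + c - 1) = ((t ^ (p + c - 1) : ℝ) : ℂ) := by
    rw [Complex.ofReal_cpow ht.le]; push_cast; rfl
  rw [h5] at h1
  exact_mod_cast h1

/-- The integral of a non-integrable function is 0 by convention, whereas the Beta integral is
positive. -/
theorem intervalIntegrable_rpow_mul_rpow {p c t : ℝ} (hp : 0 < p) (hc : 0 < c) (ht : 0 < t) :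
    IntervalIntegrable (fun s => (t - s) ^ (c - 1) * s ^ (p - 1)) volume 0 t := by
  by_contra h
  have h1 := integral_rpow_mul_rpow hp hc ht
  rw [intervalIntegral.integral_undef h] at h1
  have := Real.Gamma_pos_of_pos hp
  have := Real.Gamma_pos_of_pos hc
  have := Real.Gamma_pos_of_pos (show 0 < p + c by linarith)
  have := Real.rpow_pos_of_pos ht (p + c - 1)
  exact absurd h1.symm (by positivity)

/-- The fractional integral of order `c` of `s ↦ s ^ (α - 1) * E_{α,α}(k s ^ α)`. -/
theorem integral_rpow_mul_mittagLeffler {α c t : ℝ} (hα : 0 < α) (hc : 0 < c) (ht : 0 < t) (k : ℂ) :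
    ∫ s in (0 : ℝ)..t, (((t - s) ^ (c - 1) * s ^ (α - 1) : ℝ) : ℂ) *
        mittagLeffler α α (k * ((s ^ α : ℝ) : ℂ))
      = ((Real.Gamma c * t ^ (α + c - 1) : ℝ) : ℂ) *
        mittagLeffler α (α + c) (k * ((t ^ α : ℝ) : ℂ)) := by
  have hp : ∀ n : ℕ, 0 < α * n + α := fun n => by positivity
  set F : ℕ → ℝ → ℂ := fun n s => (k ^ n / ((Real.Gamma (α * n + α) : ℝ) : ℂ)) *
    (((t - s) ^ (c - 1) * s ^ (α * n + α - 1) : ℝ) : ℂ) with hF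
  have hFi : ∀ n, IntegrableOn (F n) (Ioc 0 t) := fun n =>
    ((intervalIntegrable_iff_integrableOn_Ioc_of_le ht.le).1
      (intervalIntegrable_rpow_mul_rpow (hp n) hc ht)).ofReal.const_mul _
  have hint : ∀ n : ℕ, ∫ s in Ioc 0 t, (t - s) ^ (c - 1) * s ^ (α * n + α - 1)
      = t ^ (α + c - 1) * (t ^ α) ^ n *
        (Real.Gamma (α * n + α) * Real.Gamma c / Real.Gamma (α * n + (α + c))) := fun n => by
    rw [← intervalIntegral.integral_of_le ht.le, integral_rpow_mul_rpow (hp n) hc ht,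
      ← Real.rpow_natCast, ← Real.rpow_mul ht.le, ← Real.rpow_add ht, add_assoc]
    congr 2
    ring
  have hG : ∀ n : ℕ, (Real.Gamma (α * n + α) : ℂ) ≠ 0 := fun n => by
    exact_mod_cast (Real.Gamma_pos_of_pos (hp n)).ne'
  have hFint : ∀ n, ∫ s in Ioc 0 t, F n s = ((Real.Gamma c * t ^ (α + c - 1) : ℝ) : ℂ) *
      ((k * ((t ^ α : ℝ) : ℂ)) ^ n / ((Real.Gamma (α * n + (α + c)) : ℝ) : ℂ)) := fun n => by
    have := hG n
    rw [hF]
    simp only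
    rw [integral_const_mul, integral_complex_ofReal, hint]
    push_cast
    generalize (Real.Gamma (α * n + α) : ℂ) = G at this ⊢
    rw [mul_pow]
    field_simp
  -- Each F n is a constant times a nonnegative function, so its L¹ norm is the modulus of its
  -- integral, and summability reduces to absolute convergence of the Mittag-Leffler series.
  have hFnorm : ∀ n, ∫ s in Ioc 0 t, ‖F n s‖ = ‖((Real.Gamma c * t ^ (α + c - 1) : ℝ) : ℂ) *
      ((k * ((t ^ α : ℝ) : ℂ)) ^ n / ((Real.Gamma (α * n + (α + c)) : ℝ) : ℂ))‖ := fun n => by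
    rw [← hFint, hF]
    simp only
    rw [integral_const_mul, norm_mul, integral_complex_ofReal, Complex.norm_real,
      Real.norm_of_nonneg, ← integral_const_mul]
    · refine setIntegral_congr_fun measurableSet_Ioc fun s hs => ?_
      rw [norm_mul, Complex.norm_real, Real.norm_of_nonneg]
      exact mul_nonneg (Real.rpow_nonneg (by linarith [hs.2]) _) (Real.rpow_nonneg hs.1.le _)
    · refine setIntegral_nonneg measurableSet_Ioc fun s hs => ?_
      exact mul_nonneg (Real.rpow_nonneg (by linarith [hs.2]) _) (Real.rpow_nonneg hs.1.le _)
  have hsum := (hasSum_mittagLeffler hα (α + c) (k * ((t ^ α : ℝ) : ℂ))).mul_left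
    ((Real.Gamma c * t ^ (α + c - 1) : ℝ) : ℂ)
  have h1 := hasSum_integral_of_summable_integral_norm hFi (by
    simp_rw [hFnorm]; exact hsum.summable.norm)
  simp_rw [hFint] at h1
  rw [← h1.unique hsum, intervalIntegral.integral_of_le ht.le]
  refine setIntegral_congr_fun measurableSet_Ioc fun s hs => ?_
  have h2 := (hasSum_mittagLeffler hα α (k * ((s ^ α : ℝ) : ℂ))).mul_left
    (((t - s) ^ (c - 1) * s ^ (α - 1) : ℝ) : ℂ)
  rw [← h2.tsum_eq]
  congr 1
  funext n
  have h3 : s ^ (α * n + α - 1) = s ^ (α - 1) * (s ^ α) ^ n := by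
    rw [← Real.rpow_natCast, ← Real.rpow_mul hs.1.le, ← Real.rpow_add hs.1]
    congr 1
    ring
  rw [hF]
  simp only [h3]
  push_cast
  ring

/-- The term n = 0 is split off. For b = 1 this turns the integrated time derivative into an
increment of the solution. -/
theorem mittagLeffler_succ {α : ℝ} (hα : 0 < α) (b : ℝ) (z : ℂ) :
    mittagLeffler α b z = (((Real.Gamma b)⁻¹ : ℝ) : ℂ) + z * mittagLeffler α (α + b) z := by
  rw [mittagLeffler, (summable_mittagLeffler hα b z).tsum_eq_zero_add, mittagLeffler, ← tsum_mul_left]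
  congr 1
  · simp
  · congr 1
    funext n
    rw [pow_succ, show α * ((n + 1 : ℕ) : ℝ) + b = α * n + (α + b) by push_cast; ring]
    ring


/-! ### The operator `H₀` on the Fourier side -/

/-- Locally integrable functions that agree against all smooth compactly supported test functions
agree a.e. This brings the distributional definition of H₀ down to pointwise identities. -/
theorem toTemperedDistribution_eq_smulLeftCLM_iff {d : ℕ} {m : Sp d → ℂ}
    (hm : m.HasTemperateGrowth) (f g : L2 d) :
    (f : 𝓢'(Sp d, ℂ)) = TemperedDistribution.smulLeftCLM ℂ m (g : 𝓢'(Sp d, ℂ)) ↔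
      (f : Sp d → ℂ) =ᵐ[volume] fun x => m x * g x := by
  have happly : ∀ u : 𝓢(Sp d, ℂ),
      TemperedDistribution.smulLeftCLM ℂ m (g : 𝓢'(Sp d, ℂ)) u = ∫ x, u x * (m x * g x) := by
    intro u
    rw [TemperedDistribution.smulLeftCLM_apply_apply, Lp.toTemperedDistribution_apply]
    refine integral_congr_ae (Eventually.of_forall fun x => ?_)
    simp only [SchwartzMap.smulLeftCLM_apply_apply hm, smul_eq_mul]
    ring
  have hm' : Continuous m := hm.1.continuous
  constructor
  · intro h
    refine ae_eq_of_integral_contDiff_smul_eq ((Lp.memLp f).locallyIntegrable (by norm_num)) ?_ ?_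
    · exact LocallyIntegrable.continuous_smul hm' ((Lp.memLp g).locallyIntegrable (by norm_num))
    · intro ψ hψ hc
      have hc' : HasCompactSupport (Complex.ofRealCLM ∘ ψ) := hc.comp_left rfl
      have hψ' : ContDiff ℝ ∞ (Complex.ofRealCLM ∘ ψ) := by fun_prop
      have h1 := DFunLike.congr_fun h (hc'.toSchwartzMap hψ')
      rw [happly, Lp.toTemperedDistribution_apply] at h1
      simpa [Complex.real_smul] using h1
  · intro h
    ext u
    rw [happly, Lp.toTemperedDistribution_apply]
    refine integral_congr_ae ?_
    filter_upwards [h] with x hx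
    rw [hx, smul_eq_mul]

/-- With its converse below, the passage between the unitary transform and 𝓕, in which the
distributional results are formulated. -/
theorem fourierL2_ae {d : ℕ} (v : L2 d) :
    (fourierL2 d v : Sp d → ℂ) =ᵐ[volume] fun ξ =>
      ((((2 * Real.pi)⁻¹ : ℝ) ^ ((d : ℝ) / 2) : ℝ) : ℂ) * (𝓕 v : L2 d) ((2 * Real.pi)⁻¹ • ξ) :=
  (memLp_dilate (show 0 < (2 * Real.pi)⁻¹ by positivity) (𝓕 v : L2 d)).coeFn_toLp

theorem fourier_ae {d : ℕ} (v : L2 d) :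
    ((𝓕 v : L2 d) : Sp d → ℂ) =ᵐ[volume] fun ξ =>
      (((2 * Real.pi : ℝ) ^ ((d : ℝ) / 2) : ℝ) : ℂ) * fourierL2 d v ((2 * Real.pi) • ξ) := by
  filter_upwards [(quasi_dilate (show 0 < 2 * Real.pi by positivity)).ae (fourierL2_ae v)] with ξ h
  rw [h, smul_smul, inv_mul_cancel₀ (by positivity), one_smul, ← mul_assoc, ← Complex.ofReal_mul,
    Real.inv_rpow (by positivity), mul_inv_cancel₀ (by positivity)]
  simp

theorem hasTemperateGrowth_norm_sq (d : ℕ) :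
    (fun x : Sp d => ((‖x‖ ^ 2 : ℝ) : ℂ)).HasTemperateGrowth := by
  fun_prop

/-- The factor (2π)² reflects the kernel of 𝓕; the dilation in `fourierL2` removes it. -/
theorem fourier_neg_laplacian {d : ℕ} (v : L2 d) :
    𝓕 (-Δ (v : 𝓢'(Sp d, ℂ))) = TemperedDistribution.smulLeftCLM ℂ
      (fun x : Sp d => (((2 * Real.pi) ^ 2 * ‖x‖ ^ 2 : ℝ) : ℂ)) ((𝓕 v : L2 d) : 𝓢'(Sp d, ℂ)) := by
  have e : (fun x : Sp d => (((2 * Real.pi) ^ 2 * ‖x‖ ^ 2 : ℝ) : ℂ))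
      = (((2 * Real.pi) ^ 2 : ℝ) : ℂ) • fun x : Sp d => ((‖x‖ ^ 2 : ℝ) : ℂ) := by
    funext x; simp
  rw [e, TemperedDistribution.smulLeftCLM_smul (hasTemperateGrowth_norm_sq d),
    TemperedDistribution.laplacian_eq_fourierMultiplierCLM, neg_smul, neg_neg,
    ← Complex.coe_smul, FourierTransform.fourier_smul,
    TemperedDistribution.fourierMultiplierCLM_apply, FourierTransform.fourier_fourierInv_eq,
    Lp.fourier_toTemperedDistribution_eq]
  rfl

theorem fourier_H0_ae {d : ℕ} {v : L2 d} (hv : v ∈ domH0 d) :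
    ((𝓕 (H0 v) : L2 d) : Sp d → ℂ) =ᵐ[volume]
      fun x => (((2 * Real.pi) ^ 2 * ‖x‖ ^ 2 : ℝ) : ℂ) * (𝓕 v : L2 d) x := by
  rw [← toTemperedDistribution_eq_smulLeftCLM_iff (by fun_prop), ← fourier_neg_laplacian,
    ← H0_spec hv, Lp.fourier_toTemperedDistribution_eq]

/-- `F(H₀ v) = |ξ|² v̂` for `v ∈ D(H₀)`. -/
theorem fourierL2_H0 {d : ℕ} {v : L2 d} (hv : v ∈ domH0 d) :
    (fourierL2 d (H0 v) : Sp d → ℂ) =ᵐ[volume]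
      fun ξ => ((‖ξ‖ ^ 2 : ℝ) : ℂ) * fourierL2 d v ξ := by
  have hc : 0 < (2 * Real.pi)⁻¹ := by positivity
  filter_upwards [fourierL2_ae (H0 v), fourierL2_ae v, (quasi_dilate hc).ae (fourier_H0_ae hv)]
    with ξ h1 h2 h3
  rw [h1, h2, h3, norm_smul, Real.norm_of_nonneg hc.le]
  have : (Real.pi : ℂ) ≠ 0 := by exact_mod_cast Real.pi_ne_zero
  push_cast
  field_simp

/-- `D(H₀)` consists of the `v ∈ L²` with `|ξ|² v̂ ∈ L²`. -/
theorem mem_domH0_iff {d : ℕ} {v : L2 d} :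
    v ∈ domH0 d ↔ MemLp (fun ξ : Sp d => ((‖ξ‖ ^ 2 : ℝ) : ℂ) * fourierL2 d v ξ) 2 volume := by
  constructor
  · intro hv
    exact (memLp_congr_ae (fourierL2_H0 hv)).1 (Lp.memLp _)
  · intro h
    have hc : 0 < 2 * Real.pi := by positivity
    -- The dilate of (1 + |ξ|²) v̂ dominates the Bessel weight applied to 𝓕 v, because 1 + |x|² ≤ 1
    -- + |2πx|².
    have h1 := memLp_dilate hc (((Lp.memLp (fourierL2 d v)).add h).toLp)
    have hb : (fun x : Sp d => (((1 + ‖x‖ ^ 2) ^ ((2 : ℝ) / 2) : ℝ) : ℂ)).HasTemperateGrowth := by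
      fun_prop
    have h2 : MemLp (fun x : Sp d => (((1 + ‖x‖ ^ 2) ^ ((2 : ℝ) / 2) : ℝ) : ℂ) * (𝓕 v : L2 d) x)
        2 volume := by
      refine h1.mono (hb.1.continuous.aestronglyMeasurable.mul (Lp.aestronglyMeasurable _)) ?_
      filter_upwards [(quasi_dilate hc).ae ((Lp.memLp (fourierL2 d v)).add h).coeFn_toLp,
        fourier_ae v] with x e1 e2
      rw [e1, e2]
      simp only [Pi.add_apply]
      rw [← one_add_mul, mul_left_comm, norm_mul, norm_mul, norm_mul, norm_mul]
      gcongr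
      rw [div_self two_ne_zero, Real.rpow_one, ← Complex.ofReal_one, ← Complex.ofReal_add,
        Complex.norm_real, Complex.norm_real, norm_smul, Real.norm_of_nonneg (by positivity),
        Real.norm_of_nonneg (by positivity), Real.norm_of_nonneg hc.le, mul_pow]
      have : (1 : ℝ) ≤ (2 * Real.pi) ^ 2 := one_le_pow₀ (by linarith [Real.pi_gt_three])
      nlinarith [sq_nonneg ‖x‖]
    refine TemperedDistribution.memSobolev_iff_exists_smulLeftCLM_fourier.2 ⟨h2.toLp, ?_⟩
    rw [Lp.fourier_toTemperedDistribution_eq]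
    exact ((toTemperedDistribution_eq_smulLeftCLM_iff hb _ _).2 h2.coeFn_toLp).symm


/-! ### Multiplication operators on `L²` depending on time -/

theorem mulL2_ae {d : ℕ} {m : Sp d → ℂ} {f : L2 d} (h : MemLp (fun ξ => m ξ * f ξ) 2 volume) :
    (mulL2 m f : Sp d → ℂ) =ᵐ[volume] fun ξ => m ξ * f ξ := by
  rw [mulL2, dif_pos h]
  exact h.coeFn_toLp

theorem norm_sq_L2 {d : ℕ} (f : L2 d) : ‖f‖ ^ 2 = ∫ ξ, ‖f ξ‖ ^ 2 := by
  have h := @inner_self_eq_norm_sq_to_K ℂ _ _ _ _ f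
  rw [L2.inner_def] at h
  have h2 : ∀ ξ, inner ℂ (f ξ) (f ξ) = ((‖f ξ‖ ^ 2 : ℝ) : ℂ) := fun ξ => by
    rw [inner_self_eq_norm_sq_to_K]; push_cast; rfl
  simp_rw [h2] at h
  rw [integral_complex_ofReal] at h
  exact Complex.ofReal_injective (h.trans (Complex.ofReal_pow _ _).symm).symm

theorem memLp_mul_of_le {d : ℕ} {m : Sp d → ℂ} (hm : AEStronglyMeasurable m volume) {h G : L2 d}
    {K : ℝ} (hb : ∀ᵐ ξ, ‖m ξ * h ξ‖ ≤ K * ‖G ξ‖) : MemLp (fun ξ => m ξ * h ξ) 2 volume :=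
  (Lp.memLp G).of_le_mul (hm.mul (Lp.aestronglyMeasurable h)) hb

theorem norm_le_of_ae_mul {d : ℕ} {m : Sp d → ℂ} {f h G : L2 d} {K : ℝ}
    (hf : (f : Sp d → ℂ) =ᵐ[volume] fun ξ => m ξ * h ξ)
    (hb : ∀ᵐ ξ, ‖m ξ * h ξ‖ ≤ K * ‖G ξ‖) : ‖f‖ ≤ K * ‖G‖ := by
  refine Lp.norm_le_mul_norm_of_ae_le_mul ?_
  filter_upwards [hf, hb] with ξ h1 h2
  rwa [h1]

/-- Dominated continuity of `t ↦ m(t, ·) h` in `L²`. -/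
theorem continuousWithinAt_L2 {d : ℕ} {S : Set ℝ} {t₀ : ℝ} (ht₀ : t₀ ∈ S) {f : ℝ → L2 d}
    {m : ℝ → Sp d → ℂ} {h G : L2 d} {K : ℝ}
    (hf : ∀ t ∈ S, (f t : Sp d → ℂ) =ᵐ[volume] fun ξ => m t ξ * h ξ)
    (hm : ∀ ξ, ContinuousWithinAt (fun t => m t ξ) S t₀)
    (hb : ∀ᶠ t in 𝓝[S] t₀, ∀ᵐ ξ, ‖m t ξ * h ξ‖ ≤ K * ‖G ξ‖) :
    ContinuousWithinAt f S t₀ := by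
  have hb0 : ∀ᵐ ξ, ‖m t₀ ξ * h ξ‖ ≤ K * ‖G ξ‖ := hb.self_of_nhdsWithin ht₀
  have hsub : ∀ t ∈ S, ((f t - f t₀ : L2 d) : Sp d → ℂ)
      =ᵐ[volume] fun ξ => m t ξ * h ξ - m t₀ ξ * h ξ := fun t ht => by
    filter_upwards [hf t ht, hf t₀ ht₀, Lp.coeFn_sub (f t) (f t₀)] with ξ h3 h4 h5
    rw [h5, Pi.sub_apply, h3, h4]
  have hlim : Tendsto (fun t => ∫ ξ, ‖m t ξ * h ξ - m t₀ ξ * h ξ‖ ^ 2) (𝓝[S] t₀)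
      (𝓝 (∫ _ : Sp d, (0 : ℝ))) := by
    refine tendsto_integral_filter_of_dominated_convergence (fun ξ => (2 * K) ^ 2 * ‖G ξ‖ ^ 2)
      ?_ ?_ ?_ ?_
    · filter_upwards [self_mem_nhdsWithin] with t htS
      exact (((Lp.aestronglyMeasurable _).congr (hsub t htS)).norm.pow 2)
    · filter_upwards [hb] with t hbt
      filter_upwards [hbt, hb0] with ξ h1 h2
      rw [Real.norm_of_nonneg (by positivity), ← mul_pow]
      refine pow_le_pow_left₀ (norm_nonneg _) ((norm_sub_le _ _).trans ?_) 2
      linarith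
    · exact ((Lp.memLp G).integrable_norm_pow (by norm_num)).const_mul _
    · refine Eventually.of_forall fun ξ => ?_
      have h1 := (((hm ξ).tendsto.mul_const (h ξ)).sub_const (m t₀ ξ * h ξ)).norm.pow 2
      simpa using h1
  have hlim2 : Tendsto (fun t => ‖f t - f t₀‖ ^ 2) (𝓝[S] t₀) (𝓝 0) := by
    rw [integral_zero] at hlim
    refine hlim.congr' ?_
    filter_upwards [self_mem_nhdsWithin] with t htS
    rw [norm_sq_L2]
    refine integral_congr_ae ?_
    filter_upwards [hsub t htS] with ξ h1
    rw [h1]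
  have hlim3 := hlim2.sqrt
  simp only [Real.sqrt_sq (norm_nonneg _), Real.sqrt_zero] at hlim3
  exact tendsto_iff_norm_sub_tendsto_zero.2 hlim3

/-- The Bochner integral of `t ↦ m(t, ·) h` is `(∫ m(t, ·) dt) h`. -/
theorem integral_L2_ae {d : ℕ} {S : Set ℝ} (hS : MeasurableSet S) {f : ℝ → L2 d}
    {m : ℝ → Sp d → ℂ} {h G : L2 d} {k : ℝ → ℝ}
    (hfi : IntegrableOn f S) (hk : IntegrableOn k S)
    (hm : Measurable (Function.uncurry m))
    (hf : ∀ t ∈ S, (f t : Sp d → ℂ) =ᵐ[volume] fun ξ => m t ξ * h ξ)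
    (hb : ∀ᵐ ξ, ∀ t ∈ S, ‖m t ξ * h ξ‖ ≤ k t * ‖G ξ‖) :
    ((∫ t in S, f t : L2 d) : Sp d → ℂ) =ᵐ[volume] fun ξ => (∫ t in S, m t ξ) * h ξ := by
  have hJm : AEStronglyMeasurable (fun ξ => ∫ t in S, m t ξ) (volume : Measure (Sp d)) :=
    (hm.stronglyMeasurable.integral_prod_left'
      (μ := (volume : Measure ℝ).restrict S)).aestronglyMeasurable
  have hJ : MemLp (fun ξ => (∫ t in S, m t ξ) * h ξ) 2 volume := by
    refine memLp_mul_of_le hJm (G := G) (K := ∫ t in S, k t) ?_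
    filter_upwards [hb] with ξ hξ
    rw [← integral_mul_const, ← integral_mul_const]
    refine norm_integral_le_of_norm_le (hk.mul_const _) ?_
    exact (ae_restrict_iff' hS).2 (Eventually.of_forall hξ)
  suffices h1 : (∫ t in S, f t) = hJ.toLp by
    rw [h1]; exact hJ.coeFn_toLp
  -- Paired with ψ, the claim becomes Fubini's theorem, with the integrable majorant k(t) |G(ξ)|
  -- |ψ(ξ)|.
  refine ext_inner_left ℂ fun ψ => ?_
  rw [← integral_inner hfi, L2.inner_def]
  have e1 : ∫ t in S, inner ℂ ψ (f t)
      = ∫ t in S, ∫ ξ, m t ξ * h ξ * (starRingEnd ℂ) (ψ ξ) := by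
    refine setIntegral_congr_fun hS fun t ht => ?_
    simp only [L2.inner_def]
    refine integral_congr_ae ?_
    filter_upwards [hf t ht] with ξ hξ
    rw [RCLike.inner_apply, hξ]
  have e2 : ∫ ξ, inner ℂ (ψ ξ) ((MemLp.toLp _ hJ : L2 d) ξ)
      = ∫ ξ, ∫ t in S, m t ξ * h ξ * (starRingEnd ℂ) (ψ ξ) := by
    refine integral_congr_ae ?_
    filter_upwards [hJ.coeFn_toLp] with ξ hξ
    rw [RCLike.inner_apply, hξ, ← integral_mul_const, ← integral_mul_const]
  rw [e1, e2]
  refine integral_integral_swap ?_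
  have hGψ : Integrable (fun ξ => ‖G ξ‖ * ‖ψ ξ‖) volume :=
    (Lp.memLp G).norm.integrable_mul (Lp.memLp ψ).norm
  refine (Integrable.mul_prod hk hGψ).mono' ?_ ?_
  · refine (hm.aestronglyMeasurable.mul ?_).mul ?_
    · exact (Lp.aestronglyMeasurable h).comp_snd
    · exact (Complex.continuous_conj.comp_aestronglyMeasurable (Lp.aestronglyMeasurable ψ)).comp_snd
  · have q1 := (Measure.quasiMeasurePreserving_snd (μ := (volume : Measure ℝ).restrict S)
      (ν := (volume : Measure (Sp d)))).ae hb
    have q2 := (Measure.quasiMeasurePreserving_fst (μ := (volume : Measure ℝ).restrict S)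
      (ν := (volume : Measure (Sp d)))).ae (ae_restrict_mem hS)
    filter_upwards [q1, q2] with p h1 h2
    have := h1 p.1 h2
    simp only [Function.uncurry]
    rw [norm_mul, RCLike.norm_conj, ← mul_assoc]
    gcongr


/-! ### Construction of the solution on the Fourier side -/

/-- The Fourier multiplier of the solution operator at time `t`. -/
def solSymbol {d : ℕ} (α : ℝ) (κ : ℂ) (t : ℝ) (ξ : Sp d) : ℂ :=
  mittagLeffler α 1 (κ * ((‖ξ‖ ^ 2 * t ^ α : ℝ) : ℂ))

/-- The time derivative of `solSymbol`. -/
def derivSymbol {d : ℕ} (α : ℝ) (κ : ℂ) (t : ℝ) (ξ : Sp d) : ℂ :=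
  κ * ((‖ξ‖ ^ 2 * t ^ (α - 1) : ℝ) : ℂ) *
    mittagLeffler α α (κ * ((‖ξ‖ ^ 2 * t ^ α : ℝ) : ℂ))

/-- Bounds for the solution symbol and its derivative on the support of `h`, which suffice to
solve the equation with initial state `F* h`. -/
structure SymbolBound {d : ℕ} (α γ C X : ℝ) (κ : ℂ) (h : L2 d) : Prop where
  pos : 0 < α
  le_one : α ≤ 1
  one_le : 1 ≤ γ
  const_nonneg : 0 ≤ C
  rate_nonneg : 0 ≤ X
  memLp : MemLp (fun ξ : Sp d => ((‖ξ‖ ^ (2 * γ) : ℝ) : ℂ) * h ξ) 2 volume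
  sol_le : ∀ᵐ ξ, h ξ ≠ 0 → ∀ t, 0 ≤ t → ‖solSymbol α κ t ξ‖ ≤ C * Real.exp (X * t)
  deriv_le : ∀ᵐ ξ, h ξ ≠ 0 → ∀ t, 0 < t →
    ‖derivSymbol α κ t ξ‖ ≤ C * (t ^ (α - 1) + 1) * Real.exp (X * t) * (1 + ‖ξ‖ ^ (2 * γ))

theorem measurable_solSymbol {d : ℕ} {α : ℝ} (hα : 0 < α) (κ : ℂ) :
    Measurable (Function.uncurry (solSymbol (d := d) α κ)) := by
  refine (continuous_mittagLeffler hα 1).measurable.comp (g := mittagLeffler α 1) ?_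
  fun_prop

theorem measurable_derivSymbol {d : ℕ} {α : ℝ} (hα : 0 < α) (κ : ℂ) :
    Measurable (Function.uncurry (derivSymbol (d := d) α κ)) := by
  refine Measurable.mul (by fun_prop)
    ((continuous_mittagLeffler hα α).measurable.comp (g := mittagLeffler α α) ?_)
  fun_prop

theorem continuous_solSymbol {d : ℕ} {α : ℝ} (hα : 0 < α) (κ : ℂ) (ξ : Sp d) :
    Continuous fun t => solSymbol α κ t ξ := by
  refine (continuous_mittagLeffler hα 1).comp (g := mittagLeffler α 1) ?_
  have : Continuous fun t : ℝ => t ^ α := Real.continuous_rpow_const hα.le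
  fun_prop

theorem continuousOn_derivSymbol {d : ℕ} {α : ℝ} (hα : 0 < α) (κ : ℂ) (ξ : Sp d) :
    ContinuousOn (fun t => derivSymbol α κ t ξ) (Ioi 0) := by
  have h1 : Continuous fun t : ℝ => t ^ α := Real.continuous_rpow_const hα.le
  have h2 : ContinuousOn (fun t : ℝ => t ^ (α - 1)) (Ioi 0) := fun t ht =>
    (Real.continuousAt_rpow_const t (α - 1) (Or.inl (ne_of_gt ht))).continuousWithinAt
  refine ContinuousOn.mul (continuousOn_const.mul (Complex.continuous_ofReal.comp_continuousOn
    (continuousOn_const.mul h2))) (Continuous.continuousOn ?_)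
  refine (continuous_mittagLeffler hα α).comp (g := mittagLeffler α α) ?_
  fun_prop

theorem solSymbol_zero {d : ℕ} {α : ℝ} (hα : 0 < α) (κ : ℂ) (ξ : Sp d) :
    solSymbol α κ 0 ξ = 1 := by
  rw [solSymbol, Real.zero_rpow hα.ne', mul_zero, Complex.ofReal_zero, mul_zero, mittagLeffler_zero]
  simp

/-- The Fourier transform of the solution. -/
def solHat {d : ℕ} (α : ℝ) (κ : ℂ) (h : L2 d) (t : ℝ) : L2 d := mulL2 (solSymbol α κ t) h

/-- The Fourier transform of the time derivative of the solution. -/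
def derivHat {d : ℕ} (α : ℝ) (κ : ℂ) (h : L2 d) (t : ℝ) : L2 d := mulL2 (derivSymbol α κ t) h

/-- The Fourier transform of `H₀` applied to the solution. -/
def lapHat {d : ℕ} (α : ℝ) (κ : ℂ) (h : L2 d) (t : ℝ) : L2 d :=
  mulL2 (fun ξ => ((‖ξ‖ ^ 2 : ℝ) : ℂ) * solSymbol α κ t ξ) h

/-- The weight that controls the time derivative thereby also controls H₀ applied to the solution.
-/
theorem sq_le_one_add_rpow {x γ : ℝ} (hx : 0 ≤ x) (hγ : 1 ≤ γ) : x ^ 2 ≤ 1 + x ^ (2 * γ) := by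
  rcases le_total x 1 with h | h
  · have := Real.rpow_nonneg hx (2 * γ)
    nlinarith
  · rw [← Real.rpow_natCast x 2]
    have := Real.rpow_le_rpow_of_exponent_le h (show ((2 : ℕ) : ℝ) ≤ 2 * γ by push_cast; linarith)
    linarith

namespace SymbolBound

variable {d : ℕ} {α γ C X : ℝ} {κ : ℂ} {h : L2 d} (B : SymbolBound α γ C X κ h)
include B

/-- The function `(1 + |ξ|^(2γ)) h`. -/
theorem exists_weighted : ∃ G : L2 d,
    (∀ᵐ ξ, ‖G ξ‖ = (1 + ‖ξ‖ ^ (2 * γ)) * ‖h ξ‖) ∧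
      ‖G‖ ≤ ‖h‖ + ‖mulL2 (fun ξ : Sp d => ((‖ξ‖ ^ (2 * γ) : ℝ) : ℂ)) h‖ := by
  refine ⟨h + mulL2 (fun ξ : Sp d => ((‖ξ‖ ^ (2 * γ) : ℝ) : ℂ)) h, ?_, norm_add_le _ _⟩
  filter_upwards [Lp.coeFn_add h (mulL2 (fun ξ : Sp d => ((‖ξ‖ ^ (2 * γ) : ℝ) : ℂ)) h),
    mulL2_ae B.memLp] with ξ h1 h2
  rw [h1, Pi.add_apply, h2, ← one_add_mul, norm_mul, ← Complex.ofReal_one, ← Complex.ofReal_add,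
    Complex.norm_real, Real.norm_of_nonneg (by positivity)]

/-- The symbol is bounded only where h does not vanish; elsewhere the product is 0. -/
theorem sol_mul_le : ∀ᵐ ξ, ∀ t, 0 ≤ t → ‖solSymbol α κ t ξ * h ξ‖ ≤ C * Real.exp (X * t) * ‖h ξ‖ := by
  filter_upwards [B.sol_le] with ξ hξ t ht
  by_cases h0 : h ξ = 0
  · simp [h0]
  · rw [norm_mul]
    gcongr
    exact hξ h0 t ht

theorem lap_mul_le {G : L2 d} (hG : ∀ᵐ ξ, ‖G ξ‖ = (1 + ‖ξ‖ ^ (2 * γ)) * ‖h ξ‖) :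
    ∀ᵐ ξ, ∀ t, 0 ≤ t → ‖((‖ξ‖ ^ 2 : ℝ) : ℂ) * solSymbol α κ t ξ * h ξ‖
      ≤ C * Real.exp (X * t) * ‖G ξ‖ := by
  filter_upwards [B.sol_mul_le, hG] with ξ hξ hGξ t ht
  rw [mul_assoc, norm_mul, Complex.norm_real, Real.norm_of_nonneg (by positivity), hGξ]
  have h1 := sq_le_one_add_rpow (norm_nonneg ξ) B.one_le
  have h2 := mul_le_mul h1 (hξ t ht) (norm_nonneg _) (by positivity)
  linarith

theorem deriv_mul_le {G : L2 d} (hG : ∀ᵐ ξ, ‖G ξ‖ = (1 + ‖ξ‖ ^ (2 * γ)) * ‖h ξ‖) :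
    ∀ᵐ ξ, ∀ t, 0 < t → ‖derivSymbol α κ t ξ * h ξ‖
      ≤ C * (t ^ (α - 1) + 1) * Real.exp (X * t) * ‖G ξ‖ := by
  filter_upwards [B.deriv_le, hG] with ξ hξ hGξ t ht
  by_cases h0 : h ξ = 0
  · have := B.const_nonneg
    rw [h0, mul_zero, norm_zero]
    positivity
  · rw [norm_mul, hGξ, ← mul_assoc]
    gcongr
    exact hξ h0 t ht

theorem memLp_sol {t : ℝ} (ht : 0 ≤ t) :
    MemLp (fun ξ => solSymbol α κ t ξ * h ξ) 2 volume := by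
  refine memLp_mul_of_le ((measurable_solSymbol B.pos κ).comp
    measurable_prodMk_left).aestronglyMeasurable (G := h) (K := C * Real.exp (X * t)) ?_
  filter_upwards [B.sol_mul_le] with ξ hξ using hξ t ht

theorem solHat_ae {t : ℝ} (ht : 0 ≤ t) :
    (solHat α κ h t : Sp d → ℂ) =ᵐ[volume] fun ξ => solSymbol α κ t ξ * h ξ :=
  mulL2_ae (B.memLp_sol ht)

theorem memLp_lap {t : ℝ} (ht : 0 ≤ t) :
    MemLp (fun ξ => ((‖ξ‖ ^ 2 : ℝ) : ℂ) * solSymbol α κ t ξ * h ξ) 2 volume := by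
  obtain ⟨G, hG, -⟩ := B.exists_weighted
  refine memLp_mul_of_le (AEStronglyMeasurable.mul (by fun_prop)
    ((measurable_solSymbol B.pos κ).comp measurable_prodMk_left).aestronglyMeasurable)
    (G := G) (K := C * Real.exp (X * t)) ?_
  filter_upwards [B.lap_mul_le hG] with ξ hξ using hξ t ht

theorem lapHat_ae {t : ℝ} (ht : 0 ≤ t) :
    (lapHat α κ h t : Sp d → ℂ) =ᵐ[volume]
      fun ξ => ((‖ξ‖ ^ 2 : ℝ) : ℂ) * solSymbol α κ t ξ * h ξ :=
  mulL2_ae (B.memLp_lap ht)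

theorem derivHat_ae {t : ℝ} (ht : 0 < t) :
    (derivHat α κ h t : Sp d → ℂ) =ᵐ[volume] fun ξ => derivSymbol α κ t ξ * h ξ := by
  obtain ⟨G, hG, -⟩ := B.exists_weighted
  refine mulL2_ae (memLp_mul_of_le ((measurable_derivSymbol B.pos κ).comp
    measurable_prodMk_left).aestronglyMeasurable
    (G := G) (K := C * (t ^ (α - 1) + 1) * Real.exp (X * t)) ?_)
  filter_upwards [B.deriv_mul_le hG] with ξ hξ using hξ t ht

theorem exp_le_exp_add_one {t t₀ : ℝ} (ht : t < t₀ + 1) :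
    C * Real.exp (X * t) ≤ C * Real.exp (X * (t₀ + 1)) := by
  have := B.rate_nonneg
  have := B.const_nonneg
  gcongr

theorem continuousOn_solHat : ContinuousOn (solHat α κ h) (Ici 0) := by
  intro t₀ ht₀
  refine continuousWithinAt_L2 ht₀ (m := solSymbol α κ) (h := h) (G := h)
    (K := C * Real.exp (X * (t₀ + 1))) (fun t ht => B.solHat_ae ht)
    (fun ξ => (continuous_solSymbol B.pos κ ξ).continuousWithinAt) ?_
  filter_upwards [self_mem_nhdsWithin, nhdsWithin_le_nhds (Iio_mem_nhds (lt_add_one t₀))]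
    with t ht ht1
  filter_upwards [B.sol_mul_le] with ξ hξ
  exact (hξ t ht).trans (mul_le_mul_of_nonneg_right (B.exp_le_exp_add_one ht1) (norm_nonneg _))

theorem continuousOn_lapHat : ContinuousOn (lapHat α κ h) (Ici 0) := by
  obtain ⟨G, hG, -⟩ := B.exists_weighted
  intro t₀ ht₀
  refine continuousWithinAt_L2 ht₀ (m := fun t ξ => ((‖ξ‖ ^ 2 : ℝ) : ℂ) * solSymbol α κ t ξ)
    (h := h) (G := G) (K := C * Real.exp (X * (t₀ + 1))) (fun t ht => B.lapHat_ae ht)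
    (fun ξ => (continuous_const.mul (continuous_solSymbol B.pos κ ξ)).continuousWithinAt) ?_
  filter_upwards [self_mem_nhdsWithin, nhdsWithin_le_nhds (Iio_mem_nhds (lt_add_one t₀))]
    with t ht ht1
  filter_upwards [B.lap_mul_le hG] with ξ hξ
  exact (hξ t ht).trans (mul_le_mul_of_nonneg_right (B.exp_le_exp_add_one ht1) (norm_nonneg _))

/-- The factor t^{α-1} is singular only at 0, so domination is available for t > t₀/2. -/
theorem continuousOn_derivHat : ContinuousOn (derivHat α κ h) (Ioi 0) := by
  obtain ⟨G, hG, -⟩ := B.exists_weighted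
  intro t₀ ht₀
  have ht₀' : (0 : ℝ) < t₀ := ht₀
  have hC := B.const_nonneg
  have hX := B.rate_nonneg
  refine continuousWithinAt_L2 ht₀ (m := derivSymbol α κ)
    (h := h) (G := G) (K := C * ((t₀ / 2) ^ (α - 1) + 1) * Real.exp (X * (t₀ + 1)))
    (fun t ht => B.derivHat_ae ht)
    (fun ξ => continuousOn_derivSymbol B.pos κ ξ t₀ ht₀) ?_
  filter_upwards [self_mem_nhdsWithin, nhdsWithin_le_nhds (Iio_mem_nhds (lt_add_one t₀)),
    nhdsWithin_le_nhds (Ioi_mem_nhds (show t₀ / 2 < t₀ by linarith))] with t ht ht1 ht2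
  have h1 : t ^ (α - 1) ≤ (t₀ / 2) ^ (α - 1) :=
    Real.rpow_le_rpow_of_nonpos (by positivity) (le_of_lt ht2) (by linarith [B.le_one])
  have h2 : Real.exp (X * t) ≤ Real.exp (X * (t₀ + 1)) := by
    have : t < t₀ + 1 := ht1
    gcongr
  filter_upwards [B.deriv_mul_le hG] with ξ hξ
  refine (hξ t ht).trans ?_
  have ht0 : (0 : ℝ) < t := ht
  gcongr

theorem norm_solHat_le {t : ℝ} (ht : 0 ≤ t) : ‖solHat α κ h t‖ ≤ C * Real.exp (X * t) * ‖h‖ := by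
  refine norm_le_of_ae_mul (B.solHat_ae ht) ?_
  filter_upwards [B.sol_mul_le] with ξ hξ using hξ t ht

theorem norm_lapHat_le {G : L2 d} (hG : ∀ᵐ ξ, ‖G ξ‖ = (1 + ‖ξ‖ ^ (2 * γ)) * ‖h ξ‖) {t : ℝ}
    (ht : 0 ≤ t) : ‖lapHat α κ h t‖ ≤ C * Real.exp (X * t) * ‖G‖ := by
  refine norm_le_of_ae_mul (B.lapHat_ae ht) ?_
  filter_upwards [B.lap_mul_le hG] with ξ hξ using hξ t ht

theorem norm_derivHat_le {G : L2 d} (hG : ∀ᵐ ξ, ‖G ξ‖ = (1 + ‖ξ‖ ^ (2 * γ)) * ‖h ξ‖) {t : ℝ}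
    (ht : 0 < t) :
    ‖derivHat α κ h t‖ ≤ C * (t ^ (α - 1) + 1) * Real.exp (X * t) * ‖G‖ := by
  refine norm_le_of_ae_mul (B.derivHat_ae ht) ?_
  filter_upwards [B.deriv_mul_le hG] with ξ hξ using hξ t ht

theorem solHat_zero : solHat α κ h 0 = h := by
  apply Lp.ext
  filter_upwards [B.solHat_ae le_rfl] with ξ hξ
  rw [hξ, solSymbol_zero B.pos, one_mul]

/-- A sum of two Beta integrands, with p = α and p = 1. -/
theorem integrable_weight {c t : ℝ} (hc : 0 < c) (ht : 0 < t) (M : ℝ) :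
    IntegrableOn (fun s => (t - s) ^ (c - 1) * (C * (s ^ (α - 1) + 1) * M)) (Ioc 0 t) := by
  have h1 := (intervalIntegrable_iff_integrableOn_Ioc_of_le ht.le).1
    (intervalIntegrable_rpow_mul_rpow B.pos hc ht)
  have h2 := (intervalIntegrable_iff_integrableOn_Ioc_of_le ht.le).1
    (intervalIntegrable_rpow_mul_rpow one_pos hc ht)
  refine IntegrableOn.congr_fun (Integrable.const_mul (Integrable.add h1 h2) (C * M)) (fun s _ => ?_)
    measurableSet_Ioc
  simp only [Pi.add_apply, sub_self, Real.rpow_zero, mul_one]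
  ring

theorem integrableOn_smul_derivHat {c t : ℝ} (hc : 0 < c) (ht : 0 < t) :
    IntegrableOn (fun s => (t - s) ^ (c - 1) • derivHat α κ h s) (Ioc 0 t) := by
  obtain ⟨G, hG, -⟩ := B.exists_weighted
  have hC := B.const_nonneg
  have hX := B.rate_nonneg
  refine ((B.integrable_weight hc ht (Real.exp (X * t))).mul_const ‖G‖).mono' ?_ ?_
  · refine AEStronglyMeasurable.smul
      (Measurable.aestronglyMeasurable (f := fun s : ℝ => (t - s) ^ (c - 1)) (by fun_prop)) ?_
    exact (B.continuousOn_derivHat.mono Ioc_subset_Ioi_self).aestronglyMeasurable measurableSet_Ioc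
  · refine (ae_restrict_iff' measurableSet_Ioc).2 (Eventually.of_forall fun s hs => ?_)
    have h0 : 0 ≤ t - s := by linarith [hs.2]
    rw [norm_smul, Real.norm_of_nonneg (Real.rpow_nonneg h0 _), mul_assoc ((t - s) ^ (c - 1))]
    have := B.norm_derivHat_le hG hs.1
    have h1 : Real.exp (X * s) ≤ Real.exp (X * t) := by
      have := hs.2
      gcongr
    have h2 : 0 ≤ s ^ (α - 1) := Real.rpow_nonneg hs.1.le _
    refine mul_le_mul_of_nonneg_left (this.trans ?_) (Real.rpow_nonneg h0 _)
    gcongr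

/-- Two values of c are used: c = 1 yields the increment of the solution, c = 1 - α its Caputo
derivative. -/
theorem integral_smul_derivHat_ae {c t : ℝ} (hc : 0 < c) (ht : 0 < t) :
    ((∫ s in (0 : ℝ)..t, (t - s) ^ (c - 1) • derivHat α κ h s : L2 d) : Sp d → ℂ) =ᵐ[volume]
      fun ξ => κ * ((‖ξ‖ ^ 2 : ℝ) : ℂ) * (((Real.Gamma c * t ^ (α + c - 1) : ℝ) : ℂ) *
        mittagLeffler α (α + c) (κ * ((‖ξ‖ ^ 2 * t ^ α : ℝ) : ℂ))) * h ξ := by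
  obtain ⟨G, hG, -⟩ := B.exists_weighted
  have hC := B.const_nonneg
  have hX := B.rate_nonneg
  have hα := B.pos
  rw [intervalIntegral.integral_of_le ht.le]
  have key := integral_L2_ae (S := Ioc 0 t) measurableSet_Ioc (m := fun s ξ =>
      (((t - s) ^ (c - 1) : ℝ) : ℂ) * derivSymbol α κ s ξ) (h := h) (G := G)
      (B.integrableOn_smul_derivHat hc ht) (B.integrable_weight hc ht (Real.exp (X * t))) ?_ ?_ ?_
  · filter_upwards [key] with ξ hξ
    rw [hξ]
    congr 1
    rw [← intervalIntegral.integral_of_le ht.le]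
    have h1 := integral_rpow_mul_mittagLeffler hα hc ht (κ * ((‖ξ‖ ^ 2 : ℝ) : ℂ))
    have h2 : κ * ((‖ξ‖ ^ 2 * t ^ α : ℝ) : ℂ) = κ * ((‖ξ‖ ^ 2 : ℝ) : ℂ) * ((t ^ α : ℝ) : ℂ) := by
      push_cast; ring
    rw [h2, ← h1, ← intervalIntegral.integral_const_mul]
    congr 1
    funext s
    rw [derivSymbol]
    have h3 : κ * ((‖ξ‖ ^ 2 * s ^ α : ℝ) : ℂ) = κ * ((‖ξ‖ ^ 2 : ℝ) : ℂ) * ((s ^ α : ℝ) : ℂ) := by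
      push_cast; ring
    rw [h3]
    push_cast
    ring
  · exact Measurable.mul (by fun_prop) (measurable_derivSymbol hα κ)
  · intro s hs
    filter_upwards [Lp.coeFn_smul ((t - s) ^ (c - 1)) (derivHat α κ h s), B.derivHat_ae hs.1]
      with ξ h1 h2
    rw [h1, Pi.smul_apply, h2, Complex.real_smul, mul_assoc]
  · filter_upwards [B.deriv_mul_le hG] with ξ hξ s hs
    have h0 : 0 ≤ t - s := by linarith [hs.2]
    have h1 : Real.exp (X * s) ≤ Real.exp (X * t) := by
      have := hs.2
      gcongr
    have h2 : 0 ≤ s ^ (α - 1) := Real.rpow_nonneg hs.1.le _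
    rw [mul_assoc, norm_mul, Complex.norm_real, Real.norm_of_nonneg (Real.rpow_nonneg h0 _),
      mul_assoc ((t - s) ^ (c - 1))]
    refine mul_le_mul_of_nonneg_left ((hξ s hs.1).trans ?_) (Real.rpow_nonneg h0 _)
    gcongr

/-- The case c = 1, where κ|ξ|² t^α E_{α,α+1} = E_{α,1} - 1. -/
theorem integral_derivHat {t : ℝ} (ht : 0 < t) :
    ∫ s in (0 : ℝ)..t, derivHat α κ h s = solHat α κ h t - h := by
  have h1 := B.integral_smul_derivHat_ae one_pos ht
  simp only [sub_self, Real.rpow_zero, one_smul] at h1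
  apply Lp.ext
  filter_upwards [h1, Lp.coeFn_sub (solHat α κ h t) h, B.solHat_ae ht.le] with ξ h1 h2 h3
  rw [h1, h2, Pi.sub_apply, h3, solSymbol, mittagLeffler_succ B.pos 1, Real.Gamma_one,
    add_sub_cancel_right]
  push_cast
  ring

/-- The case c = 1 - α: the power of t has exponent 0 and E_{α,1} reappears. -/
theorem integral_caputo_derivHat (hα1 : α < 1) {t : ℝ} (ht : 0 < t) :
    ∫ s in (0 : ℝ)..t, (t - s) ^ (-α) • derivHat α κ h s
      = Real.Gamma (1 - α) • κ • lapHat α κ h t := by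
  have h1 := B.integral_smul_derivHat_ae (c := 1 - α) (by linarith) ht
  simp only [sub_sub_cancel_left, add_sub_cancel, sub_self, Real.rpow_zero, mul_one] at h1
  apply Lp.ext
  filter_upwards [h1, Lp.coeFn_smul (Real.Gamma (1 - α)) (κ • lapHat α κ h t),
    Lp.coeFn_smul κ (lapHat α κ h t), B.lapHat_ae ht.le] with ξ h1 h2 h3 h4
  rw [h1, h2, Pi.smul_apply, h3, Pi.smul_apply, h4, solSymbol, Complex.real_smul, smul_eq_mul]
  ring

theorem derivHat_of_one (hα1 : α = 1) {t : ℝ} (ht : 0 < t) :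
    derivHat α κ h t = κ • lapHat α κ h t := by
  apply Lp.ext
  filter_upwards [B.derivHat_ae ht, Lp.coeFn_smul κ (lapHat α κ h t), B.lapHat_ae ht.le]
    with ξ h1 h2 h3
  rw [h1, h2, Pi.smul_apply, h3, solSymbol, derivSymbol, hα1, sub_self, Real.rpow_zero, mul_one,
    smul_eq_mul]
  ring

end SymbolBound


/-! ### Existence of the solution -/

theorem measurableSet_timeInterval (T : EReal) : MeasurableSet (timeInterval T) :=
  (measurableSet_lt measurable_const measurable_id).inter
    (measurableSet_lt measurable_coe_real_ereal measurable_const)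

theorem isOpen_timeInterval (T : EReal) : IsOpen (timeInterval T) :=
  (isOpen_lt continuous_const continuous_id).inter
    (isOpen_lt continuous_coe_real_ereal continuous_const)

theorem timeInterval_subset (T : EReal) : timeInterval T ⊆ Ioi 0 := fun _ ht => ht.1

theorem continuous_smul_of_tsupport_subset {E : Type*} [NormedAddCommGroup E] [NormedSpace ℝ E]
    {J : Set ℝ} (hJ : IsOpen J) {φ : ℝ → ℝ} (hφ : Continuous φ) (hs : tsupport φ ⊆ J)
    {u : ℝ → E} (hu : ContinuousOn u J) : Continuous fun t => φ t • u t := by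
  refine continuous_iff_continuousAt.2 fun t => ?_
  by_cases ht : t ∈ J
  · exact hφ.continuousAt.smul (hu.continuousAt (hJ.mem_nhds ht))
  · have h0 : (fun t => φ t • u t) =ᶠ[𝓝 t] fun _ => 0 := by
      filter_upwards [notMem_tsupport_iff_eventuallyEq.1 fun h => ht (hs h)] with s hs
      simp [hs]
    exact continuousAt_const.congr h0.symm

theorem tsupport_deriv_subset_tsupport (φ : ℝ → ℝ) : tsupport (deriv φ) ⊆ tsupport φ :=
  closure_minimal support_deriv_subset (isClosed_tsupport φ)

/-- A classical derivative that is continuous is a weak derivative. -/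
theorem hasWeakDeriv_of_hasDerivAt {d : ℕ} {J : Set ℝ} (hJ : IsOpen J) {u g : ℝ → L2 d}
    (hg : ContinuousOn g J) (hd : ∀ t ∈ J, HasDerivAt u (g t) t) : HasWeakDeriv J u g := by
  have hu : ContinuousOn u J := fun t ht => (hd t ht).continuousAt.continuousWithinAt
  refine ⟨hu.locallyIntegrableOn hJ.measurableSet, hg.locallyIntegrableOn hJ.measurableSet,
    fun φ hφ hc hs => ?_⟩
  have hφ' : Continuous (deriv φ) := hφ.continuous_deriv (by simp)
  have hs' : tsupport (deriv φ) ⊆ J := (tsupport_deriv_subset_tsupport φ).trans hs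
  have i1 : Integrable fun t => deriv φ t • u t :=
    (continuous_smul_of_tsupport_subset hJ hφ' hs' hu).integrable_of_hasCompactSupport
      hc.deriv.smul_right
  have i2 : Integrable fun t => φ t • g t :=
    (continuous_smul_of_tsupport_subset hJ hφ.continuous hs hg).integrable_of_hasCompactSupport
      hc.smul_right
  have i3 : Integrable fun t => φ t • u t :=
    (continuous_smul_of_tsupport_subset hJ hφ.continuous hs hu).integrable_of_hasCompactSupport
      hc.smul_right
  have hzero : ∀ (ψ : ℝ → ℝ) (w : ℝ → L2 d), tsupport ψ ⊆ J →
      ∫ t in J, ψ t • w t = ∫ t, ψ t • w t := fun ψ w hψ => by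
    refine setIntegral_eq_integral_of_forall_compl_eq_zero fun t ht => ?_
    rw [image_eq_zero_of_notMem_tsupport fun h => ht (hψ h), zero_smul]
  rw [hzero _ _ hs', hzero _ _ hs, eq_neg_iff_add_eq_zero, ← integral_add i1 i2]
  -- φu vanishes near every point outside J, so it is differentiable on the whole line and its
  -- derivative has integral 0.
  refine integral_eq_zero_of_hasDerivAt_of_integrable (f := fun t => φ t • u t) (fun t => ?_)
    (i1.add i2) i3
  by_cases ht : t ∈ J
  · have h1 : HasDerivAt φ (deriv φ t) t := (hφ.differentiable (by simp) t).hasDerivAt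
    have := h1.smul (hd t ht)
    rwa [add_comm] at this
  · have hts : t ∉ tsupport φ := fun h => ht (hs h)
    have h0 : (fun t => φ t • u t) =ᶠ[𝓝 t] fun _ => 0 := by
      filter_upwards [notMem_tsupport_iff_eventuallyEq.1 hts] with s hs
      simp [hs]
    rw [image_eq_zero_of_notMem_tsupport hts,
      image_eq_zero_of_notMem_tsupport fun h => hts (tsupport_deriv_subset_tsupport φ h),
      zero_smul, zero_smul, add_zero]
    exact (hasDerivAt_const t (0 : L2 d)).congr_of_eventuallyEq h0

/-- The solution with initial state `F* h`. -/
def sol {d : ℕ} (α : ℝ) (κ : ℂ) (h : L2 d) (t : ℝ) : L2 d :=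
  (fourierL2 d).symm (solHat α κ h t)

/-- The time derivative of the solution with initial state `F* h`. -/
def solDeriv {d : ℕ} (α : ℝ) (κ : ℂ) (h : L2 d) (t : ℝ) : L2 d :=
  (fourierL2 d).symm (derivHat α κ h t)

theorem fourierL2_symm_real_smul {d : ℕ} (r : ℝ) (f : L2 d) :
    (fourierL2 d).symm (r • f) = r • (fourierL2 d).symm f :=
  ((fourierL2 d).symm.toContinuousLinearEquiv.toContinuousLinearMap.restrictScalars ℝ).map_smul r f

namespace SymbolBound

variable {d : ℕ} {α γ C X : ℝ} {κ : ℂ} {h : L2 d} (B : SymbolBound α γ C X κ h)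
include B

theorem sol_mem_domH0 {t : ℝ} (ht : 0 ≤ t) : sol α κ h t ∈ domH0 d := by
  rw [mem_domH0_iff, sol, LinearIsometryEquiv.apply_symm_apply]
  refine (memLp_congr_ae ?_).1 (Lp.memLp (lapHat α κ h t))
  filter_upwards [B.lapHat_ae ht, B.solHat_ae ht] with ξ h1 h2
  rw [h1, h2, mul_assoc]

theorem H0_sol {t : ℝ} (ht : 0 ≤ t) :
    H0 (sol α κ h t) = (fourierL2 d).symm (lapHat α κ h t) := by
  rw [LinearIsometryEquiv.eq_symm_apply]
  apply Lp.ext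
  have h0 := fourierL2_H0 (B.sol_mem_domH0 ht)
  rw [sol, LinearIsometryEquiv.apply_symm_apply] at h0
  filter_upwards [h0, B.lapHat_ae ht, B.solHat_ae ht] with ξ h1 h2 h3
  rw [sol, h1, h2, h3, mul_assoc]

theorem continuousOn_sol : ContinuousOn (sol α κ h) (Ici 0) :=
  (fourierL2 d).symm.continuous.comp_continuousOn B.continuousOn_solHat

theorem continuousOn_H0_sol : ContinuousOn (fun t => H0 (sol α κ h t)) (Ici 0) :=
  ((fourierL2 d).symm.continuous.comp_continuousOn B.continuousOn_lapHat).congr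
    fun _ ht => B.H0_sol ht

theorem continuousOn_solDeriv : ContinuousOn (solDeriv α κ h) (Ioi 0) :=
  (fourierL2 d).symm.continuous.comp_continuousOn B.continuousOn_derivHat

theorem integrableOn_derivHat {t : ℝ} (ht : 0 < t) : IntegrableOn (derivHat α κ h) (Ioc 0 t) := by
  simpa using B.integrableOn_smul_derivHat one_pos ht

/-- The fundamental theorem of calculus, applied to `integral_derivHat`, replaces termwise
differentiation of the series. -/
theorem hasDerivAt_sol {t : ℝ} (ht : 0 < t) : HasDerivAt (sol α κ h) (solDeriv α κ h t) t := by
  have h1 : HasDerivAt (fun s => h + ∫ r in (0 : ℝ)..s, derivHat α κ h r) (derivHat α κ h t) t := by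
    refine HasDerivAt.const_add h (intervalIntegral.integral_hasDerivAt_right
      ((intervalIntegrable_iff_integrableOn_Ioc_of_le ht.le).2 (B.integrableOn_derivHat ht)) ?_ ?_)
    · exact B.continuousOn_derivHat.stronglyMeasurableAtFilter isOpen_Ioi t ht
    · exact B.continuousOn_derivHat.continuousAt (Ioi_mem_nhds ht)
  have h2 : HasDerivAt (solHat α κ h) (derivHat α κ h t) t := by
    refine h1.congr_of_eventuallyEq ?_
    filter_upwards [Ioi_mem_nhds ht] with s hs
    rw [B.integral_derivHat hs, add_sub_cancel]
  exact ((fourierL2 d).symm.toContinuousLinearEquiv.toContinuousLinearMap.restrictScalars ℝ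
    ).hasFDerivAt.comp_hasDerivAt t h2

theorem hasWeakDeriv_sol {J : Set ℝ} (hJ : IsOpen J) (hJ0 : J ⊆ Ioi 0) :
    HasWeakDeriv J (sol α κ h) (solDeriv α κ h) :=
  hasWeakDeriv_of_hasDerivAt hJ (B.continuousOn_solDeriv.mono hJ0)
    fun _ ht => B.hasDerivAt_sol (hJ0 ht)

theorem caputo_sol {t : ℝ} (ht : 0 < t) :
    caputo α (solDeriv α κ h) t = κ • H0 (sol α κ h t) := by
  rw [caputo, B.H0_sol ht.le]
  split_ifs with hα1
  · rw [solDeriv, B.derivHat_of_one hα1 ht, map_smul]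
  · have hα : α < 1 := lt_of_le_of_ne B.le_one hα1
    have h1 := B.integral_caputo_derivHat hα ht
    have h2 : ∫ s in (0 : ℝ)..t, (t - s) ^ (-α) • solDeriv α κ h s
        = (fourierL2 d).symm (∫ s in (0 : ℝ)..t, (t - s) ^ (-α) • derivHat α κ h s) := by
      rw [intervalIntegral.integral_of_le ht.le, intervalIntegral.integral_of_le ht.le]
      rw [← LinearIsometryEquiv.coe_toContinuousLinearEquiv,
        ← ContinuousLinearEquiv.integral_comp_comm]
      refine integral_congr_ae (Eventually.of_forall fun s => ?_)
      simp only [solDeriv, fourierL2_symm_real_smul,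
        LinearIsometryEquiv.coe_toContinuousLinearEquiv]
    have hG : Real.Gamma (1 - α) ≠ 0 := (Real.Gamma_pos_of_pos (by linarith)).ne'
    rw [h2, h1, fourierL2_symm_real_smul, map_smul, smul_smul, inv_mul_cancel₀ hG, one_smul]

theorem hasCaputoDeriv_sol (T : EReal) :
    HasCaputoDeriv α T (sol α κ h) (fun t => κ • H0 (sol α κ h t)) := by
  refine ⟨solDeriv α κ h, B.hasWeakDeriv_sol (isOpen_timeInterval T) (timeInterval_subset T), ?_⟩
  refine (ae_restrict_iff' (measurableSet_timeInterval T)).2 (Eventually.of_forall fun t ht => ?_)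
  refine ⟨fun hα1 => ?_, (B.caputo_sol ht.1).symm⟩
  rw [intervalIntegrable_iff_integrableOn_Ioc_of_le ht.1.le]
  have h1 := B.integrableOn_smul_derivHat (c := 1 - α) (by linarith) ht.1
  have h2 := ((fourierL2 d).symm.toContinuousLinearEquiv.toContinuousLinearMap).integrable_comp h1
  refine h2.congr (Eventually.of_forall fun s => ?_)
  simp [solDeriv]

theorem isSolution_sol {β : ℝ} (hκ : Complex.I ^ (β : ℂ) * κ = 1) (T : EReal) :
    IsSolution α β ((fourierL2 d).symm h) T (sol α κ h) where
  continuousOn := B.continuousOn_sol.mono fun _ ht => ht.1.le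
  mem_dom := (ae_restrict_iff' (measurableSet_timeInterval T)).2
    (Eventually.of_forall fun _ ht => B.sol_mem_domH0 ht.1.le)
  locallyIntegrable_H0 := (B.continuousOn_H0_sol.mono fun _ ht => ht.1.le).locallyIntegrableOn
    (measurableSet_timeInterval T)
  equation := by
    refine ⟨_, B.hasCaputoDeriv_sol T, Eventually.of_forall fun t => ?_⟩
    rw [smul_smul, neg_mul, hκ, neg_smul, one_smul, neg_add_cancel]
  initial := by
    have h1 := (B.continuousOn_sol 0 self_mem_Ici).tendsto
    have h2 : sol α κ h 0 = (fourierL2 d).symm h := by rw [sol, B.solHat_zero]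
    rw [h2] at h1
    exact h1.mono_left (nhdsWithin_mono _ Ioi_subset_Ici_self)

theorem memCDom_sol (T : ℝ) : MemCDom T (sol α κ h) :=
  ⟨fun _ ht => B.sol_mem_domH0 ht.1, B.continuousOn_sol.mono fun _ ht => ht.1,
    B.continuousOn_H0_sol.mono fun _ ht => ht.1⟩

theorem memW11_sol {T : ℝ} (hT : 0 < T) : MemW11 T (sol α κ h) := by
  refine ⟨?_, solDeriv α κ h, B.hasWeakDeriv_sol isOpen_Ioo fun _ ht => ht.1, ?_⟩
  · exact ((B.continuousOn_sol.mono fun _ ht => ht.1).integrableOn_Icc (a := 0) (b := T)).mono_set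
      Ioo_subset_Icc_self
  · have h2 := ((fourierL2 d).symm.toContinuousLinearEquiv.toContinuousLinearMap).integrable_comp
      ((B.integrableOn_derivHat hT).mono_set Ioo_subset_Ioc_self)
    exact h2

theorem eNormCDom_sol_le {G : L2 d} (hG : ∀ᵐ ξ, ‖G ξ‖ = (1 + ‖ξ‖ ^ (2 * γ)) * ‖h ξ‖) (T : ℝ) :
    eNormCDom T (sol α κ h) ≤ ENNReal.ofReal (C * Real.exp (X * T) * (‖h‖ + ‖G‖)) := by
  have hC := B.const_nonneg
  have hX := B.rate_nonneg
  refine iSup₂_le fun t ht => ENNReal.ofReal_le_ofReal ?_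
  have h1 : Real.exp (X * t) ≤ Real.exp (X * T) := by
    have := ht.2
    gcongr
  have h2 : ‖sol α κ h t‖ ≤ C * Real.exp (X * T) * ‖h‖ := by
    rw [sol, LinearIsometryEquiv.norm_map]
    refine (B.norm_solHat_le ht.1).trans ?_
    gcongr
  have h3 : ‖H0 (sol α κ h t)‖ ≤ C * Real.exp (X * T) * ‖G‖ := by
    rw [B.H0_sol ht.1, LinearIsometryEquiv.norm_map]
    refine (B.norm_lapHat_le hG ht.1).trans ?_
    gcongr
  rw [normH0]
  refine (Real.sqrt_le_left (by positivity)).2 ?_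
  rw [mul_add]
  have := norm_nonneg (sol α κ h t)
  have := norm_nonneg (H0 (sol α κ h t))
  nlinarith [mul_self_nonneg ‖h‖]

theorem lintegral_sol_le (T : ℝ) :
    ∫⁻ t in Ioo 0 T, ‖sol α κ h t‖ₑ ≤ ENNReal.ofReal (C * Real.exp (X * T) * ‖h‖ * T) := by
  have hC := B.const_nonneg
  have hX := B.rate_nonneg
  have h1 : ∫⁻ t in Ioo 0 T, ‖sol α κ h t‖ₑ
      ≤ ∫⁻ _ in Ioo 0 T, ENNReal.ofReal (C * Real.exp (X * T) * ‖h‖) := by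
    refine setLIntegral_mono measurable_const fun t ht => ?_
    rw [← ofReal_norm]
    refine ENNReal.ofReal_le_ofReal ?_
    rw [sol, LinearIsometryEquiv.norm_map]
    refine (B.norm_solHat_le ht.1.le).trans ?_
    have := ht.2.le
    gcongr
  refine h1.trans_eq ?_
  rw [setLIntegral_const, Real.volume_Ioo, sub_zero, ← ENNReal.ofReal_mul (by positivity)]

theorem lintegral_solDeriv_le {G : L2 d} (hG : ∀ᵐ ξ, ‖G ξ‖ = (1 + ‖ξ‖ ^ (2 * γ)) * ‖h ξ‖) {T : ℝ}
    (hT : 0 < T) : ∫⁻ t in Ioo 0 T, ‖solDeriv α κ h t‖ₑ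
      ≤ ENNReal.ofReal (C * Real.exp (X * T) * ‖G‖ * (T ^ α / α + T)) := by
  have hC := B.const_nonneg
  have hX := B.rate_nonneg
  have hα := B.pos
  have hi : IntervalIntegrable (fun t : ℝ => t ^ (α - 1)) volume 0 T :=
    intervalIntegral.intervalIntegrable_rpow' (by linarith)
  have hi2 : IntegrableOn (fun t : ℝ => C * Real.exp (X * T) * ‖G‖ * (t ^ (α - 1) + 1)) (Ioo 0 T) := by
    have := (hi.add (intervalIntegrable_const (c := (1 : ℝ)))).const_mul (C * Real.exp (X * T) * ‖G‖)
    exact ((intervalIntegrable_iff_integrableOn_Ioc_of_le hT.le).1 this).mono_set Ioo_subset_Ioc_self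
  have h1 : ∫⁻ t in Ioo 0 T, ‖solDeriv α κ h t‖ₑ
      ≤ ∫⁻ t in Ioo 0 T, ENNReal.ofReal (C * Real.exp (X * T) * ‖G‖ * (t ^ (α - 1) + 1)) := by
    refine setLIntegral_mono (by fun_prop) fun t ht => ?_
    rw [← ofReal_norm]
    refine ENNReal.ofReal_le_ofReal ?_
    rw [solDeriv, LinearIsometryEquiv.norm_map]
    refine (B.norm_derivHat_le hG ht.1).trans ?_
    have h0 := ht.2.le
    have h2 : 0 ≤ t ^ (α - 1) := Real.rpow_nonneg ht.1.le _
    have h3 : Real.exp (X * t) ≤ Real.exp (X * T) := by gcongr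
    calc C * (t ^ (α - 1) + 1) * Real.exp (X * t) * ‖G‖
        ≤ C * (t ^ (α - 1) + 1) * Real.exp (X * T) * ‖G‖ := by gcongr
      _ = _ := by ring
  refine h1.trans_eq ?_
  rw [← ofReal_integral_eq_lintegral_ofReal hi2]
  · congr 1
    rw [← integral_Ioc_eq_integral_Ioo, ← intervalIntegral.integral_of_le hT.le,
      intervalIntegral.integral_const_mul, intervalIntegral.integral_add hi intervalIntegrable_const,
      integral_rpow (Or.inl (by linarith)), intervalIntegral.integral_const]
    simp [Real.zero_rpow hα.ne']
  · refine (ae_restrict_iff' measurableSet_Ioo).2 (Eventually.of_forall fun t ht => ?_)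
    have h2 : 0 ≤ t ^ (α - 1) := Real.rpow_nonneg ht.1.le _
    simp only [Pi.zero_apply]
    positivity

/-- The infimum over weak derivatives is tested with `solDeriv`. In the constant, 1/α comes from ∫₀ᵀ
t^{α-1} dt = T^α/α with T^α ≤ 1 + T, and the weighted function G has norm at most twice the graph
norm. -/
theorem eNorm_sol_le {T : ℝ} (hT : 0 < T) :
    eNormCDom T (sol α κ h) + eNormW11 T (sol α κ h) ≤
      ENNReal.ofReal (C * (6 + 2 / α) * (1 + T) * Real.exp (X * T) *
        Real.sqrt (‖h‖ ^ 2 + ‖mulL2 (fun ξ : Sp d => ((‖ξ‖ ^ (2 * γ) : ℝ) : ℂ)) h‖ ^ 2)) := by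
  obtain ⟨G, hG, hGn⟩ := B.exists_weighted
  have hC := B.const_nonneg
  have hα := B.pos
  set N := Real.sqrt (‖h‖ ^ 2 + ‖mulL2 (fun ξ : Sp d => ((‖ξ‖ ^ (2 * γ) : ℝ) : ℂ)) h‖ ^ 2) with hN
  have hN1 : ‖h‖ ≤ N := Real.le_sqrt_of_sq_le (by nlinarith [norm_nonneg h])
  have hN2 : ‖mulL2 (fun ξ : Sp d => ((‖ξ‖ ^ (2 * γ) : ℝ) : ℂ)) h‖ ≤ N :=
    Real.le_sqrt_of_sq_le (by nlinarith [norm_nonneg h])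
  have hN0 : 0 ≤ N := Real.sqrt_nonneg _
  have hW : eNormW11 T (sol α κ h) ≤ ENNReal.ofReal (C * Real.exp (X * T) * ‖h‖ * T) +
      ENNReal.ofReal (C * Real.exp (X * T) * ‖G‖ * (T ^ α / α + T)) := by
    refine add_le_add (B.lintegral_sol_le T) ?_
    exact (iInf₂_le (solDeriv α κ h) (B.hasWeakDeriv_sol isOpen_Ioo fun _ ht => ht.1)).trans
      (B.lintegral_solDeriv_le hG hT)
  refine (add_le_add (B.eNormCDom_sol_le hG T) hW).trans ?_
  have hTα : T ^ α ≤ 1 + T := by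
    rcases le_total T 1 with h1 | h1
    · have := Real.rpow_le_one hT.le h1 hα.le
      linarith
    · have := Real.rpow_le_rpow_of_exponent_le h1 B.le_one
      rw [Real.rpow_one] at this
      linarith
  rw [← ENNReal.ofReal_add (by positivity) (by positivity),
    ← ENNReal.ofReal_add (by positivity) (by positivity)]
  refine ENNReal.ofReal_le_ofReal ?_
  have hGN : ‖G‖ ≤ 2 * N := by linarith
  calc C * Real.exp (X * T) * (‖h‖ + ‖G‖) + (C * Real.exp (X * T) * ‖h‖ * T +
        C * Real.exp (X * T) * ‖G‖ * (T ^ α / α + T))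
      ≤ C * Real.exp (X * T) * (N + 2 * N) + (C * Real.exp (X * T) * N * T +
        C * Real.exp (X * T) * (2 * N) * ((1 + T) / α + T)) := by gcongr
    _ = C * Real.exp (X * T) * N * (3 + T + 2 * ((1 + T) / α + T)) := by ring
    _ ≤ C * Real.exp (X * T) * N * ((6 + 2 / α) * (1 + T)) := by
        refine mul_le_mul_of_nonneg_left ?_ (by positivity)
        have : (6 + 2 / α) * (1 + T) = 6 * (1 + T) + 2 * ((1 + T) / α) := by ring
        rw [this]
        linarith
    _ = _ := by ring

end SymbolBound


/-! ### Weak derivatives and increments -/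

theorem deriv_smoothTransition_of_one_lt {x : ℝ} (hx : 1 < x) :
    deriv Real.smoothTransition x = 0 := by
  have : Real.smoothTransition =ᶠ[𝓝 x] fun _ => 1 := by
    filter_upwards [Ioi_mem_nhds hx] with y hy
    exact Real.smoothTransition.one_of_one_le (le_of_lt hy)
  rw [this.deriv_eq]; simp

theorem deriv_smoothTransition_nonneg (x : ℝ) : 0 ≤ deriv Real.smoothTransition x :=
  Real.smoothTransition.monotone.deriv_nonneg

theorem hasDerivAt_smoothTransition (x : ℝ) :
    HasDerivAt Real.smoothTransition (deriv Real.smoothTransition x) x :=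
  ((Real.smoothTransition.contDiff (n := 1)).differentiable (by simp) x).hasDerivAt

theorem continuous_deriv_smoothTransition : Continuous (deriv Real.smoothTransition) :=
  (Real.smoothTransition.contDiff (n := 1)).continuous_deriv (by simp)

/-- An average against a probability density stays within δ of c if u does so wherever the density
is nonzero. -/
theorem norm_integral_smul_sub_le {E : Type*} [NormedAddCommGroup E] [NormedSpace ℝ E]
    [CompleteSpace E] {s t δ : ℝ} (hst : s ≤ t) {ψ : ℝ → ℝ} (hψ : Continuous ψ) (hψ0 : ∀ x, 0 ≤ ψ x)
    (hψ1 : ∫ x in s..t, ψ x = 1) {u : ℝ → E} (hu : ContinuousOn u (Icc s t)) {c : E}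
    (hc : ∀ x ∈ Icc s t, ψ x ≠ 0 → ‖u x - c‖ ≤ δ) :
    ‖(∫ x in s..t, ψ x • u x) - c‖ ≤ δ := by
  have hu' : ContinuousOn u (uIcc s t) := by rwa [uIcc_of_le hst]
  have h1 : (∫ x in s..t, ψ x • u x) - c = ∫ x in s..t, ψ x • (u x - c) := by
    simp_rw [smul_sub]
    have i1 : IntervalIntegrable (fun x => ψ x • u x) volume s t :=
      (hψ.continuousOn.smul hu').intervalIntegrable
    have i2 : IntervalIntegrable (fun x => ψ x • c) volume s t :=
      (by fun_prop : Continuous fun x => ψ x • c).intervalIntegrable _ _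
    rw [intervalIntegral.integral_sub i1 i2, intervalIntegral.integral_smul_const, hψ1, one_smul]
  rw [h1]
  calc ‖∫ x in s..t, ψ x • (u x - c)‖ ≤ ∫ x in s..t, ψ x * δ := by
        refine intervalIntegral.norm_integral_le_of_norm_le hst ?_
          (hψ.mul continuous_const).continuousOn.intervalIntegrable
        refine Eventually.of_forall fun x hx => ?_
        rw [norm_smul, Real.norm_of_nonneg (hψ0 x)]
        by_cases h0 : ψ x = 0
        · simp [h0]
        · exact mul_le_mul_of_nonneg_left (hc x (Ioc_subset_Icc_self hx) h0) (hψ0 x)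
    _ = δ := by rw [intervalIntegral.integral_mul_const, hψ1, one_mul]

/-- The increments of a continuous function are the integrals of its weak derivative. -/
theorem HasWeakDeriv.sub_eq_integral {d : ℕ} {J : Set ℝ} (hJ : IsOpen J) {u g : ℝ → L2 d}
    (hu : ContinuousOn u J) (hw : HasWeakDeriv J u g) {s t : ℝ} (hst : s < t) (hsub : Icc s t ⊆ J) :
    u t - u s = ∫ x in s..t, g x := by
  obtain ⟨-, hg, hw⟩ := hw
  set σ := Real.smoothTransition with hσ
  have hgi : IntegrableOn g (Icc s t) := hg.integrableOn_compact_subset hsub isCompact_Icc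
  have hus : ContinuousOn u (Icc s t) := hu.mono hsub
  -- A plateau that rises on [s, s+ε] and falls on [t-ε, t]; its derivative approximates the
  -- difference of the unit masses at s and t.
  set φ : ℝ → ℝ → ℝ := fun ε x => σ ((x - s) / ε) * σ ((t - x) / ε) with hφ
  have hφ0 : ∀ ε > 0, ∀ x, x ∉ Icc s t → φ ε x = 0 := fun ε hε x hx => by
    rw [mem_Icc, not_and_or, not_le, not_le] at hx
    rcases hx with hx | hx
    · have e : σ ((x - s) / ε) = 0 := Real.smoothTransition.zero_of_nonpos
        (div_nonpos_of_nonpos_of_nonneg (by linarith) hε.le)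
      simp only [hφ, e, zero_mul]
    · have e : σ ((t - x) / ε) = 0 := Real.smoothTransition.zero_of_nonpos
        (div_nonpos_of_nonpos_of_nonneg (by linarith) hε.le)
      simp only [hφ, e, mul_zero]
  have hφsupp : ∀ ε > 0, tsupport (φ ε) ⊆ Icc s t := fun ε hε =>
    closure_minimal (fun x hx => by_contra fun h => hx (hφ0 ε hε x h)) isClosed_Icc
  have hφc : ∀ ε > 0, HasCompactSupport (φ ε) := fun ε hε =>
    isCompact_Icc.of_isClosed_subset (isClosed_tsupport _) (hφsupp ε hε)
  have hφs : ∀ ε, ContDiff ℝ ∞ (φ ε) := fun ε => by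
    have h1 : ContDiff ℝ ∞ fun x : ℝ => (x - s) / ε := by fun_prop
    have h2 : ContDiff ℝ ∞ fun x : ℝ => (t - x) / ε := by fun_prop
    exact ((Real.smoothTransition.contDiff (n := ⊤)).comp h1).mul
      ((Real.smoothTransition.contDiff (n := ⊤)).comp h2)
  set ψ₁ : ℝ → ℝ → ℝ := fun ε x => deriv σ ((x - s) / ε) / ε with hψ₁
  set ψ₂ : ℝ → ℝ → ℝ := fun ε x => deriv σ ((t - x) / ε) / ε with hψ₂
  have hd1 : ∀ ε x, HasDerivAt (fun x => σ ((x - s) / ε)) (ψ₁ ε x) x := fun ε x => by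
    have h1 : HasDerivAt (fun x : ℝ => (x - s) / ε) (1 / ε) x :=
      ((hasDerivAt_id x).sub_const s).div_const ε
    have := (hasDerivAt_smoothTransition ((x - s) / ε)).comp x h1
    rwa [mul_one_div] at this
  have hd2 : ∀ ε x, HasDerivAt (fun x => σ ((t - x) / ε)) (-ψ₂ ε x) x := fun ε x => by
    have h1 : HasDerivAt (fun x : ℝ => (t - x) / ε) (-1 / ε) x :=
      ((hasDerivAt_id x).const_sub t).div_const ε
    have := (hasDerivAt_smoothTransition ((t - x) / ε)).comp x h1
    convert! this using 1
    rw [hψ₂]; ring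
  have hc1 : ∀ ε, Continuous (ψ₁ ε) := fun ε =>
    (continuous_deriv_smoothTransition.comp (by fun_prop)).div_const ε
  have hc2 : ∀ ε, Continuous (ψ₂ ε) := fun ε =>
    (continuous_deriv_smoothTransition.comp (by fun_prop)).div_const ε
  -- For 2ε < t - s the two ramps are disjoint, so at each x one factor equals 1 and its derivative
  -- vanishes.
  have hφd : ∀ ε > 0, 2 * ε < t - s → ∀ x, deriv (φ ε) x = ψ₁ ε x - ψ₂ ε x := fun ε hε hε2 x => by
    have hd : HasDerivAt (φ ε) (ψ₁ ε x * σ ((t - x) / ε) + σ ((x - s) / ε) * -ψ₂ ε x) x :=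
      (hd1 ε x).mul (hd2 ε x)
    rw [hd.deriv]
    rcases lt_or_ge 1 ((x - s) / ε) with h | h
    · have e1 : σ ((x - s) / ε) = 1 := Real.smoothTransition.one_of_one_le h.le
      have e2 : ψ₁ ε x = 0 := by
        rw [hψ₁]; simp only
        rw [deriv_smoothTransition_of_one_lt h, zero_div]
      rw [e1, e2]; ring
    · have h' : 1 < (t - x) / ε := by
        rw [div_le_one hε] at h
        rw [one_lt_div hε]
        linarith
      have e1 : σ ((t - x) / ε) = 1 := Real.smoothTransition.one_of_one_le h'.le
      have e2 : ψ₂ ε x = 0 := by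
        rw [hψ₂]; simp only
        rw [deriv_smoothTransition_of_one_lt h', zero_div]
      rw [e1, e2]; ring
  have hσ0 : ∀ ε > 0, 2 * ε < t - s → σ ((t - s) / ε) = 1 := fun ε hε hε2 =>
    Real.smoothTransition.one_of_one_le (by rw [one_le_div hε]; linarith)
  have hI1 : ∀ ε > 0, 2 * ε < t - s → ∫ x in s..t, ψ₁ ε x = 1 := fun ε hε hε2 => by
    rw [intervalIntegral.integral_eq_sub_of_hasDerivAt (fun x _ => hd1 ε x)
      ((hc1 ε).intervalIntegrable _ _), hσ0 ε hε hε2]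
    simp [hσ]
  have hI2 : ∀ ε > 0, 2 * ε < t - s → ∫ x in s..t, ψ₂ ε x = 1 := fun ε hε hε2 => by
    have := intervalIntegral.integral_eq_sub_of_hasDerivAt (fun x _ => hd2 ε x)
      ((hc2 ε).neg.intervalIntegrable s t)
    rw [intervalIntegral.integral_neg, hσ0 ε hε hε2, sub_self, zero_div, hσ,
      Real.smoothTransition.zero] at this
    linarith
  have hψ0 : ∀ ε > 0, ∀ x, 0 ≤ ψ₁ ε x := fun ε hε x =>
    div_nonneg (deriv_smoothTransition_nonneg _) hε.le
  have hψ0' : ∀ ε > 0, ∀ x, 0 ≤ ψ₂ ε x := fun ε hε x =>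
    div_nonneg (deriv_smoothTransition_nonneg _) hε.le
  have hweak : ∀ ε > 0, 2 * ε < t - s →
      (∫ x in s..t, ψ₁ ε x • u x) - (∫ x in s..t, ψ₂ ε x • u x) = -∫ x in s..t, φ ε x • g x := by
    intro ε hε hε2
    have h1 := hw (φ ε) (hφs ε) (hφc ε hε) ((hφsupp ε hε).trans hsub)
    have e1 : ∀ (ρ : ℝ → ℝ) (w : ℝ → L2 d), (∀ x, x ∉ Icc s t → ρ x = 0) →
        ∫ x in J, ρ x • w x = ∫ x in s..t, ρ x • w x := fun ρ w hρ => by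
      rw [intervalIntegral.integral_of_le hst.le, ← integral_Icc_eq_integral_Ioc]
      exact setIntegral_eq_of_subset_of_forall_sdiff_eq_zero hJ.measurableSet hsub
        fun x hx => by rw [hρ x hx.2, zero_smul]
    rw [e1 _ _ (hφ0 ε hε), e1 _ _ (fun x hx => image_eq_zero_of_notMem_tsupport fun h =>
      hx (hφsupp ε hε (tsupport_deriv_subset_tsupport _ h)))] at h1
    have hus' : ContinuousOn u (uIcc s t) := by rwa [uIcc_of_le hst.le]
    have i1 : IntervalIntegrable (fun x => ψ₁ ε x • u x) volume s t :=
      ((hc1 ε).continuousOn.smul hus').intervalIntegrable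
    have i2 : IntervalIntegrable (fun x => ψ₂ ε x • u x) volume s t :=
      ((hc2 ε).continuousOn.smul hus').intervalIntegrable
    rw [← h1, ← intervalIntegral.integral_sub i1 i2]
    refine intervalIntegral.integral_congr fun x _ => ?_
    simp only [hφd ε hε hε2, sub_smul]
  have hlim : Tendsto (fun ε => ∫ x in s..t, φ ε x • g x) (𝓝[>] 0) (𝓝 (∫ x in s..t, g x)) := by
    simp_rw [intervalIntegral.integral_of_le hst.le, integral_Ioc_eq_integral_Ioo]
    refine tendsto_integral_filter_of_dominated_convergence (fun x => ‖g x‖) ?_ ?_ ?_ ?_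
    · exact Eventually.of_forall fun ε => (hφs ε).continuous.aestronglyMeasurable.smul
        (hgi.mono_set Ioo_subset_Icc_self).1
    · refine Eventually.of_forall fun ε => Eventually.of_forall fun x => ?_
      rw [norm_smul, Real.norm_of_nonneg (mul_nonneg (Real.smoothTransition.nonneg _)
        (Real.smoothTransition.nonneg _))]
      exact mul_le_of_le_one_left (norm_nonneg _) (mul_le_one₀ (Real.smoothTransition.le_one _)
        (Real.smoothTransition.nonneg _) (Real.smoothTransition.le_one _))
    · exact (hgi.mono_set Ioo_subset_Icc_self).norm
    · refine (ae_restrict_iff' measurableSet_Ioo).2 (Eventually.of_forall fun x hx => ?_)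
      have hm : 0 < min (x - s) (t - x) := lt_min (by linarith [hx.1]) (by linarith [hx.2])
      refine tendsto_const_nhds.congr' ?_
      filter_upwards [Ioo_mem_nhdsGT hm] with ε hε
      have e1 : σ ((x - s) / ε) = 1 := Real.smoothTransition.one_of_one_le (by
        rw [one_le_div hε.1]; exact hε.2.le.trans (min_le_left _ _))
      have e2 : σ ((t - x) / ε) = 1 := Real.smoothTransition.one_of_one_le (by
        rw [one_le_div hε.1]; exact hε.2.le.trans (min_le_right _ _))
      simp only [hφ, e1, e2, mul_one, one_smul]
  have hbound : ∀ δ > 0, ‖(∫ x in s..t, g x) - (u t - u s)‖ ≤ 2 * δ := by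
    intro δ hδ
    refine le_of_tendsto (hlim.sub_const (u t - u s)).norm ?_
    obtain ⟨η₁, hη₁, h1⟩ := Metric.continuousOn_iff.1 hus s (left_mem_Icc.2 hst.le) δ hδ
    obtain ⟨η₂, hη₂, h2⟩ := Metric.continuousOn_iff.1 hus t (right_mem_Icc.2 hst.le) δ hδ
    have hm : 0 < min (min η₁ η₂) ((t - s) / 2) := lt_min (lt_min hη₁ hη₂) (by linarith)
    filter_upwards [Ioo_mem_nhdsGT hm] with ε hε
    have hε0 : 0 < ε := hε.1
    have hε1 : ε < η₁ := hε.2.trans_le ((min_le_left _ _).trans (min_le_left _ _))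
    have hε2 : ε < η₂ := hε.2.trans_le ((min_le_left _ _).trans (min_le_right _ _))
    have hε3 : 2 * ε < t - s := by linarith [hε.2.trans_le (min_le_right _ _)]
    have b1 := norm_integral_smul_sub_le hst.le (hc1 ε) (hψ0 ε hε0) (hI1 ε hε0 hε3) hus (c := u s)
      (δ := δ) fun x hx hx0 => by
        have hxε : (x - s) / ε ≤ 1 := by
          by_contra! h
          exact hx0 (by simp only [hψ₁]; rw [deriv_smoothTransition_of_one_lt h, zero_div])
        rw [div_le_one hε0] at hxε
        rw [← dist_eq_norm]
        refine (h1 x hx ?_).le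
        rw [Real.dist_eq, abs_of_nonneg (by linarith [hx.1])]
        linarith
    have b2 := norm_integral_smul_sub_le hst.le (hc2 ε) (hψ0' ε hε0) (hI2 ε hε0 hε3) hus (c := u t)
      (δ := δ) fun x hx hx0 => by
        have hxε : (t - x) / ε ≤ 1 := by
          by_contra! h
          exact hx0 (by simp only [hψ₂]; rw [deriv_smoothTransition_of_one_lt h, zero_div])
        rw [div_le_one hε0] at hxε
        rw [← dist_eq_norm]
        refine (h2 x hx ?_).le
        rw [Real.dist_eq, abs_sub_comm, abs_of_nonneg (by linarith [hx.2])]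
        linarith
    have e := hweak ε hε0 hε3
    have e2 : (∫ x in s..t, φ ε x • g x) - (u t - u s)
        = ((∫ x in s..t, ψ₂ ε x • u x) - u t) - ((∫ x in s..t, ψ₁ ε x • u x) - u s) := by
      rw [← neg_eq_iff_eq_neg] at e
      rw [← e]; abel
    rw [e2]
    refine (norm_sub_le _ _).trans ?_
    linarith
  have hz : ‖(∫ x in s..t, g x) - (u t - u s)‖ ≤ 0 :=
    le_of_forall_pos_le_add fun δ hδ => by
      have := hbound (δ / 2) (by linarith)
      linarith
  exact (sub_eq_zero.1 (norm_le_zero_iff.1 hz)).symm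


/-! ### Abel's integral equation -/

/-- The value depends neither on s nor on t; this is what makes the two Abel kernels conjugate. -/
theorem integral_rpow_mul_rpow_translate {α s t : ℝ} (hα : 0 < α) (hα1 : α < 1) (hst : s < t) :
    ∫ τ in s..t, (t - τ) ^ (α - 1) * (τ - s) ^ (-α) = Real.Gamma α * Real.Gamma (1 - α) := by
  have h1 := integral_rpow_mul_rpow (p := 1 - α) (c := α) (t := t - s) (by linarith) hα
    (by linarith)
  have h2 := intervalIntegral.integral_comp_sub_right (a := s) (b := t)
    (fun x : ℝ => (t - s - x) ^ (α - 1) * x ^ (1 - α - 1)) s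
  rw [sub_self, h1] at h2
  have e : ∀ τ : ℝ, (t - s - (τ - s)) ^ (α - 1) * (τ - s) ^ (1 - α - 1)
      = (t - τ) ^ (α - 1) * (τ - s) ^ (-α) := fun τ => by
    congr 2 <;> ring
  simp_rw [e] at h2
  rw [h2]
  simp [mul_comm]

theorem intervalIntegrable_rpow_mul_rpow_translate {α s t : ℝ} (hα : 0 < α) (hα1 : α < 1)
    (hst : s < t) :
    IntervalIntegrable (fun τ => (t - τ) ^ (α - 1) * (τ - s) ^ (-α)) volume s t := by
  have h1 := intervalIntegrable_rpow_mul_rpow (p := 1 - α) (c := α) (t := t - s) (by linarith) hα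
    (by linarith)
  have h2 := h1.comp_sub_right s
  rw [zero_add, sub_add_cancel] at h2
  refine h2.congr (fun τ _ => ?_)
  congr 2 <;> ring

/-- Integrating an Abel transform against the conjugate Abel kernel. -/
theorem integral_abel {E : Type*} [NormedAddCommGroup E] [NormedSpace ℝ E] [CompleteSpace E]
    {α t : ℝ} (hα : 0 < α) (hα1 : α < 1) (ht : 0 < t) {q : ℝ → E}
    (hq : IntervalIntegrable q volume 0 t) :
    ∫ τ in (0 : ℝ)..t, (t - τ) ^ (α - 1) • ∫ s in (0 : ℝ)..τ, (τ - s) ^ (-α) • q s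
      = (Real.Gamma α * Real.Gamma (1 - α)) • ∫ s in (0 : ℝ)..t, q s := by
  set μ : Measure ℝ := volume.restrict (Ioc 0 t) with hμ
  -- The cutoff to s < τ turns the triangle into a square, on which Fubini's theorem for product
  -- measures applies.
  set k : ℝ → ℝ → ℝ := fun τ s =>
    (Ioi s).indicator (fun τ => (t - τ) ^ (α - 1) * (τ - s) ^ (-α)) τ with hk
  have hq' : Integrable q μ := (intervalIntegrable_iff_integrableOn_Ioc_of_le ht.le).1 hq
  have hkm : Measurable (Function.uncurry k) := by
    have : Function.uncurry k = {p : ℝ × ℝ | p.2 < p.1}.indicator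
        (fun p => (t - p.1) ^ (α - 1) * (p.1 - p.2) ^ (-α)) := by
      ext ⟨τ, s⟩
      simp [hk, indicator, Function.uncurry]
    rw [this]
    exact Measurable.indicator (by fun_prop) (measurableSet_lt measurable_snd measurable_fst)
  have hset : ∀ s ∈ Ioc (0 : ℝ) t, Ioc 0 t ∩ Ioi s = Ioc s t := fun s hs => by
    ext x; simp only [mem_inter_iff, mem_Ioc, mem_Ioi]
    exact ⟨fun h => ⟨h.2, h.1.2⟩, fun h => ⟨⟨hs.1.trans h.1, h.2⟩, h.1⟩⟩
  have hk0 : ∀ s, ∀ τ ∈ Ioc 0 t, 0 ≤ k τ s := fun s τ hτ => by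
    simp only [hk]
    refine indicator_apply_nonneg fun h => mul_nonneg (Real.rpow_nonneg (by linarith [hτ.2]) _)
      (Real.rpow_nonneg (by linarith [mem_Ioi.1 h]) _)
  have hae : ∀ᵐ s ∂μ, s ∈ Ioo 0 t := by
    have h1 : ∀ᵐ s ∂μ, s ∈ Ioc 0 t := ae_restrict_mem measurableSet_Ioc
    have h2 : ∀ᵐ s ∂μ, s ≠ t := ae_restrict_of_ae (Measure.ae_ne volume t)
    filter_upwards [h1, h2] with s h3 h4
    exact ⟨h3.1, lt_of_le_of_ne h3.2 h4⟩
  have hki : ∀ s ∈ Ioo 0 t, Integrable (fun τ => k τ s) μ := fun s hs => by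
    have := (intervalIntegrable_iff_integrableOn_Ioc_of_le hs.2.le).1
      (intervalIntegrable_rpow_mul_rpow_translate hα hα1 hs.2)
    simp only [hk, hμ]
    rw [integrable_indicator_iff measurableSet_Ioi, IntegrableOn,
      Measure.restrict_restrict measurableSet_Ioi, inter_comm, hset s ⟨hs.1, hs.2.le⟩]
    exact this
  have hkI : ∀ s ∈ Ioo 0 t, ∫ τ, k τ s ∂μ = Real.Gamma α * Real.Gamma (1 - α) := fun s hs => by
    simp only [hk, hμ]
    rw [setIntegral_indicator measurableSet_Ioi, hset s ⟨hs.1, hs.2.le⟩,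
      ← intervalIntegral.integral_of_le hs.2.le, integral_rpow_mul_rpow_translate hα hα1 hs.2]
  -- Tonelli with τ first: the inner integral of the nonnegative kernel is the constant Γ(α)Γ(1-α),
  -- so integrability of q suffices.
  have hF : Integrable (Function.uncurry fun τ s => k τ s • q s) (μ.prod μ) := by
    refine (integrable_prod_iff' ?_).2 ⟨?_, ?_⟩
    · exact hkm.aestronglyMeasurable.smul hq'.1.comp_snd
    · filter_upwards [hae] with s hs
      exact (hki s hs).smul_const (q s)
    · refine (hq'.norm.const_mul (Real.Gamma α * Real.Gamma (1 - α))).congr ?_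
      filter_upwards [hae] with s hs
      rw [← hkI s hs, ← integral_mul_const]
      refine setIntegral_congr_fun measurableSet_Ioc fun τ hτ => ?_
      simp only [Function.uncurry]
      rw [norm_smul, Real.norm_of_nonneg (hk0 s τ hτ)]
  have hswap := integral_integral_swap hF
  have hR : ∫ s, ∫ τ, k τ s • q s ∂μ ∂μ = (Real.Gamma α * Real.Gamma (1 - α)) • ∫ s, q s ∂μ := by
    rw [← integral_smul]
    refine integral_congr_ae ?_
    filter_upwards [hae] with s hs
    rw [integral_smul_const, hkI s hs]
  rw [hR] at hswap
  rw [intervalIntegral.integral_of_le ht.le, intervalIntegral.integral_of_le ht.le, ← hswap]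
  refine setIntegral_congr_fun measurableSet_Ioc fun τ hτ => ?_
  rw [intervalIntegral.integral_of_le hτ.1.le, integral_Ioc_eq_integral_Ioo, ← integral_smul]
  have hset2 : Ioc 0 t ∩ Iio τ = Ioo 0 τ := by
    ext x; simp only [mem_inter_iff, mem_Ioc, mem_Iio, mem_Ioo]
    exact ⟨fun h => ⟨h.1.1, h.2⟩, fun h => ⟨⟨h.1, h.2.le.trans hτ.2⟩, h.2⟩⟩
  rw [← hset2, ← setIntegral_indicator measurableSet_Iio]
  refine integral_congr_ae (Eventually.of_forall fun s => ?_)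
  simp only [hk, indicator, mem_Iio, mem_Ioi]
  split_ifs
  · rw [smul_smul]
  · rw [zero_smul]

/-! ### A Gronwall inequality with a weakly singular kernel -/

/-- After the reflection s ↦ t - s the integral is part of the Laplace transform of x^{α-1} at μ. -/
theorem integral_rpow_mul_exp_le {α μ t : ℝ} (hα : 0 < α) (hμ : 0 < μ) (ht : 0 ≤ t) :
    ∫ s in (0 : ℝ)..t, (t - s) ^ (α - 1) * Real.exp (μ * s)
      ≤ Real.exp (μ * t) * ((1 / μ) ^ α * Real.Gamma α) := by
  have h1 := intervalIntegral.integral_comp_sub_left (a := 0) (b := t)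
    (fun x : ℝ => x ^ (α - 1) * Real.exp (μ * (t - x))) t
  simp only [sub_sub_cancel, sub_self, sub_zero] at h1
  have hI : IntegrableOn (fun x : ℝ => x ^ (α - 1) * Real.exp (-(μ * x))) (Ioi 0) := by
    have := integrableOn_rpow_mul_exp_neg_mul_rpow (p := 1) (s := α - 1) (b := μ)
      (by linarith) one_pos hμ
    simpa using this
  rw [h1, ← Real.integral_rpow_mul_exp_neg_mul_Ioi hα hμ, ← integral_const_mul,
    intervalIntegral.integral_of_le ht]
  have e : ∀ x : ℝ, x ^ (α - 1) * Real.exp (μ * (t - x))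
      = Real.exp (μ * t) * (x ^ (α - 1) * Real.exp (-(μ * x))) := fun x => by
    rw [show μ * (t - x) = μ * t + -(μ * x) by ring, Real.exp_add]; ring
  simp_rw [e]
  refine setIntegral_mono_set (hI.const_mul _) ?_ Ioc_subset_Ioi_self.eventuallyLE
  refine (ae_restrict_iff' measurableSet_Ioi).2 (Eventually.of_forall fun x hx => ?_)
  have := Real.rpow_nonneg (le_of_lt (mem_Ioi.1 hx)) (α - 1)
  simp only [Pi.zero_apply]
  positivity

theorem intervalIntegrable_sub_rpow {α t : ℝ} (hα : 0 < α) :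
    IntervalIntegrable (fun s => (t - s) ^ (α - 1)) volume 0 t := by
  have h := (intervalIntegral.intervalIntegrable_rpow' (a := 0) (b := t)
    (show -1 < α - 1 by linarith)).comp_sub_left t
  simpa using h.symm

/-- Relative to the weight e^{μt} with μ large, the Volterra operator halves every bound. Starting
from f ≤ M, n steps give f ≤ M 2^{-n} e^{μt}. -/
theorem eq_zero_of_le_integral {α K M b : ℝ} (hα : 0 < α) (hK : 0 ≤ K) {f : ℝ → ℝ}
    (hf0 : ∀ t ∈ Ioc 0 b, 0 ≤ f t) (hfM : ∀ t ∈ Ioc 0 b, f t ≤ M)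
    (hf : ∀ t ∈ Ioc 0 b, f t ≤ K * ∫ s in (0 : ℝ)..t, (t - s) ^ (α - 1) * f s) :
    ∀ t ∈ Ioc 0 b, f t = 0 := by
  have hΓ := Real.Gamma_pos_of_pos hα
  obtain ⟨μ, hμ, hμα⟩ : ∃ μ : ℝ, 0 < μ ∧ K * ((1 / μ) ^ α * Real.Gamma α) ≤ 1 / 2 := by
    have hB : 0 < 2 * K * Real.Gamma α + 1 := by positivity
    -- With this μ the product K μ^{-α} Γ(α) equals KΓ(α)/(2KΓ(α) + 1); the summand 1 covers K = 0.
    refine ⟨(2 * K * Real.Gamma α + 1) ^ (1 / α), by positivity, ?_⟩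
    rw [Real.div_rpow zero_le_one (by positivity), Real.one_rpow, ← Real.rpow_mul hB.le,
      one_div_mul_cancel hα.ne', Real.rpow_one, one_div, ← div_eq_inv_mul, ← mul_div_assoc,
      div_le_iff₀ hB]
    linarith
  have hM : ∀ t ∈ Ioc 0 b, 0 ≤ M := fun t ht => (hf0 t ht).trans (hfM t ht)
  have key : ∀ n : ℕ, ∀ t ∈ Ioc 0 b, f t ≤ M * (1 / 2) ^ n * Real.exp (μ * t) := by
    intro n
    induction n with
    | zero =>
      intro t ht
      have h1 : 1 ≤ Real.exp (μ * t) := Real.one_le_exp (by have := ht.1; positivity)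
      have := hM t ht
      have := hfM t ht
      rw [pow_zero, mul_one]
      nlinarith
    | succ n ih =>
      intro t ht
      have hM0 := hM t ht
      have h1 : ∫ s in (0 : ℝ)..t, (t - s) ^ (α - 1) * f s
          ≤ ∫ s in (0 : ℝ)..t, (t - s) ^ (α - 1) * Real.exp (μ * s) * (M * (1 / 2) ^ n) := by
        rw [intervalIntegral.integral_of_le ht.1.le, intervalIntegral.integral_of_le ht.1.le]
        refine integral_mono_of_nonneg ?_ ?_ ?_
        · refine (ae_restrict_iff' measurableSet_Ioc).2 (Eventually.of_forall fun s hs => ?_)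
          exact mul_nonneg (Real.rpow_nonneg (by linarith [hs.2]) _)
            (hf0 s ⟨hs.1, hs.2.trans ht.2⟩)
        · have := ((intervalIntegrable_sub_rpow (t := t) hα).mul_continuousOn
            (g := fun s => Real.exp (μ * s)) (by fun_prop)).mul_const (M * (1 / 2) ^ n)
          exact (intervalIntegrable_iff_integrableOn_Ioc_of_le ht.1.le).1 this
        · refine (ae_restrict_iff' measurableSet_Ioc).2 (Eventually.of_forall fun s hs => ?_)
          have := mul_le_mul_of_nonneg_left (ih s ⟨hs.1, hs.2.trans ht.2⟩)
            (Real.rpow_nonneg (show 0 ≤ t - s by linarith [hs.2]) (α - 1))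
          simp only
          linarith
      rw [intervalIntegral.integral_mul_const] at h1
      have h2 := integral_rpow_mul_exp_le hα hμ ht.1.le
      calc f t ≤ K * ∫ s in (0 : ℝ)..t, (t - s) ^ (α - 1) * f s := hf t ht
        _ ≤ K * (Real.exp (μ * t) * ((1 / μ) ^ α * Real.Gamma α) * (M * (1 / 2) ^ n)) := by
            refine mul_le_mul_of_nonneg_left (h1.trans ?_) hK
            exact mul_le_mul_of_nonneg_right h2 (by positivity)
        _ = K * ((1 / μ) ^ α * Real.Gamma α) * (M * (1 / 2) ^ n * Real.exp (μ * t)) := by ring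
        _ ≤ 1 / 2 * (M * (1 / 2) ^ n * Real.exp (μ * t)) :=
            mul_le_mul_of_nonneg_right hμα (by positivity)
        _ = M * (1 / 2) ^ (n + 1) * Real.exp (μ * t) := by rw [pow_succ]; ring
  intro t ht
  refine le_antisymm ?_ (hf0 t ht)
  have h1 : Tendsto (fun n : ℕ => M * (1 / 2 : ℝ) ^ n * Real.exp (μ * t)) atTop
      (𝓝 (M * 0 * Real.exp (μ * t))) :=
    ((tendsto_pow_atTop_nhds_zero_of_lt_one (by norm_num) (by norm_num)).const_mul M).mul_const _
  rw [mul_zero, zero_mul] at h1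
  exact ge_of_tendsto' h1 fun n => key n t ht

/-! ### Bounded Fourier multipliers -/

theorem memLp_mul_of_bound {d : ℕ} {m : Sp d → ℂ} (hm : Measurable m) {K : ℝ}
    (hb : ∀ ξ, ‖m ξ‖ ≤ K) (f : L2 d) : MemLp (fun ξ => m ξ * f ξ) 2 volume :=
  memLp_mul_of_le hm.aestronglyMeasurable (G := f) (K := K) (Eventually.of_forall fun ξ => by
    rw [norm_mul]; exact mul_le_mul_of_nonneg_right (hb ξ) (norm_nonneg _))

/-- Multiplication by a bounded measurable function on `L²`. -/
def mulCLM {d : ℕ} {m : Sp d → ℂ} (hm : Measurable m) {K : ℝ} (hb : ∀ ξ, ‖m ξ‖ ≤ K) :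
    L2 d →L[ℂ] L2 d :=
  LinearMap.mkContinuous
    { toFun := mulL2 m
      map_add' := fun f g => by
        apply Lp.ext
        filter_upwards [mulL2_ae (memLp_mul_of_bound hm hb (f + g)),
          mulL2_ae (memLp_mul_of_bound hm hb f), mulL2_ae (memLp_mul_of_bound hm hb g),
          Lp.coeFn_add f g, Lp.coeFn_add (mulL2 m f) (mulL2 m g)] with ξ h1 h2 h3 h4 h5
        rw [h1, h5, Pi.add_apply, h2, h3, h4, Pi.add_apply, mul_add]
      map_smul' := fun c f => by
        apply Lp.ext
        filter_upwards [mulL2_ae (memLp_mul_of_bound hm hb (c • f)),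
          mulL2_ae (memLp_mul_of_bound hm hb f),
          Lp.coeFn_smul c f, Lp.coeFn_smul c (mulL2 m f)] with ξ h1 h2 h4 h5
        rw [RingHom.id_apply, h1, h5, Pi.smul_apply, h2, h4, Pi.smul_apply, smul_eq_mul,
          smul_eq_mul]
        ring } K
    fun f => norm_le_of_ae_mul (mulL2_ae (memLp_mul_of_bound hm hb f))
      (Eventually.of_forall fun ξ => by
        rw [norm_mul]; exact mul_le_mul_of_nonneg_right (hb ξ) (norm_nonneg _))

theorem mulCLM_ae {d : ℕ} {m : Sp d → ℂ} (hm : Measurable m) {K : ℝ} (hb : ∀ ξ, ‖m ξ‖ ≤ K)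
    (f : L2 d) : (mulCLM hm hb f : Sp d → ℂ) =ᵐ[volume] fun ξ => m ξ * f ξ :=
  mulL2_ae (memLp_mul_of_bound hm hb f)

/-- Truncation of the Fourier transform to a ball turns `H₀` into a bounded operator. -/
theorem exists_truncation (d : ℕ) (R : ℝ) : ∃ Q A : L2 d →L[ℂ] L2 d,
    (∀ v ∈ domH0 d, Q (H0 v) = A (Q v)) ∧
      ∀ v, Q v = 0 → ∀ᵐ ξ, ‖ξ‖ ≤ R → fourierL2 d v ξ = 0 := by
  set p : Sp d → ℂ := (Metric.closedBall 0 R).indicator fun _ => 1 with hp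
  set a : Sp d → ℂ := (Metric.closedBall 0 R).indicator fun ξ => ((‖ξ‖ ^ 2 : ℝ) : ℂ) with ha
  have hpm : Measurable p := measurable_const.indicator Metric.isClosed_closedBall.measurableSet
  have ham : Measurable a :=
    Measurable.indicator (by fun_prop) Metric.isClosed_closedBall.measurableSet
  have hpb : ∀ ξ, ‖p ξ‖ ≤ 1 := fun ξ => by
    simp only [hp, indicator]; split_ifs <;> simp
  have hab : ∀ ξ, ‖a ξ‖ ≤ R ^ 2 := fun ξ => by
    simp only [ha, indicator]
    split_ifs with h
    · rw [Complex.norm_real, Real.norm_of_nonneg (by positivity)]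
      exact pow_le_pow_left₀ (norm_nonneg _) (mem_closedBall_zero_iff.1 h) 2
    · simp; positivity
  refine ⟨(mulCLM hpm hpb).comp (fourierL2 d).toContinuousLinearEquiv.toContinuousLinearMap,
    mulCLM ham hab, fun v hv => ?_, fun v hv => ?_⟩
  · change mulCLM hpm hpb (fourierL2 d (H0 v)) = mulCLM ham hab (mulCLM hpm hpb (fourierL2 d v))
    apply Lp.ext
    filter_upwards [mulCLM_ae hpm hpb (fourierL2 d (H0 v)),
      mulCLM_ae ham hab (mulCLM hpm hpb (fourierL2 d v)), mulCLM_ae hpm hpb (fourierL2 d v),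
      fourierL2_H0 hv] with ξ h1 h2 h3 h4
    rw [h1, h2, h3, h4]
    simp only [hp, ha, indicator]
    split_ifs <;> simp
  · change mulCLM hpm hpb (fourierL2 d v) = 0 at hv
    have h1 := mulCLM_ae hpm hpb (fourierL2 d v)
    rw [hv] at h1
    filter_upwards [h1, Lp.coeFn_zero ℂ 2 (volume : Measure (Sp d))] with ξ h2 h3 hξ
    rw [h3] at h2
    simpa [hp, indicator, hξ] using h2.symm


/-! ### Uniqueness of solutions -/

/-- The primitive of an integrable function is continuous, so the lower limit s can be sent to 0. -/
theorem sub_eq_integral_of_tendsto {E : Type*} [NormedAddCommGroup E] [NormedSpace ℝ E]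
    {y p : ℝ → E} {y₀ : E} {t : ℝ} (ht : 0 < t) (hp : IntervalIntegrable p volume 0 t)
    (hy : Tendsto y (𝓝[>] 0) (𝓝 y₀)) (h : ∀ s ∈ Ioo 0 t, y t - y s = ∫ x in s..t, p x) :
    y t - y₀ = ∫ x in (0 : ℝ)..t, p x := by
  have h1 := intervalIntegral.continuousOn_primitive_interval' hp right_mem_uIcc
    0 left_mem_uIcc
  have h2 : Tendsto (fun s => ∫ x in t..s, p x) (𝓝[>] 0) (𝓝 (∫ x in t..0, p x)) := by
    refine h1.tendsto.mono_left ?_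
    rw [uIcc_of_le ht.le]
    exact nhdsWithin_le_of_mem (Icc_mem_nhdsGT_of_mem ⟨le_rfl, ht⟩)
  have h3 : Tendsto (fun s => y t - y s) (𝓝[>] 0) (𝓝 (-∫ x in t..0, p x)) := by
    refine h2.neg.congr' ?_
    filter_upwards [Ioo_mem_nhdsGT ht] with s hs
    rw [h s hs, intervalIntegral.integral_symm, neg_neg]
  rw [tendsto_nhds_unique (tendsto_const_nhds.sub hy) h3, ← intervalIntegral.integral_symm]

theorem Icc_subset_timeInterval {T : EReal} {s t : ℝ} (hs : 0 < s) (ht : t ∈ timeInterval T) :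
    Icc s t ⊆ timeInterval T := fun _ hx =>
  ⟨hs.trans_le hx.1, (EReal.coe_le_coe_iff.2 hx.2).trans_lt ht.2⟩

theorem Ioc_subset_timeInterval {T : EReal} {t : ℝ} (ht : t ∈ timeInterval T) :
    Ioc 0 t ⊆ timeInterval T := fun _ hx =>
  ⟨hx.1, (EReal.coe_le_coe_iff.2 hx.2).trans_lt ht.2⟩

/-- An interval to the right of t has positive measure. This finds a time beyond t at which the
Caputo integral converges. -/
theorem exists_gt_of_ae {J : Set ℝ} (hJ : IsOpen J) {P : ℝ → Prop}
    (hP : ∀ᵐ t ∂(volume.restrict J), P t) {t : ℝ} (ht : t ∈ J) : ∃ τ, t < τ ∧ P τ := by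
  obtain ⟨δ, hδ, hsub⟩ := Metric.isOpen_iff.1 hJ t ht
  have hs : Ioo t (t + δ) ⊆ J := fun x hx => hsub (by
    rw [Metric.mem_ball, Real.dist_eq, abs_of_pos (by linarith [hx.1])]
    linarith [hx.2])
  have h1 := ae_restrict_of_ae_restrict_of_subset hs hP
  have : NeBot (ae (volume.restrict (Ioo t (t + δ)))) := by
    rw [ae_neBot, Ne, Measure.restrict_eq_zero]
    simp [hδ]
  obtain ⟨τ, h2, h3⟩ := (h1.and (ae_restrict_mem measurableSet_Ioo)).exists
  exact ⟨τ, h3.1, h2⟩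

/-- A function for which the Caputo integral converges is integrable. -/
theorem intervalIntegrable_of_rpow_smul {E : Type*} [NormedAddCommGroup E] [NormedSpace ℝ E]
    {α t τ : ℝ} (hα : 0 < α) (ht : 0 < t) (htτ : t ≤ τ) {g : ℝ → E}
    (hg : IntervalIntegrable (fun s => (τ - s) ^ (-α) • g s) volume 0 τ) :
    IntervalIntegrable g volume 0 t := by
  -- The continuous factor (τ - s)^α undoes the weight in the hypothesis.
  have h1 : IntervalIntegrable (fun s => (τ - s) ^ α • (τ - s) ^ (-α) • g s) volume 0 τ := by
    refine hg.continuousOn_smul (f := fun s => (τ - s) ^ α) ?_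
    exact (ContinuousOn.rpow_const (by fun_prop) fun _ _ => Or.inr hα.le)
  rw [intervalIntegrable_iff_integrableOn_Ioo_of_le (ht.le.trans htτ)] at h1
  rw [intervalIntegrable_iff_integrableOn_Ioo_of_le ht.le]
  refine (h1.congr_fun (fun s hs => ?_) measurableSet_Ioo).mono_set
    (Ioo_subset_Ioo_right htτ)
  have h0 : 0 < τ - s := by linarith [hs.2]
  rw [smul_smul, ← Real.rpow_add h0, add_neg_cancel, Real.rpow_zero, one_smul]

namespace IsSolution

variable {d : ℕ} {α β : ℝ} {κ : ℂ} {u₀ : L2 d} {T : EReal} {u v : ℝ → L2 d}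

/-- The definition of a solution does not constrain its value at t = 0; assigning u₀ there gives
continuity on a compact interval. -/
theorem continuousOn_update (hv : IsSolution α β u₀ T v) {t : ℝ} (ht : t ∈ timeInterval T) :
    ContinuousOn (Function.update v 0 u₀) (Icc 0 t) := by
  rw [continuousOn_update_iff, Icc_sdiff_left]
  exact ⟨hv.continuousOn.mono (Ioc_subset_timeInterval ht), fun _ =>
    hv.initial.mono_left (nhdsWithin_mono _ Ioc_subset_Ioi_self)⟩

theorem update_eq {s : ℝ} (hs : 0 < s) : Function.update v 0 u₀ s = v s :=
  Function.update_of_ne hs.ne' _ _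

/-- The Volterra integral equation for a truncation of a solution. -/
theorem volterra (hα : 0 < α) (hα1 : α ≤ 1) (hκ : Complex.I ^ (β : ℂ) * κ = 1)
    (hv : IsSolution α β u₀ T v) {Q A : L2 d →L[ℂ] L2 d}
    (hQ : ∀ v ∈ domH0 d, Q (H0 v) = A (Q v)) {t : ℝ} (ht : t ∈ timeInterval T) :
    Q (v t) - Q u₀ = (Real.Gamma α)⁻¹ •
      ∫ s in (0 : ℝ)..t, (t - s) ^ (α - 1) • (κ • A) (Q (Function.update v 0 u₀ s)) := by
  obtain ⟨w, ⟨g, hg, hgw⟩, heq⟩ := hv.equation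
  have ht0 : 0 < t := ht.1
  have hJ := isOpen_timeInterval T
  have hκ' : κ * Complex.I ^ (β : ℂ) = 1 := by rw [mul_comm, hκ]
  -- Q intertwines H₀ with A, and the factor κ inverts i^β.
  have hcap : ∀ᵐ s ∂(volume.restrict (timeInterval T)),
      Q (caputo α g s) = (κ • A) (Q (v s)) := by
    filter_upwards [hgw, heq, hv.mem_dom] with s h1 h2 h3
    have h4 : H0 (v s) = Complex.I ^ (β : ℂ) • w s := by
      rw [neg_smul, neg_add_eq_zero] at h2
      exact h2.symm
    rw [smul_apply, ← hQ _ h3, h4, map_smul, smul_smul, hκ', one_smul, h1.2]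
  have hcap' : ∀ᵐ s ∂(volume.restrict (Ioc 0 t)),
      Q (caputo α g s) = (κ • A) (Q (Function.update v 0 u₀ s)) := by
    filter_upwards [ae_restrict_of_ae_restrict_of_subset (Ioc_subset_timeInterval ht) hcap,
      ae_restrict_mem measurableSet_Ioc] with s h1 h2
    rw [update_eq h2.1, h1]
  have hcont : ContinuousOn (fun s => (κ • A) (Q (Function.update v 0 u₀ s))) (Icc 0 t) :=
    ((κ • A).comp Q).continuous.comp_continuousOn (hv.continuousOn_update ht)
  have hQy : Tendsto (fun s => Q (v s)) (𝓝[>] 0) (𝓝 (Q u₀)) :=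
    (Q.continuous.tendsto u₀).comp hv.initial
  have hinc : ∀ s ∈ Ioo 0 t, v t - v s = ∫ x in s..t, g x := fun s hs =>
    hg.sub_eq_integral hJ hv.continuousOn hs.2 (Icc_subset_timeInterval hs.1 ht)
  have hgi : ∀ s ∈ Ioo 0 t, IntervalIntegrable g volume s t := fun s hs => by
    rw [intervalIntegrable_iff_integrableOn_Icc_of_le hs.2.le]
    exact hg.2.1.integrableOn_compact_subset (Icc_subset_timeInterval hs.1 ht) isCompact_Icc
  rcases hα1.lt_or_eq with hα1 | rfl
  -- Local integrability on the open interval says nothing about g near 0; that information comes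
  -- from the convergent Caputo integral at some τ > t.
  · obtain ⟨τ, htτ, hτ, -⟩ := exists_gt_of_ae hJ hgw ht
    have hg0 : IntervalIntegrable g volume 0 t :=
      intervalIntegrable_of_rpow_smul hα ht0 htτ.le (hτ hα1)
    have hQg : IntervalIntegrable (fun s => Q (g s)) volume 0 t :=
      ⟨Q.integrable_comp hg0.1, Q.integrable_comp hg0.2⟩
    have e1 : Q (v t) - Q u₀ = ∫ x in (0 : ℝ)..t, Q (g x) := by
      rw [Q.intervalIntegral_comp_comm hg0, ← map_sub,
        sub_eq_integral_of_tendsto ht0 hg0 hv.initial hinc]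
    -- Integration against the conjugate kernel turns the Caputo integral back into the integral of
    -- Q g.
    have e2 := integral_abel hα hα1 ht0 hQg
    have hΓ := (Real.Gamma_pos_of_pos hα).ne'
    have hΓ' := (Real.Gamma_pos_of_pos (show 0 < 1 - α by linarith)).ne'
    have e3 : ∫ τ in (0 : ℝ)..t, (t - τ) ^ (α - 1) • ∫ s in (0 : ℝ)..τ, (τ - s) ^ (-α) • Q (g s)
        = Real.Gamma (1 - α) • ∫ s in (0 : ℝ)..t,
          (t - s) ^ (α - 1) • (κ • A) (Q (Function.update v 0 u₀ s)) := by
      rw [← intervalIntegral.integral_smul, intervalIntegral.integral_of_le ht0.le,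
        intervalIntegral.integral_of_le ht0.le]
      refine integral_congr_ae ?_
      filter_upwards [hcap',
        ae_restrict_of_ae_restrict_of_subset (Ioc_subset_timeInterval ht) hgw] with s h1 h2
      have h3 : ∫ r in (0 : ℝ)..s, (s - r) ^ (-α) • Q (g r)
          = Q (∫ r in (0 : ℝ)..s, (s - r) ^ (-α) • g r) := by
        rw [← Q.intervalIntegral_comp_comm (h2.1 hα1)]
        refine intervalIntegral.integral_congr fun r _ => ?_
        exact (Q.restrictScalars ℝ).map_smul _ _ |>.symm
      have h4 : Q ((Real.Gamma (1 - α))⁻¹ • ∫ r in (0 : ℝ)..s, (s - r) ^ (-α) • g r)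
          = (Real.Gamma (1 - α))⁻¹ • Q (∫ r in (0 : ℝ)..s, (s - r) ^ (-α) • g r) :=
        (Q.restrictScalars ℝ).map_smul _ _
      rw [← h1, caputo, if_neg hα1.ne, h4, h3, smul_comm (Real.Gamma (1 - α)) _ (_ • _),
        smul_inv_smul₀ hΓ']
    rw [e2, mul_comm, mul_smul] at e3
    have e4 := smul_right_injective (L2 d) hΓ' e3
    rw [e1, ← e4, inv_smul_smul₀ hΓ]
  -- For α = 1 no Caputo integral is available, and the equation itself supplies integrability near
  -- 0: Q g agrees a.e. with a continuous function.
  · have hp : IntervalIntegrable (fun s => (κ • A) (Q (Function.update v 0 u₀ s))) volume 0 t :=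
      (hcont.mono (by rw [uIcc_of_le ht0.le])).intervalIntegrable
    simp only [sub_self, Real.rpow_zero, one_smul, Real.Gamma_one, inv_one]
    refine sub_eq_integral_of_tendsto (y := fun s => Q (v s)) ht0 hp hQy fun s hs => ?_
    rw [← map_sub, hinc s hs, ← Q.intervalIntegral_comp_comm (hgi s hs),
      intervalIntegral.integral_of_le hs.2.le, intervalIntegral.integral_of_le hs.2.le]
    refine integral_congr_ae ?_
    filter_upwards [ae_restrict_of_ae_restrict_of_subset (Ioc_subset_Ioc_left hs.1.le) hcap']
      with r hr
    rw [← hr, caputo, if_pos rfl]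

end IsSolution

/-- Since A is bounded and e is continuous on a compact interval, ‖e‖ satisfies the hypotheses of
the singular Gronwall inequality with K = |c| ‖A‖. -/
theorem eq_zero_of_volterra {E : Type*} [NormedAddCommGroup E] [NormedSpace ℝ E]
    [NormedSpace ℂ E] {α b c : ℝ} (hα : 0 < α) (A : E →L[ℂ] E) {e : ℝ → E} (he : ContinuousOn e (Icc 0 b))
    (h : ∀ t ∈ Ioc 0 b, e t = c • ∫ s in (0 : ℝ)..t, (t - s) ^ (α - 1) • A (e s)) :
    ∀ t ∈ Ioc 0 b, e t = 0 := by
  obtain ⟨M, hM⟩ := isCompact_Icc.exists_bound_of_continuousOn he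
  have key := eq_zero_of_le_integral (K := |c| * ‖A‖) (M := M) (b := b) (f := fun t => ‖e t‖) hα
    (by positivity) (fun t _ => norm_nonneg _) (fun t ht => hM t (Ioc_subset_Icc_self ht))
    fun t ht => by
      have hi : IntervalIntegrable (fun s => (t - s) ^ (α - 1) * ‖e s‖) volume 0 t := by
        refine (intervalIntegrable_sub_rpow hα).mul_continuousOn ?_
        rw [uIcc_of_le ht.1.le]
        exact (he.mono (Icc_subset_Icc_right ht.2)).norm
      rw [h t ht, norm_smul, Real.norm_eq_abs, mul_assoc, ← intervalIntegral.integral_const_mul]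
      refine mul_le_mul_of_nonneg_left ?_ (abs_nonneg c)
      refine intervalIntegral.norm_integral_le_of_norm_le ht.1.le ?_ (hi.const_mul _)
      refine Eventually.of_forall fun s hs => ?_
      have h0 := Real.rpow_nonneg (show 0 ≤ t - s by linarith [hs.2]) (α - 1)
      rw [norm_smul, Real.norm_of_nonneg h0]
      have := mul_le_mul_of_nonneg_left (A.le_opNorm (e s)) h0
      linarith
  exact fun t ht => norm_eq_zero.1 (key t ht)

/-- Two solutions with the same initial state agree. -/
theorem IsSolution.unique {d : ℕ} {α β : ℝ} {κ : ℂ} {u₀ : L2 d} {T : EReal} {u v : ℝ → L2 d}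
    (hα : 0 < α) (hα1 : α ≤ 1) (hκ : Complex.I ^ (β : ℂ) * κ = 1)
    (hu : IsSolution α β u₀ T u) (hv : IsSolution α β u₀ T v) : EqOn v u (timeInterval T) := by
  intro b hb
  have hR : ∀ R : ℝ, ∀ᵐ ξ, ‖ξ‖ ≤ R → fourierL2 d (v b - u b) ξ = 0 := by
    intro R
    obtain ⟨Q, A, hQ, hQ0⟩ := exists_truncation d R
    refine hQ0 _ ?_
    set e : ℝ → L2 d := fun s => Q (Function.update v 0 u₀ s) - Q (Function.update u 0 u₀ s)
      with he
    have hc : ∀ {w}, IsSolution α β u₀ T w →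
        ContinuousOn (fun s => Q (Function.update w 0 u₀ s)) (Icc 0 b) := fun hw =>
      Q.continuous.comp_continuousOn (hw.continuousOn_update hb)
    have hi : ∀ {w}, IsSolution α β u₀ T w → ∀ t ∈ Ioc 0 b, IntervalIntegrable
        (fun s => (t - s) ^ (α - 1) • (κ • A) (Q (Function.update w 0 u₀ s))) volume 0 t :=
      fun hw t ht => by
        refine (intervalIntegrable_sub_rpow hα).smul_continuousOn ?_
        rw [uIcc_of_le ht.1.le]
        exact (κ • A).continuous.comp_continuousOn ((hc hw).mono (Icc_subset_Icc_right ht.2))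
    have hz := eq_zero_of_volterra (c := (Real.Gamma α)⁻¹) (e := e) hα (κ • A)
      ((hc hv).sub (hc hu)) fun t ht => by
        simp only [he]
        have htT := Ioc_subset_timeInterval hb ht
        have e1 := hv.volterra hα hα1 hκ hQ htT
        have e2 := hu.volterra hα hα1 hκ hQ htT
        have e3 : ∀ s, (t - s) ^ (α - 1) • (κ • A) (Q (Function.update v 0 u₀ s) -
            Q (Function.update u 0 u₀ s)) = (t - s) ^ (α - 1) • (κ • A) (Q (Function.update v 0 u₀ s))
              - (t - s) ^ (α - 1) • (κ • A) (Q (Function.update u 0 u₀ s)) := fun s => by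
          rw [map_sub, smul_sub]
        simp_rw [e3]
        rw [intervalIntegral.integral_sub (hi hv t ht) (hi hu t ht), smul_sub, ← e1, ← e2,
          IsSolution.update_eq ht.1, IsSolution.update_eq ht.1]
        abel
    have := hz b ⟨hb.1, le_rfl⟩
    simp only [he, IsSolution.update_eq hb.1] at this
    rwa [map_sub]
  have h0 : fourierL2 d (v b - u b) = 0 := by
    apply Lp.ext
    filter_upwards [ae_all_iff.2 fun n : ℕ => hR n, Lp.coeFn_zero ℂ 2 (volume : Measure (Sp d))]
      with ξ h1 h2
    obtain ⟨n, hn⟩ := exists_nat_ge ‖ξ‖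
    rw [h1 n hn, h2, Pi.zero_apply]
  rw [map_eq_zero_iff _ (fourierL2 d).injective] at h0
  exact sub_eq_zero.1 h0


/-! ### The bounds on the symbols for the three classes of initial data -/

/-- E_{α,1} and E_{α,α} are both bounded on the ray, so the rate is 0 and the only weight is the
factor |ξ|² of the derivative. -/
theorem exists_symbolBound_of_lt (d : ℕ) {α β : ℝ} (hα : 0 < α) (hα1 : α ≤ 1) (hβ1 : β ≤ 1)
    (hαβ : α < β) : ∃ C : ℝ, 0 < C ∧ ∀ h : L2 d,
      MemLp (fun ξ : Sp d => ((‖ξ‖ ^ (2 * 1 : ℝ) : ℝ) : ℂ) * h ξ) 2 volume →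
        SymbolBound α 1 C 0 ((-Complex.I) ^ (β : ℂ)) h := by
  obtain ⟨C₁, h₁⟩ := mittagLeffler_bounded hα hβ1 hαβ 1
  obtain ⟨C₂, h₂⟩ := mittagLeffler_bounded hα hβ1 hαβ α
  have hC : 0 < |C₁| + |C₂| + 1 := by positivity
  refine ⟨|C₁| + |C₂| + 1, hC, fun h hh =>
    ⟨hα, hα1, le_rfl, hC.le, le_rfl, hh, ?_, ?_⟩⟩
  · refine Eventually.of_forall fun ξ _ t ht => ?_
    have := h₁ (‖ξ‖ ^ 2 * t ^ α) (by positivity)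
    rw [zero_mul, Real.exp_zero, mul_one, solSymbol]
    linarith [le_abs_self C₁, abs_nonneg C₂]
  · refine Eventually.of_forall fun ξ _ t ht => ?_
    have h3 := h₂ (‖ξ‖ ^ 2 * t ^ α) (by positivity)
    have h4 := Real.rpow_pos_of_pos ht (α - 1)
    rw [zero_mul, Real.exp_zero, mul_one, derivSymbol, norm_mul, norm_mul, norm_neg_I_cpow, one_mul,
      Complex.norm_real, Real.norm_of_nonneg (by positivity)]
    calc ‖ξ‖ ^ 2 * t ^ (α - 1) * ‖_‖
        ≤ (1 + ‖ξ‖ ^ (2 * 1 : ℝ)) * (t ^ (α - 1) + 1) * (|C₁| + |C₂| + 1) := by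
          gcongr
          · exact sq_le_one_add_rpow (norm_nonneg ξ) le_rfl
          · linarith
          · linarith [le_abs_self C₂, abs_nonneg C₁]
      _ = _ := by ring

theorem cos_nonneg_of_le {α β : ℝ} (hα : 0 < α) (hβ : 0 < β) (hβα : β ≤ α) :
    0 ≤ Real.cos (Real.pi * β / (2 * α)) := by
  have hπ := Real.pi_pos
  refine Real.cos_nonneg_of_neg_pi_div_two_le_of_le ?_ ?_
  · have : 0 ≤ Real.pi * β / (2 * α) := by positivity
    linarith
  · rw [div_le_div_iff₀ (by positivity) two_pos]
    nlinarith

/-- C is fixed before h and X, so it does not depend on the initial state. The weight γ = 1/α comes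
from the derivative: at r = |ξ|² t^α the factor r^{(1-α)/α} of E_{α,α} combines with |ξ|² t^{α-1} to
|ξ|^{2/α}. -/
theorem exists_symbolBound_of_le (d : ℕ) {α β : ℝ} (hα : 0 < α) (hα1 : α ≤ 1) (hβ : 0 < β)
    (hβα : β ≤ α) : ∃ C : ℝ, 0 < C ∧ ∀ (h : L2 d) (X : ℝ), 0 ≤ X →
      MemLp (fun ξ : Sp d => ((‖ξ‖ ^ (2 * (1 / α)) : ℝ) : ℂ) * h ξ) 2 volume →
      (∀ᵐ ξ, h ξ ≠ 0 → Real.cos (Real.pi * β / (2 * α)) * ‖ξ‖ ^ (2 * (1 / α)) ≤ X) →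
        SymbolBound α (1 / α) C X ((-Complex.I) ^ (β : ℂ)) h := by
  obtain ⟨C₁, hC₁, h₁⟩ := mittagLeffler_growth (b := 1) hα hα1 hβ hβα zero_le_one le_rfl
  obtain ⟨C₂, hC₂, h₂⟩ := mittagLeffler_growth (b := α) hα hα1 hβ hβα hα.le hα1
  have hC : 0 < C₁ + C₂ + 1 / α := by positivity
  have hα' : 1 ≤ 1 / α := by rwa [le_div_iff₀ hα, one_mul]
  set c := Real.cos (Real.pi * β / (2 * α)) with hc
  have hpow : ∀ (x t : ℝ), 0 ≤ x → 0 ≤ t →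
      (x ^ 2 * t ^ α) ^ (1 / α) = x ^ (2 * (1 / α)) * t := fun x t hx ht => by
    rw [Real.mul_rpow (by positivity) (by positivity), ← Real.rpow_mul ht, mul_one_div_cancel hα.ne',
      Real.rpow_one, ← Real.rpow_natCast, ← Real.rpow_mul hx]
    norm_num
  refine ⟨C₁ + C₂ + 1 / α, hC, fun h X hX hh hsupp =>
    ⟨hα, hα1, hα', hC.le, hX, hh, ?_, ?_⟩⟩
  · filter_upwards [hsupp] with ξ hξ h0 t ht
    have hE : 1 ≤ Real.exp (X * t) := Real.one_le_exp (by positivity)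
    -- The growth estimate needs r > 0. At r = 0 the symbol is 1, which C dominates because 1/α ≥ 1.
    rcases (show 0 ≤ ‖ξ‖ ^ 2 * t ^ α by positivity).eq_or_lt with hr | hr
    · rw [solSymbol, ← hr, Complex.ofReal_zero, mul_zero, mittagLeffler_zero]
      simp only [Real.Gamma_one, inv_one, Complex.ofReal_one, norm_one]
      nlinarith
    · refine (h₁ _ hr).trans ?_
      rw [sub_self, zero_div, Real.rpow_zero, mul_one, hpow _ _ (norm_nonneg ξ) ht, ← mul_assoc]
      have h3 : Real.exp (c * ‖ξ‖ ^ (2 * (1 / α)) * t) ≤ Real.exp (X * t) :=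
        Real.exp_le_exp.2 (mul_le_mul_of_nonneg_right (hξ h0) ht)
      have h4 := mul_le_mul_of_nonneg_left h3 (show 0 ≤ 1 / α by positivity)
      nlinarith
  · filter_upwards [hsupp] with ξ hξ h0 t ht
    have hE : 1 ≤ Real.exp (X * t) := Real.one_le_exp (by positivity)
    have ht' := Real.rpow_pos_of_pos ht (α - 1)
    have hξ' := Real.rpow_nonneg (norm_nonneg ξ) (2 * (1 / α))
    rcases (norm_nonneg ξ).eq_or_lt with hr | hr
    · rw [derivSymbol, ← hr]
      simp only [ne_eq, OfNat.ofNat_ne_zero, not_false_eq_true, zero_pow, zero_mul,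
        Complex.ofReal_zero, mul_zero, norm_zero]
      positivity
    · have hr2 : 0 < ‖ξ‖ ^ 2 * t ^ α := by positivity
      have h3 := h₂ _ hr2
      rw [hpow _ _ (norm_nonneg ξ) ht.le, ← mul_assoc] at h3
      have h4 : Real.exp (c * ‖ξ‖ ^ (2 * (1 / α)) * t) ≤ Real.exp (X * t) :=
        Real.exp_le_exp.2 (mul_le_mul_of_nonneg_right (hξ h0) ht.le)
      -- All powers of t cancel.
      have h5 : ‖ξ‖ ^ 2 * t ^ (α - 1) * (‖ξ‖ ^ 2 * t ^ α) ^ ((1 - α) / α)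
          = ‖ξ‖ ^ (2 * (1 / α)) := by
        have e1 : (‖ξ‖ ^ 2 * t ^ α) * (‖ξ‖ ^ 2 * t ^ α) ^ ((1 - α) / α)
            = ‖ξ‖ ^ (2 * (1 / α)) * t := by
          have e0 : 1 / α = 1 + (1 - α) / α := by
            field_simp
            ring
          rw [← hpow _ _ hr.le ht.le, e0, Real.rpow_add hr2, Real.rpow_one]
        rw [Real.rpow_sub_one ht.ne', ← mul_div_assoc, div_mul_eq_mul_div, e1,
          mul_div_cancel_right₀ _ ht.ne']
      have h6 := sq_le_one_add_rpow (norm_nonneg ξ) hα'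
      rw [derivSymbol, norm_mul, norm_mul, norm_neg_I_cpow, one_mul, Complex.norm_real,
        Real.norm_of_nonneg (by positivity)]
      calc ‖ξ‖ ^ 2 * t ^ (α - 1) * ‖_‖
          ≤ ‖ξ‖ ^ 2 * t ^ (α - 1) * (C₂ + 1 / α * (‖ξ‖ ^ 2 * t ^ α) ^ ((1 - α) / α) *
              Real.exp (X * t)) := by
            refine mul_le_mul_of_nonneg_left (h3.trans ?_) (by positivity)
            gcongr
        _ = C₂ * (‖ξ‖ ^ 2 * t ^ (α - 1)) + 1 / α * (‖ξ‖ ^ 2 * t ^ (α - 1) *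
              (‖ξ‖ ^ 2 * t ^ α) ^ ((1 - α) / α)) * Real.exp (X * t) := by ring
        _ = C₂ * (‖ξ‖ ^ 2 * t ^ (α - 1)) + 1 / α * ‖ξ‖ ^ (2 * (1 / α)) * Real.exp (X * t) := by
            rw [h5]
        _ ≤ C₂ * ((1 + ‖ξ‖ ^ (2 * (1 / α))) * (t ^ (α - 1) + 1) * Real.exp (X * t))
            + 1 / α * ((1 + ‖ξ‖ ^ (2 * (1 / α))) * (t ^ (α - 1) + 1) * Real.exp (X * t)) := by
            refine add_le_add (mul_le_mul_of_nonneg_left ?_ hC₂) ?_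
            · calc ‖ξ‖ ^ 2 * t ^ (α - 1)
                  ≤ (1 + ‖ξ‖ ^ (2 * (1 / α))) * (t ^ (α - 1) + 1) := by gcongr; linarith
                _ ≤ _ := le_mul_of_one_le_right (by positivity) hE
            · rw [mul_assoc]
              refine mul_le_mul_of_nonneg_left ?_ (by positivity)
              refine mul_le_mul_of_nonneg_right ?_ (by positivity)
              nlinarith
        _ ≤ (C₁ + C₂ + 1 / α) * (t ^ (α - 1) + 1) * Real.exp (X * t) *
              (1 + ‖ξ‖ ^ (2 * (1 / α))) := by
            have : 0 ≤ C₁ * ((t ^ (α - 1) + 1) * Real.exp (X * t) * (1 + ‖ξ‖ ^ (2 * (1 / α)))) := by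
              positivity
            linarith

/-! ### Frequency support and norms of the initial state -/

theorem suppL2_subset {d : ℕ} {f : Sp d → ℂ} {h : L2 d} (hf : (h : Sp d → ℂ) =ᵐ[volume] f) :
    suppL2 h ⊆ tsupport f := fun ξ hξ => by
  by_contra h0
  obtain ⟨r, hr, hsub⟩ := Metric.isOpen_iff.1 (isClosed_tsupport f).isOpen_compl ξ h0
  refine hξ r hr ?_
  filter_upwards [ae_restrict_of_ae hf, ae_restrict_mem measurableSet_ball] with x h1 h2
  rw [h1, Pi.zero_apply]
  exact image_eq_zero_of_notMem_tsupport (hsub h2)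

/-- A point outside the support has a ball on which h vanishes a.e., and a set that is null near
each of its points is null. -/
theorem ae_mem_suppL2 {d : ℕ} (h : L2 d) : ∀ᵐ ξ, h ξ ≠ 0 → ξ ∈ suppL2 h := by
  rw [ae_iff]
  refine measure_null_of_locally_null _ fun ξ hξ => ?_
  simp only [suppL2, mem_ofPred_eq, Classical.not_imp, not_forall, not_not] at hξ
  obtain ⟨-, r, hr, h0⟩ := hξ
  refine ⟨{x | ¬(h x ≠ 0 → x ∈ suppL2 h)} ∩ Metric.ball ξ r,
    inter_mem self_mem_nhdsWithin (mem_nhdsWithin_of_mem_nhds (Metric.ball_mem_nhds ξ hr)), ?_⟩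
  have h1 := (ae_restrict_iff' measurableSet_ball).1 h0
  rw [ae_iff] at h1
  refine measure_mono_null (fun x hx => ?_) h1
  simp only [mem_inter_iff, mem_ofPred_eq, Classical.not_imp] at hx ⊢
  exact ⟨hx.2, hx.1.1⟩

theorem freqRadius_nonneg {d : ℕ} (u₀ : L2 d) : 0 ≤ freqRadius u₀ := by
  refine Real.sSup_nonneg ?_
  rintro _ ⟨ξ, -, rfl⟩
  exact norm_nonneg ξ

/-- Compact support bounds the set of radii; an unbounded set would give the supremum its default
value 0. -/
theorem norm_le_freqRadius {d : ℕ} {u₀ : L2 d} (hu : u₀ ∈ fourierC0 d) :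
    ∀ᵐ ξ, fourierL2 d u₀ ξ ≠ 0 → ‖ξ‖ ≤ freqRadius u₀ := by
  obtain ⟨f, -, hfc, hf⟩ := hu
  have hb : BddAbove ((fun ξ : Sp d => ‖ξ‖) '' suppL2 (fourierL2 d u₀)) :=
    (hfc.isCompact.bddAbove_image continuous_norm.continuousOn).mono
      (image_mono (suppL2_subset hf))
  filter_upwards [ae_mem_suppL2 (fourierL2 d u₀)] with ξ h1 h2
  exact le_csSup hb (mem_image_of_mem _ (h1 h2))

theorem fourierC0_subset_domH0pow (d : ℕ) {γ : ℝ} (hγ : 0 ≤ γ) : fourierC0 d ⊆ domH0pow d γ := by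
  rintro v ⟨f, hfc, hfs, hf⟩
  have h1 : Continuous fun ξ : Sp d => ((‖ξ‖ ^ (2 * γ) : ℝ) : ℂ) :=
    Complex.continuous_ofReal.comp ((Real.continuous_rpow_const (by positivity)).comp continuous_norm)
  have h2 : MemLp (fun ξ : Sp d => ((‖ξ‖ ^ (2 * γ) : ℝ) : ℂ) * f ξ) 2 volume :=
    (h1.mul hfc).memLp_of_hasCompactSupport hfs.mul_left
  refine (memLp_congr_ae ?_).1 h2
  filter_upwards [hf] with ξ hξ
  rw [hξ]

theorem norm_rpow_two_mul_one {d : ℕ} (ξ : Sp d) : ‖ξ‖ ^ (2 * 1 : ℝ) = ‖ξ‖ ^ 2 := by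
  rw [mul_one]; exact_mod_cast Real.rpow_natCast ‖ξ‖ 2

theorem memLp_of_mem_domH0 {d : ℕ} {v : L2 d} (hv : v ∈ domH0 d) :
    MemLp (fun ξ : Sp d => ((‖ξ‖ ^ (2 * 1 : ℝ) : ℝ) : ℂ) * fourierL2 d v ξ) 2 volume := by
  simp_rw [norm_rpow_two_mul_one]
  exact mem_domH0_iff.1 hv

theorem normH0_eq {d : ℕ} {v : L2 d} (hv : v ∈ domH0 d) :
    normH0 v = Real.sqrt (‖fourierL2 d v‖ ^ 2 +
      ‖mulL2 (fun ξ : Sp d => ((‖ξ‖ ^ (2 * 1 : ℝ) : ℝ) : ℂ)) (fourierL2 d v)‖ ^ 2) := by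
  have : fourierL2 d (H0 v)
      = mulL2 (fun ξ : Sp d => ((‖ξ‖ ^ (2 * 1 : ℝ) : ℝ) : ℂ)) (fourierL2 d v) := by
    apply Lp.ext
    filter_upwards [fourierL2_H0 hv, mulL2_ae (memLp_of_mem_domH0 hv)] with ξ h1 h2
    rw [h1, h2, norm_rpow_two_mul_one]
  rw [normH0, ← this, LinearIsometryEquiv.norm_map, LinearIsometryEquiv.norm_map]

theorem normH0pow_eq {d : ℕ} (γ : ℝ) (v : L2 d) :
    normH0pow γ v = Real.sqrt (‖fourierL2 d v‖ ^ 2 +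
      ‖mulL2 (fun ξ : Sp d => ((‖ξ‖ ^ (2 * γ) : ℝ) : ℂ)) (fourierL2 d v)‖ ^ 2) := by
  rw [normH0pow, H0pow, LinearIsometryEquiv.norm_map, LinearIsometryEquiv.norm_map]

/-- The bounds on the symbols for initial states in `U_{α,β}`. -/
theorem exists_symbolBound (d : ℕ) {α β : ℝ} (hα : 0 < α) (hα1 : α ≤ 1) (hβ : 0 < β)
    (hβ1 : β ≤ 1) : ∃ C : ℝ, 0 < C ∧ ∀ u₀ ∈ initialSpace d α β, ∃ γ X : ℝ,
      SymbolBound α γ C X ((-Complex.I) ^ (β : ℂ)) (fourierL2 d u₀) ∧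
      initialNorm α β u₀ = Real.sqrt (‖fourierL2 d u₀‖ ^ 2 +
        ‖mulL2 (fun ξ : Sp d => ((‖ξ‖ ^ (2 * γ) : ℝ) : ℂ)) (fourierL2 d u₀)‖ ^ 2) ∧
      (α ≤ β → X = 0) ∧
      (β < α → X = Real.cos (Real.pi * β / (2 * α)) * freqRadius u₀ ^ (2 / α)) := by
  rcases lt_or_ge α β with hαβ | hβα
  · obtain ⟨C, hC, h⟩ := exists_symbolBound_of_lt d hα hα1 hβ1 hαβ
    refine ⟨C, hC, fun u₀ hu => ?_⟩
    rw [initialSpace, if_pos hαβ] at hu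
    refine ⟨1, 0, h _ (memLp_of_mem_domH0 hu), ?_, fun _ => rfl, fun h => absurd h hαβ.not_gt⟩
    rw [initialNorm, if_pos hαβ, normH0_eq hu]
  · obtain ⟨C, hC, h⟩ := exists_symbolBound_of_le d hα hα1 hβ hβα
    refine ⟨C, hC, fun u₀ hu => ?_⟩
    rw [initialSpace, if_neg hβα.not_gt] at hu
    rw [initialNorm, if_neg hβα.not_gt, normH0pow_eq]
    rcases hβα.eq_or_lt with rfl | hβα
    · rw [if_pos rfl] at hu
      -- Here θ = π/2, so the exponential rate is 0 at every frequency and no support condition is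
      -- needed.
      have hcos : Real.cos (Real.pi * β / (2 * β)) = 0 := by
        rw [mul_div_mul_right _ _ hα.ne', Real.cos_pi_div_two]
      refine ⟨1 / β, 0, h _ 0 le_rfl hu (Eventually.of_forall fun ξ _ => ?_), rfl, fun _ => rfl,
        fun h => absurd h (lt_irrefl _)⟩
      rw [hcos, zero_mul]
    · rw [if_neg hβα.ne'] at hu
      have hc := cos_nonneg_of_le hα hβ hβα.le
      have hΛ := freqRadius_nonneg u₀
      refine ⟨1 / α, _, h _ _ (by positivity) (fourierC0_subset_domH0pow d (by positivity) hu) ?_,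
        rfl, fun h => absurd hβα h.not_gt, fun _ => rfl⟩
      filter_upwards [norm_le_freqRadius hu] with ξ h1 h2
      rw [mul_one_div]
      exact mul_le_mul_of_nonneg_left
        (Real.rpow_le_rpow (norm_nonneg ξ) (h1 h2) (by positivity)) hc

/-- The principal logarithms of i and -i are opposite. -/
theorem I_cpow_mul_neg_I_cpow (β : ℝ) : Complex.I ^ (β : ℂ) * (-Complex.I) ^ (β : ℂ) = 1 := by
  rw [Complex.cpow_def_of_ne_zero Complex.I_ne_zero,
    Complex.cpow_def_of_ne_zero (neg_ne_zero.2 Complex.I_ne_zero), ← Complex.exp_add,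
    Complex.log_I, Complex.log_neg_I, ← Complex.exp_zero]
  congr 1
  ring

end TFSE
end

theorem proposition2p1 (d : ℕ) (hd : 1 ≤ d) (α β : ℝ) (hα : 0 < α) (hα1 : α ≤ 1)
    (hβ : 0 < β) (hβ1 : β ≤ 1) :
    ∃ C : ℝ, 0 < C ∧ ∀ u₀ ∈ TFSE.initialSpace d α β, ∃ u : ℝ → TFSE.L2 d,
      -- existence and uniqueness, on `(0,∞)` (`T = ⊤`) and on every `(0,T)`
      (∀ T : EReal, 0 < T → TFSE.IsSolution α β u₀ T u ∧
        ∀ v : ℝ → TFSE.L2 d, TFSE.IsSolution α β u₀ T v →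
          EqOn v u (TFSE.timeInterval T)) ∧
      -- the formula for the solution
      (∀ t : ℝ, 0 ≤ t →
        MemLp (fun ξ : TFSE.Sp d =>
          TFSE.mittagLeffler α 1 ((-Complex.I) ^ (β : ℂ) * ((‖ξ‖ ^ 2 * t ^ α : ℝ) : ℂ)) *
            TFSE.fourierL2 d u₀ ξ) 2 volume ∧
        u t = (TFSE.fourierL2 d).symm (TFSE.mulL2 (fun ξ : TFSE.Sp d =>
          TFSE.mittagLeffler α 1 ((-Complex.I) ^ (β : ℂ) * ((‖ξ‖ ^ 2 * t ^ α : ℝ) : ℂ)))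
            (TFSE.fourierL2 d u₀))) ∧
      -- regularity and norm estimates
      ∀ T : ℝ, 0 < T →
        TFSE.MemCDom T u ∧ TFSE.MemW11 T u ∧
        (α ≤ β → TFSE.eNormCDom T u + TFSE.eNormW11 T u ≤
          ENNReal.ofReal (C * (1 + T) * TFSE.initialNorm α β u₀)) ∧
        (β < α → TFSE.eNormCDom T u + TFSE.eNormW11 T u ≤
          ENNReal.ofReal (C * (1 + T) *
            Real.exp (Real.cos (Real.pi * β / (2 * α)) *
              TFSE.freqRadius u₀ ^ (2 / α) * T) * TFSE.initialNorm α β u₀)) := by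
  obtain ⟨C, hC, h⟩ := TFSE.exists_symbolBound d hα hα1 hβ hβ1
  -- The factor 6 + 2/α is the one lost in `eNorm_sol_le`.
  refine ⟨C * (6 + 2 / α), by positivity, fun u₀ hu₀ => ?_⟩
  obtain ⟨γ, X, B, hnorm, hX0, hX1⟩ := h u₀ hu₀
  have hκ := TFSE.I_cpow_mul_neg_I_cpow β
  refine ⟨TFSE.sol α ((-Complex.I) ^ (β : ℂ)) (TFSE.fourierL2 d u₀), fun T _ => ?_,
    fun t ht => ⟨B.memLp_sol ht, rfl⟩, fun T hT => ⟨B.memCDom_sol T, B.memW11_sol hT, ?_, ?_⟩⟩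
  · have hs := B.isSolution_sol hκ T
    rw [LinearIsometryEquiv.symm_apply_apply] at hs
    exact ⟨hs, fun v hv => hs.unique hα hα1 hκ hv⟩
  · intro hle
    have := B.eNorm_sol_le hT
    rwa [← hnorm, hX0 hle, zero_mul, Real.exp_zero, mul_one] at this
  · intro hlt
    have := B.eNorm_sol_le hT
    rwa [← hnorm, hX1 hlt] at this
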